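/- Let $G$ be a finite group. For finite $G$-sets $X,Y$, a \emph{span} from $X$ to $Y$ is a diagram of equivariant maps of finite $G$-sets $X\xleftarrow{p}A\xrightarrow{q}Y$, and a \emph{bispan} from $X$ to $Y$ is a diagram $X\xleftarrow{p}A\xrightarrow{q}B\xrightarrow{r}Y$. \emph{Mackey functors and Green semirings.} Let $\mathcal A_G$ be the category of finite $G$-sets and isomorphism classes of spans, with composition by fibre product; it is symmetric monoidal under the product of $G$-sets and of spans. A \emph{Mackey functor} is a functor $\mathcal A_G\to\mathrm{Sets}$ that preserves finite products (no additive inverses are required). The \emph{box product} $M\boxtimes N$ is the Day convolution product, i.e. the left Kan extension of $(X,Y)\mapsto M(X)\times N(Y)$ along $\times:\mathcal A_G\times\mathcal A_G\to\mathcal A_G$; it is symmetric monoidal, with unit the functor represented by the one-point $G$-set. A \emph{Green semiring} is a Mackey functor $S$ with a map $\mu:S\boxtimes S\to S$ that makes it a commutative (associative and unital) monoid for the box product. Green semirings, with the maps that preserve multiplication and unit, form a category. \emph{Green functors.} Let $\mathcal U_G$ be the category of finite $G$-sets and isomorphism classes of bispans, where the composite of $X\xleftarrow{p_0}A_0\xrightarrow{q_0}B_0\xrightarrow{r_0}Y$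 and $Y\xleftarrow{p_1}A_1\xrightarrow{q_1}B_1\xrightarrow{r_1}Z$ is the bispan $X\xleftarrow{p}A\xrightarrow{q}B\xrightarrow{r}Z$ with $$B=\{(b_1,s)\mid b_1\in B_1,\ s:q_1^{-1}\{b_1\}\to B_0,\ r_0s=p_1\},$$ $$A=\{(a_0,a_1,s)\mid a_1\in A_1,\ s:q_1^{-1}\{q_1(a_1)\}\to B_0,\ r_0s=p_1,\ a_0\in q_0^{-1}\{s(a_1)\}\}$$ (the maps $s$ need not be equivariant, and $G$ acts on them by conjugation), $p(a_0,a_1,s)=p_0(a_0)$, $q(a_0,a_1,s)=(q_1(a_1),s)$ and $r(b_1,s)=r_1(b_1)$. An equivariant map $f:U\to V$ is \emph{green} if for every $u\in U$ the isotropy group of $f(u)$ equals that of $u$. A bispan is \emph{green} if its middle map $q$ is green; the green bispans form a subcategory $\mathcal C_G\subseteq\mathcal U_G$ containing all objects. A \emph{Green functor} is a functor $\mathcal C_G\to\mathrm{Sets}$ that preserves finite products, and the morphisms of Green functors are the natural transformations. Then the category of Green functors is equivalent to the category of Green semirings. -/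

import Mathlib

open CategoryTheory MonoidalCategory

universe u w

/-- A finite `G`-set. -/
structure FinGSet (G : Type u) [Group G] where
  carrier : Type u
  [action : MulAction G carrier]
  [finite : Finite carrier]

namespace FinGSet

attribute [instance] FinGSet.action FinGSet.finite

instance (G : Type u) [Group G] : CoeSort (FinGSet G) (Type u) := ⟨FinGSet.carrier⟩

variable {G : Type u} [Group G]

/-- The one-point `G`-set. -/
def point (G : Type u) [Group G] : FinGSet G :=
  letI : MulAction G PUnit.{u + 1} :=
    { smul := fun _ x => x, one_smul := fun _ => rfl, mul_smul := fun _ _ _ => rfl }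
  ⟨PUnit⟩

/-- The product of two finite `G`-sets, with the diagonal action. -/
def prod (X Y : FinGSet G) : FinGSet G := ⟨X × Y⟩

/-- The fibre product of two maps of finite `G`-sets. -/
def pullback {X Y Z : FinGSet G} (f : X →[G] Z) (g : Y →[G] Z) : FinGSet G :=
  letI : MulAction G {x : X × Y // f x.1 = g x.2} :=
    { smul := fun k x => ⟨k • x.1, by
        change f (k • x.1.1) = g (k • x.1.2)
        rw [map_smul, map_smul, x.2]⟩
      one_smul := fun x => Subtype.ext (one_smul G x.1)
      mul_smul := fun a b x => Subtype.ext (mul_smul a b x.1) }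
  ⟨{x : X × Y // f x.1 = g x.2}⟩

end FinGSet

set_option linter.unusedVariables false
set_option linter.unusedSectionVars false

/-- A span `X ⟵ A ⟶ Y` of finite `G`-sets. -/
structure GSpan {G : Type u} [Group G] (X Y : FinGSet G) where
  A : FinGSet G
  p : A →[G] X
  q : A →[G] Y

namespace GSpan

variable {G : Type u} [Group G] {X Y Z W X' Y' Z' : FinGSet G}

/-- Isomorphism of spans: an equivariant bijection of the apices over `X` and `Y`. -/
def IsIso (ω ω' : GSpan X Y) : Prop :=
  ∃ e : ω.A ≃ ω'.A, (∀ (g : G) (a : ω.A), e (g • a) = g • e a) ∧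
    (∀ a, ω'.p (e a) = ω.p a) ∧ (∀ a, ω'.q (e a) = ω.q a)

theorem IsIso.refl (ω : GSpan X Y) : ω.IsIso ω :=
  ⟨Equiv.refl _, fun _ _ => rfl, fun _ => rfl, fun _ => rfl⟩

theorem IsIso.symm {ω ω' : GSpan X Y} (h : ω.IsIso ω') : ω'.IsIso ω := by
  obtain ⟨e, h₁, h₂, h₃⟩ := h
  refine ⟨e.symm, fun g a => ?_, fun a => ?_, fun a => ?_⟩
  · rw [Equiv.symm_apply_eq, h₁, Equiv.apply_symm_apply]
  · rw [← h₂, Equiv.apply_symm_apply]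
  · rw [← h₃, Equiv.apply_symm_apply]

theorem IsIso.trans {ω₁ ω₂ ω₃ : GSpan X Y} (h : ω₁.IsIso ω₂) (h' : ω₂.IsIso ω₃) :
    ω₁.IsIso ω₃ := by
  obtain ⟨e, h₁, h₂, h₃⟩ := h
  obtain ⟨e', h₁', h₂', h₃'⟩ := h'
  exact ⟨e.trans e', fun g a => by simp [h₁, h₁'], fun a => by simp [h₂, h₂'],
    fun a => by simp [h₃, h₃']⟩

instance setoid (X Y : FinGSet G) : Setoid (GSpan X Y) :=
  ⟨IsIso, IsIso.refl, IsIso.symm, IsIso.trans⟩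

/-- The identity span. -/
def id (X : FinGSet G) : GSpan X X := ⟨X, MulActionHom.id G, MulActionHom.id G⟩

/-- The composite of spans, formed with the fibre product over the middle `G`-set. -/
def comp (ω₀ : GSpan X Y) (ω₁ : GSpan Y Z) : GSpan X Z where
  A := FinGSet.pullback ω₀.q ω₁.p
  p := { toFun := fun a => ω₀.p a.1.1, map_smul' := fun g a => map_smul ω₀.p g a.1.1 }
  q := { toFun := fun a => ω₁.q a.1.2, map_smul' := fun g a => map_smul ω₁.q g a.1.2 }

/-- The product of two spans. -/
def prod (ω : GSpan X Y) (ω' : GSpan X' Y') : GSpan (X.prod X') (Y.prod Y') where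
  A := ω.A.prod ω'.A
  p := { toFun := fun a => (ω.p a.1, ω'.p a.2)
         map_smul' := fun g a => Prod.ext (map_smul ω.p g a.1) (map_smul ω'.p g a.2) }
  q := { toFun := fun a => (ω.q a.1, ω'.q a.2)
         map_smul' := fun g a => Prod.ext (map_smul ω.q g a.1) (map_smul ω'.q g a.2) }

/-- The span `X = X ⟶ Y` attached to a map `f : X ⟶ Y`. -/
def T (f : X →[G] Y) : GSpan X Y := ⟨X, MulActionHom.id G, f⟩

/-- The span `Y ⟵ X = X` attached to a map `f : X ⟶ Y`. -/
def R (f : X →[G] Y) : GSpan Y X := ⟨X, f, MulActionHom.id G⟩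

theorem comp_congr {ω₀ ω₀' : GSpan X Y} (h : ω₀.IsIso ω₀') {ω₁ ω₁' : GSpan Y Z}
    (h' : ω₁.IsIso ω₁') : (ω₀.comp ω₁).IsIso (ω₀'.comp ω₁') := by
  obtain ⟨e, h₁, h₂, h₃⟩ := h
  obtain ⟨e', h₁', h₂', h₃'⟩ := h'
  refine ⟨(e.prodCongr e').subtypeEquiv fun a => ?_, fun g a => ?_, fun a => h₂ _, fun a => h₃' _⟩
  · simp [h₃, h₂']
  · exact Subtype.ext (Prod.ext (h₁ g _) (h₁' g _))

theorem prod_congr {ω₀ ω₀' : GSpan X Y} (h : ω₀.IsIso ω₀') {ω₁ ω₁' : GSpan X' Y'}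
    (h' : ω₁.IsIso ω₁') : (ω₀.prod ω₁).IsIso (ω₀'.prod ω₁') := by
  obtain ⟨e, h₁, h₂, h₃⟩ := h
  obtain ⟨e', h₁', h₂', h₃'⟩ := h'
  exact ⟨e.prodCongr e', fun g a => Prod.ext (h₁ g _) (h₁' g _),
    fun a => Prod.ext (h₂ _) (h₂' _), fun a => Prod.ext (h₃ _) (h₃' _)⟩

theorem id_comp (ω : GSpan X Y) : ((id X).comp ω).IsIso ω := by
  refine ⟨⟨fun a => a.1.2, fun a => ⟨(ω.p a, a), rfl⟩, fun a => ?_, fun a => rfl⟩,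
    fun g a => rfl, fun a => a.2.symm, fun a => rfl⟩
  exact Subtype.ext (Prod.ext a.2.symm rfl)

theorem comp_id (ω : GSpan X Y) : (ω.comp (id Y)).IsIso ω := by
  refine ⟨⟨fun a => a.1.1, fun a => ⟨(a, ω.q a), rfl⟩, fun a => ?_, fun a => rfl⟩,
    fun g a => rfl, fun a => rfl, fun a => a.2⟩
  exact Subtype.ext (Prod.ext rfl a.2)

theorem comp_assoc (ω₀ : GSpan X Y) (ω₁ : GSpan Y Z) (ω₂ : GSpan Z W) :
    ((ω₀.comp ω₁).comp ω₂).IsIso (ω₀.comp (ω₁.comp ω₂)) :=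
  ⟨⟨fun a => ⟨(a.1.1.1.1, ⟨(a.1.1.1.2, a.1.2), a.2⟩), a.1.1.2⟩,
    fun a => ⟨(⟨(a.1.1, a.1.2.1.1), a.2⟩, a.1.2.1.2), a.1.2.2⟩, fun _ => rfl, fun _ => rfl⟩,
    fun _ _ => rfl, fun _ => rfl, fun _ => rfl⟩

theorem prod_id (X Y : FinGSet G) : ((id X).prod (id Y)).IsIso (id (X.prod Y)) :=
  ⟨Equiv.refl _, fun _ _ => rfl, fun _ => rfl, fun _ => rfl⟩

theorem prod_comp (ω₀ : GSpan X Y) (ω₁ : GSpan Y Z) (ω₀' : GSpan X' Y') (ω₁' : GSpan Y' Z') :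
    ((ω₀.comp ω₁).prod (ω₀'.comp ω₁')).IsIso ((ω₀.prod ω₀').comp (ω₁.prod ω₁')) :=
  ⟨⟨fun a => ⟨((a.1.1.1, a.2.1.1), (a.1.1.2, a.2.1.2)), Prod.ext a.1.2 a.2.2⟩,
    fun a => (⟨(a.1.1.1, a.1.2.1), congrArg Prod.fst a.2⟩,
      ⟨(a.1.1.2, a.1.2.2), congrArg Prod.snd a.2⟩), fun _ => rfl, fun _ => rfl⟩,
    fun _ _ => rfl, fun _ => rfl, fun _ => rfl⟩

theorem comp_T (ω : GSpan X Y) (f : Y →[G] Z) : (ω.comp (T f)).IsIso ⟨ω.A, ω.p, f.comp ω.q⟩ := by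
  refine ⟨⟨fun a => a.1.1, fun a => ⟨(a, ω.q a), rfl⟩, fun a => ?_, fun a => rfl⟩,
    fun g a => rfl, fun a => rfl, fun a => congrArg f a.2⟩
  exact Subtype.ext (Prod.ext rfl a.2)

theorem R_comp (ω : GSpan X Y) (f : X →[G] Z) : ((R f).comp ω).IsIso ⟨ω.A, f.comp ω.p, ω.q⟩ := by
  refine ⟨⟨fun a => a.1.2, fun a => ⟨(ω.p a, a), rfl⟩, fun a => ?_, fun a => rfl⟩,
    fun g a => rfl, fun a => congrArg f a.2.symm, fun a => rfl⟩
  exact Subtype.ext (Prod.ext a.2.symm rfl)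

theorem T_isIso_R (f : X →[G] Y) (f' : Y →[G] X) (h : ∀ x, f' (f x) = x) (h' : ∀ y, f (f' y) = y) :
    (T f).IsIso (R f') :=
  ⟨⟨f, f', h, h'⟩, fun g a => map_smul f g a, h, fun _ => rfl⟩

end GSpan

/-- The category whose objects are the finite `G`-sets and whose morphisms are the isomorphism
classes of spans. -/
structure SpanCat (G : Type u) [Group G] where
  of :: (toGSet : FinGSet G)

namespace SpanCat

variable {G : Type u} [Group G]

instance : Category.{u + 1} (SpanCat G) where
  Hom X Y := Quotient (GSpan.setoid X.toGSet Y.toGSet)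
  id X := Quotient.mk _ (GSpan.id X.toGSet)
  comp := Quotient.map₂ GSpan.comp fun _ _ h _ _ h' => GSpan.comp_congr h h'
  id_comp f := by
    induction f using Quotient.inductionOn with | h ω => exact Quotient.sound (GSpan.id_comp ω)
  comp_id f := by
    induction f using Quotient.inductionOn with | h ω => exact Quotient.sound (GSpan.comp_id ω)
  assoc f g h := by
    induction f, g using Quotient.inductionOn₂ with | h ω₀ ω₁ =>
    induction h using Quotient.inductionOn with | h ω₂ =>
    exact Quotient.sound (GSpan.comp_assoc ω₀ ω₁ ω₂)

/-- The morphism represented by a span. -/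
def mk {X Y : FinGSet G} (ω : GSpan X Y) : of X ⟶ of Y := Quotient.mk _ ω

theorem mk_eq {X Y : FinGSet G} {ω ω' : GSpan X Y} (h : ω.IsIso ω') : mk ω = mk ω' :=
  Quotient.sound h

theorem exists_mk {X Y : FinGSet G} (f : of X ⟶ of Y) : ∃ ω : GSpan X Y, mk ω = f :=
  Quotient.exists_rep f

theorem mk_comp {X Y Z : FinGSet G} (ω₀ : GSpan X Y) (ω₁ : GSpan Y Z) :
    mk ω₀ ≫ mk ω₁ = mk (ω₀.comp ω₁) := rfl

theorem mk_id (X : FinGSet G) : mk (GSpan.id X) = 𝟙 (of X) := rfl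

theorem mk_comp_T {X Y Z : FinGSet G} (ω : GSpan X Y) (f : Y →[G] Z) :
    mk ω ≫ mk (GSpan.T f) = mk ⟨ω.A, ω.p, f.comp ω.q⟩ := mk_eq (GSpan.comp_T ω f)

theorem mk_T_comp_T {X Y Z : FinGSet G} (f : X →[G] Y) (g : Y →[G] Z) :
    mk (GSpan.T f) ≫ mk (GSpan.T g) = mk (GSpan.T (g.comp f)) := mk_comp_T _ _

/-- The product of two equivariant maps. -/
def prodMap {X Y X' Y' : FinGSet G} (f : X →[G] Y) (g : X' →[G] Y') :
    X.prod X' →[G] Y.prod Y' where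
  toFun a := (f a.1, g a.2)
  map_smul' k a := Prod.ext (map_smul f k a.1) (map_smul g k a.2)

theorem mk_prod_T_id {X Y : FinGSet G} (f : X →[G] Y) (Z : FinGSet G) :
    mk ((GSpan.T f).prod (GSpan.id Z)) =
      mk (GSpan.T (prodMap f (MulActionHom.id G))) := rfl

theorem mk_prod_id_T {X Y : FinGSet G} (f : X →[G] Y) (Z : FinGSet G) :
    mk ((GSpan.id Z).prod (GSpan.T f)) =
      mk (GSpan.T (prodMap (MulActionHom.id G) f)) := rfl

/-- The isomorphism attached to an equivariant bijection. -/
def isoT {X Y : FinGSet G} (f : X →[G] Y) (f' : Y →[G] X) (h : ∀ x, f' (f x) = x)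
    (h' : ∀ y, f (f' y) = y) : of X ≅ of Y where
  hom := mk (GSpan.T f)
  inv := mk (GSpan.T f')
  hom_inv_id := (mk_comp_T _ _).trans <| mk_eq
    ⟨Equiv.refl _, fun _ _ => rfl, fun _ => rfl, fun a => (h a).symm⟩
  inv_hom_id := (mk_comp_T _ _).trans <| mk_eq
    ⟨Equiv.refl _, fun _ _ => rfl, fun _ => rfl, fun a => (h' a).symm⟩

theorem isoT_hom_comp {X Y Z : FinGSet G} (f : X →[G] Y) (f' : Y →[G] X) (h : ∀ x, f' (f x) = x)
    (h' : ∀ y, f (f' y) = y) (ω : GSpan Y Z) :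
    mk (GSpan.T f) ≫ mk ω = mk ⟨ω.A, f'.comp ω.p, ω.q⟩ := by
  rw [mk_eq (GSpan.T_isIso_R f f' h h')]
  exact mk_eq (GSpan.R_comp ω f')

/-- The product of morphisms. -/
def map₂ {X Y X' Y' : SpanCat G} (f : X ⟶ Y) (g : X' ⟶ Y') :
    of (X.toGSet.prod X'.toGSet) ⟶ of (Y.toGSet.prod Y'.toGSet) :=
  Quotient.map₂ GSpan.prod (fun _ _ h _ _ h' => GSpan.prod_congr h h') f g

def assocHom (X Y Z : FinGSet G) : (X.prod Y).prod Z →[G] X.prod (Y.prod Z) where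
  toFun a := (a.1.1, (a.1.2, a.2))
  map_smul' _ _ := rfl

def assocInv (X Y Z : FinGSet G) : X.prod (Y.prod Z) →[G] (X.prod Y).prod Z where
  toFun a := ((a.1, a.2.1), a.2.2)
  map_smul' _ _ := rfl

def leftHom (X : FinGSet G) : (FinGSet.point G).prod X →[G] X where
  toFun a := a.2
  map_smul' _ _ := rfl

def leftInv (X : FinGSet G) : X →[G] (FinGSet.point G).prod X where
  toFun a := (PUnit.unit, a)
  map_smul' _ _ := rfl

def rightHom (X : FinGSet G) : X.prod (FinGSet.point G) →[G] X where
  toFun a := a.1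
  map_smul' _ _ := rfl

def rightInv (X : FinGSet G) : X →[G] X.prod (FinGSet.point G) where
  toFun a := (a, PUnit.unit)
  map_smul' _ _ := rfl

def swap (X Y : FinGSet G) : X.prod Y →[G] Y.prod X where
  toFun a := (a.2, a.1)
  map_smul' _ _ := rfl

/-- The monoidal structure given by the product of `G`-sets and of spans; the coherence
isomorphisms are the evident bijections. -/
instance : MonoidalCategoryStruct (SpanCat G) where
  tensorObj X Y := of (X.toGSet.prod Y.toGSet)
  tensorUnit := of (FinGSet.point G)
  tensorHom f g := map₂ f g
  whiskerLeft X _ _ f := map₂ (𝟙 X) f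
  whiskerRight f Y := map₂ f (𝟙 Y)
  associator X Y Z := isoT (assocHom X.toGSet Y.toGSet Z.toGSet)
    (assocInv X.toGSet Y.toGSet Z.toGSet) (fun _ => rfl) (fun _ => rfl)
  leftUnitor X := isoT (leftHom X.toGSet) (leftInv X.toGSet) (fun _ => rfl) (fun _ => rfl)
  rightUnitor X := isoT (rightHom X.toGSet) (rightInv X.toGSet) (fun _ => rfl) (fun _ => rfl)

theorem mk_tensor {X Y X' Y' : FinGSet G} (ω : GSpan X Y) (ω' : GSpan X' Y') :
    mk ω ⊗ₘ mk ω' = mk (ω.prod ω') := rfl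

theorem mk_eq_of {X Y : FinGSet G} {ω ω' : GSpan X Y} (e : ω.A ≃ ω'.A)
    (h₁ : ∀ (g : G) (a : ω.A), e (g • a) = g • e a)
    (h₂ : ∀ a, ω'.p (e a) = ω.p a) (h₃ : ∀ a, ω'.q (e a) = ω.q a) : mk ω = mk ω' :=
  mk_eq ⟨e, h₁, h₂, h₃⟩

instance : MonoidalCategory (SpanCat G) :=
  .ofTensorHom
    (id_tensorHom_id := fun X Y => mk_eq (GSpan.prod_id _ _))
    (tensorHom_comp_tensorHom := fun f₁ f₂ g₁ g₂ => by
      obtain ⟨a, rfl⟩ := exists_mk f₁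
      obtain ⟨b, rfl⟩ := exists_mk f₂
      obtain ⟨c, rfl⟩ := exists_mk g₁
      obtain ⟨d, rfl⟩ := exists_mk g₂
      exact (mk_eq (GSpan.prod_comp a c b d)).symm)
    (associator_naturality := fun f₁ f₂ f₃ => by
      obtain ⟨a, rfl⟩ := exists_mk f₁
      obtain ⟨b, rfl⟩ := exists_mk f₂
      obtain ⟨c, rfl⟩ := exists_mk f₃
      refine (mk_comp_T _ _).trans (Eq.trans ?_
        (isoT_hom_comp (assocHom _ _ _) (assocInv _ _ _) (fun _ => rfl) (fun _ => rfl) _).symm)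
      exact mk_eq_of (Equiv.prodAssoc a.A b.A c.A) (fun _ _ => rfl) (fun _ => rfl) (fun _ => rfl))
    (leftUnitor_naturality := fun f => by
      obtain ⟨a, rfl⟩ := exists_mk f
      refine (mk_comp_T _ _).trans (Eq.trans ?_
        (isoT_hom_comp (leftHom _) (leftInv _) (fun _ => rfl) (fun _ => rfl) _).symm)
      exact mk_eq_of (Equiv.punitProd a.A : PUnit.{u + 1} × a.A ≃ a.A) (fun _ _ => rfl) (fun _ => rfl) (fun _ => rfl))
    (rightUnitor_naturality := fun f => by
      obtain ⟨a, rfl⟩ := exists_mk f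
      refine (mk_comp_T _ _).trans (Eq.trans ?_
        (isoT_hom_comp (rightHom _) (rightInv _) (fun _ => rfl) (fun _ => rfl) _).symm)
      exact mk_eq_of (Equiv.prodPUnit a.A : a.A × PUnit.{u + 1} ≃ a.A) (fun _ _ => rfl) (fun _ => rfl) (fun _ => rfl))
    (pentagon := fun W X Y Z => by
      change mk (GSpan.prod (GSpan.T (assocHom W.toGSet X.toGSet Y.toGSet)) (GSpan.id Z.toGSet)) ≫
          mk (GSpan.T (assocHom W.toGSet (X.toGSet.prod Y.toGSet) Z.toGSet)) ≫
            mk (GSpan.prod (GSpan.id W.toGSet) (GSpan.T (assocHom X.toGSet Y.toGSet Z.toGSet))) =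
        mk (GSpan.T (assocHom (W.toGSet.prod X.toGSet) Y.toGSet Z.toGSet)) ≫
          mk (GSpan.T (assocHom W.toGSet X.toGSet (Y.toGSet.prod Z.toGSet)))
      rw [mk_prod_T_id, mk_prod_id_T, mk_T_comp_T, mk_T_comp_T, mk_T_comp_T]
      rfl)
    (triangle := fun X Y => by
      change mk (GSpan.T (assocHom X.toGSet (FinGSet.point G) Y.toGSet)) ≫
          mk (GSpan.prod (GSpan.id X.toGSet) (GSpan.T (leftHom Y.toGSet))) =
        mk (GSpan.prod (GSpan.T (rightHom X.toGSet)) (GSpan.id Y.toGSet))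
      rw [mk_prod_T_id, mk_prod_id_T, mk_T_comp_T]
      rfl)

theorem swap_natural {X Y X' Y' : SpanCat G} (f : X ⟶ Y) (g : X' ⟶ Y') :
    (f ⊗ₘ g) ≫ mk (GSpan.T (swap Y.toGSet Y'.toGSet)) =
      mk (GSpan.T (swap X.toGSet X'.toGSet)) ≫ (g ⊗ₘ f) := by
  obtain ⟨a, rfl⟩ := exists_mk f
  obtain ⟨b, rfl⟩ := exists_mk g
  refine (mk_comp_T _ _).trans (Eq.trans ?_
    (isoT_hom_comp (swap _ _) (swap _ _) (fun _ => rfl) (fun _ => rfl) _).symm)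
  exact mk_eq_of (Equiv.prodComm a.A b.A) (fun _ _ => rfl) (fun _ => rfl) (fun _ => rfl)

/-- The symmetry of the product. -/
instance : SymmetricCategory (SpanCat G) where
  braiding X Y := isoT (swap X.toGSet Y.toGSet) (swap Y.toGSet X.toGSet)
    (fun _ => rfl) (fun _ => rfl)
  braiding_naturality_right X _ _ f := swap_natural (𝟙 X) f
  braiding_naturality_left f Z := swap_natural f (𝟙 Z)
  hexagon_forward X Y Z := by
    change mk (GSpan.T (assocHom X.toGSet Y.toGSet Z.toGSet)) ≫
        mk (GSpan.T (swap X.toGSet (Y.toGSet.prod Z.toGSet))) ≫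
          mk (GSpan.T (assocHom Y.toGSet Z.toGSet X.toGSet)) =
      mk (GSpan.prod (GSpan.T (swap X.toGSet Y.toGSet)) (GSpan.id Z.toGSet)) ≫
        mk (GSpan.T (assocHom Y.toGSet X.toGSet Z.toGSet)) ≫
          mk (GSpan.prod (GSpan.id Y.toGSet) (GSpan.T (swap X.toGSet Z.toGSet)))
    rw [mk_prod_T_id, mk_prod_id_T, mk_T_comp_T, mk_T_comp_T, mk_T_comp_T, mk_T_comp_T]
    rfl
  hexagon_reverse X Y Z := by
    change mk (GSpan.T (assocInv X.toGSet Y.toGSet Z.toGSet)) ≫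
        mk (GSpan.T (swap (X.toGSet.prod Y.toGSet) Z.toGSet)) ≫
          mk (GSpan.T (assocInv Z.toGSet X.toGSet Y.toGSet)) =
      mk (GSpan.prod (GSpan.id X.toGSet) (GSpan.T (swap Y.toGSet Z.toGSet))) ≫
        mk (GSpan.T (assocInv X.toGSet Z.toGSet Y.toGSet)) ≫
          mk (GSpan.prod (GSpan.T (swap X.toGSet Z.toGSet)) (GSpan.id Y.toGSet))
    rw [mk_prod_T_id, mk_prod_id_T, mk_T_comp_T, mk_T_comp_T, mk_T_comp_T, mk_T_comp_T]
    rfl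
  symmetry X Y := (isoT (swap X.toGSet Y.toGSet) (swap Y.toGSet X.toGSet)
    (fun _ => rfl) (fun _ => rfl)).hom_inv_id

end SpanCat

/-- A bispan `X ⟵ A ⟶ B ⟶ Y` of finite `G`-sets. -/
structure GBispan {G : Type u} [Group G] (X Y : FinGSet G) where
  A : FinGSet G
  B : FinGSet G
  p : A →[G] X
  q : A →[G] B
  r : B →[G] Y

namespace GBispan

variable {G : Type u} [Group G] {X Y Z W : FinGSet G}

/-- An isomorphism of bispans from `X` to `Y`: a pair of equivariant bijections compatible with all
the structure maps. -/
structure Iso (ω ω' : GBispan X Y) where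
  α : ω.A ≃ ω'.A
  β : ω.B ≃ ω'.B
  α_smul : ∀ (g : G) (a : ω.A), α (g • a) = g • α a
  β_smul : ∀ (g : G) (b : ω.B), β (g • b) = g • β b
  p_α : ∀ a, ω'.p (α a) = ω.p a
  q_α : ∀ a, ω'.q (α a) = β (ω.q a)
  r_β : ∀ b, ω'.r (β b) = ω.r b

/-- The identity isomorphism. -/
def Iso.refl (ω : GBispan X Y) : Iso ω ω :=
  ⟨Equiv.refl _, Equiv.refl _, fun _ _ => rfl, fun _ _ => rfl, fun _ => rfl, fun _ => rfl,
    fun _ => rfl⟩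

/-- The inverse of an isomorphism of bispans. -/
def Iso.symm {ω ω' : GBispan X Y} (i : Iso ω ω') : Iso ω' ω where
  α := i.α.symm
  β := i.β.symm
  α_smul g a := by rw [Equiv.symm_apply_eq, i.α_smul, Equiv.apply_symm_apply]
  β_smul g a := by rw [Equiv.symm_apply_eq, i.β_smul, Equiv.apply_symm_apply]
  p_α a := by rw [← i.p_α, Equiv.apply_symm_apply]
  q_α a := by rw [Equiv.eq_symm_apply, ← i.q_α, Equiv.apply_symm_apply]
  r_β a := by rw [← i.r_β, Equiv.apply_symm_apply]

/-- The composite of isomorphisms of bispans. -/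
def Iso.trans {ω₁ ω₂ ω₃ : GBispan X Y} (i : Iso ω₁ ω₂) (j : Iso ω₂ ω₃) : Iso ω₁ ω₃ where
  α := i.α.trans j.α
  β := i.β.trans j.β
  α_smul g a := by simp [i.α_smul, j.α_smul]
  β_smul g a := by simp [i.β_smul, j.β_smul]
  p_α a := by simp [i.p_α, j.p_α]
  q_α a := by simp [i.q_α, j.q_α]
  r_β a := by simp [i.r_β, j.r_β]

instance setoid (X Y : FinGSet G) : Setoid (GBispan X Y) :=
  ⟨fun ω ω' => Nonempty (Iso ω ω'), fun ω => ⟨Iso.refl ω⟩, fun ⟨i⟩ => ⟨i.symm⟩,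
    fun ⟨i⟩ ⟨j⟩ => ⟨i.trans j⟩⟩

/-- The identity bispan. -/
def id (X : FinGSet G) : GBispan X X :=
  ⟨X, X, MulActionHom.id G, MulActionHom.id G, MulActionHom.id G⟩

/-- The set of pairs `(b, s)` with `b ∈ B₁` and `s : q₁⁻¹{b} → B₀` a map such that `r₀ s = p₁`;
here `s` need not be equivariant. -/
structure CompB (ω₀ : GBispan X Y) (ω₁ : GBispan Y Z) where
  b : ω₁.B
  s : ∀ a : ω₁.A, ω₁.q a = b → ω₀.B
  r_s : ∀ a h, ω₀.r (s a h) = ω₁.p a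

/-- The set of triples `(a₀, a₁, s)` with `a₁ ∈ A₁`, `s : q₁⁻¹{q₁ a₁} → B₀` a map such that
`r₀ s = p₁`, and `a₀ ∈ q₀⁻¹{s a₁}`. -/
structure CompA (ω₀ : GBispan X Y) (ω₁ : GBispan Y Z) where
  a₀ : ω₀.A
  a₁ : ω₁.A
  s : ∀ a : ω₁.A, ω₁.q a = ω₁.q a₁ → ω₀.B
  r_s : ∀ a h, ω₀.r (s a h) = ω₁.p a
  q_a₀ : ω₀.q a₀ = s a₁ rfl

section comp

variable {ω₀ : GBispan X Y} {ω₁ : GBispan Y Z}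

theorem CompB.ext {x y : CompB ω₀ ω₁} (hb : x.b = y.b)
    (hs : ∀ a h h', x.s a h = y.s a h') : x = y := by
  obtain ⟨b, s, hr⟩ := x
  obtain ⟨b', s', hr'⟩ := y
  obtain rfl : b = b' := hb
  obtain rfl : s = s' := funext fun a => funext fun h => hs a h h
  rfl

theorem CompA.ext {x y : CompA ω₀ ω₁} (h₀ : x.a₀ = y.a₀) (h₁ : x.a₁ = y.a₁)
    (hs : ∀ a h h', x.s a h = y.s a h') : x = y := by
  obtain ⟨a₀, a₁, s, hr, hq⟩ := x
  obtain ⟨a₀', a₁', s', hr', hq'⟩ := y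
  obtain rfl : a₀ = a₀' := h₀
  obtain rfl : a₁ = a₁' := h₁
  obtain rfl : s = s' := funext fun a => funext fun h => hs a h h
  rfl

theorem CompB.s_congr (x : CompB ω₀ ω₁) {a a' : ω₁.A} (e : a = a') (h : ω₁.q a = x.b)
    (h' : ω₁.q a' = x.b) : x.s a h = x.s a' h' := by
  subst e; rfl

theorem CompA.s_congr (x : CompA ω₀ ω₁) {a a' : ω₁.A} (e : a = a') (h : ω₁.q a = ω₁.q x.a₁)
    (h' : ω₁.q a' = ω₁.q x.a₁) : x.s a h = x.s a' h' := by
  subst e; rfl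

theorem CompB.s_eq {x y : CompB ω₀ ω₁} (e : x = y) {a a' : ω₁.A} (ha : a = a') (h : ω₁.q a = x.b)
    (h' : ω₁.q a' = y.b) : x.s a h = y.s a' h' := by
  subst e; subst ha; rfl

/-- `G` acts by `g (b, s) = (g b, g s g⁻¹)`. -/
instance : MulAction G (CompB ω₀ ω₁) where
  smul g x :=
    { b := g • x.b
      s := fun a h => g • x.s (g⁻¹ • a) (by rw [map_smul, h, inv_smul_smul])
      r_s := fun a h => by rw [map_smul, x.r_s, map_smul, smul_inv_smul] }
  one_smul x := CompB.ext (one_smul G x.b) fun a h h' =>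
    (one_smul G _).trans (x.s_congr (by rw [inv_one, one_smul]) _ _)
  mul_smul g k x := CompB.ext (mul_smul g k x.b) fun a h h' =>
    (mul_smul g k _).trans (congrArg (fun b => g • k • b)
      (x.s_congr (by rw [mul_inv_rev, mul_smul]) _ _))

/-- `G` acts by `g (a₀, a₁, s) = (g a₀, g a₁, g s g⁻¹)`. -/
instance : MulAction G (CompA ω₀ ω₁) where
  smul g x :=
    { a₀ := g • x.a₀
      a₁ := g • x.a₁
      s := fun a h => g • x.s (g⁻¹ • a) (by rw [map_smul, h, map_smul, inv_smul_smul])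
      r_s := fun a h => by rw [map_smul, x.r_s, map_smul, smul_inv_smul]
      q_a₀ := by
        rw [map_smul, x.q_a₀]
        exact congrArg (g • ·) (x.s_congr (inv_smul_smul g x.a₁).symm _ _) }
  one_smul x := CompA.ext (one_smul G x.a₀) (one_smul G x.a₁) fun a h h' =>
    (one_smul G _).trans (x.s_congr (by rw [inv_one, one_smul]) _ _)
  mul_smul g k x := CompA.ext (mul_smul g k x.a₀) (mul_smul g k x.a₁) fun a h h' =>
    (mul_smul g k _).trans (congrArg (fun b => g • k • b)
      (x.s_congr (by rw [mul_inv_rev, mul_smul]) _ _))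

instance : Finite (CompB ω₀ ω₁) :=
  Finite.of_injective
    (fun x => (⟨x.b, x.s⟩ : Σ b : ω₁.B, ∀ a : ω₁.A, ω₁.q a = b → ω₀.B)) fun x y e => by
    obtain ⟨b, s, hr⟩ := x
    obtain ⟨b', s', hr'⟩ := y
    cases e
    rfl

instance : Finite (CompA ω₀ ω₁) :=
  Finite.of_injective
    (fun x => (⟨x.a₀, x.a₁, x.s⟩ :
      Σ _ : ω₀.A, Σ a₁ : ω₁.A, ∀ a : ω₁.A, ω₁.q a = ω₁.q a₁ → ω₀.B)) fun x y e => by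
    obtain ⟨a₀, a₁, s, hr, hq⟩ := x
    obtain ⟨a₀', a₁', s', hr', hq'⟩ := y
    cases e
    rfl

end comp

/-- The composite bispan `X ⟵ A ⟶ B ⟶ Z`, with `p (a₀, a₁, s) = p₀ a₀`,
`q (a₀, a₁, s) = (q₁ a₁, s)` and `r (b, s) = r₁ b`. -/
def comp (ω₀ : GBispan X Y) (ω₁ : GBispan Y Z) : GBispan X Z where
  A := ⟨CompA ω₀ ω₁⟩
  B := ⟨CompB ω₀ ω₁⟩
  p := { toFun := fun x => ω₀.p x.a₀, map_smul' := fun g x => map_smul ω₀.p g x.a₀ }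
  q := { toFun := fun x => ⟨ω₁.q x.a₁, x.s, x.r_s⟩
         map_smul' := fun g x => CompB.ext (map_smul ω₁.q g x.a₁) fun _ _ _ => rfl }
  r := { toFun := fun x => ω₁.r x.b, map_smul' := fun g x => map_smul ω₁.r g x.b }

/-- The map of middle sets induced by isomorphisms of bispans. -/
def mapB {ω₀ ω₀' : GBispan X Y} (i : Iso ω₀ ω₀') {ω₁ ω₁' : GBispan Y Z} (j : Iso ω₁ ω₁')
    (x : CompB ω₀ ω₁) : CompB ω₀' ω₁' where
  b := j.β x.b
  s a h := i.β (x.s (j.symm.α a) ((j.symm.q_α a).trans ((Equiv.symm_apply_eq _).2 h)))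
  r_s a h := by rw [i.r_β, x.r_s]; exact j.symm.p_α a

/-- The map of left hand sets induced by isomorphisms of bispans. -/
def mapA {ω₀ ω₀' : GBispan X Y} (i : Iso ω₀ ω₀') {ω₁ ω₁' : GBispan Y Z} (j : Iso ω₁ ω₁')
    (x : CompA ω₀ ω₁) : CompA ω₀' ω₁' where
  a₀ := i.α x.a₀
  a₁ := j.α x.a₁
  s a h := i.β (x.s (j.symm.α a)
    ((j.symm.q_α a).trans ((Equiv.symm_apply_eq _).2 (h.trans (j.q_α _)))))
  r_s a h := by rw [i.r_β, x.r_s]; exact j.symm.p_α a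
  q_a₀ := by
    rw [i.q_α, x.q_a₀]
    exact congrArg i.β (x.s_congr (j.α.symm_apply_apply _).symm _ _)

/-- Composition of bispans respects isomorphism. -/
def compIso {ω₀ ω₀' : GBispan X Y} (i : Iso ω₀ ω₀') {ω₁ ω₁' : GBispan Y Z} (j : Iso ω₁ ω₁') :
    Iso (ω₀.comp ω₁) (ω₀'.comp ω₁') where
  α :=
    { toFun := mapA i j
      invFun := mapA i.symm j.symm
      left_inv := fun x => CompA.ext (i.α.symm_apply_apply _) (j.α.symm_apply_apply _)
        fun a h h' => (i.β.symm_apply_apply _).trans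
          (x.s_congr (j.α.symm_apply_apply a) _ _)
      right_inv := fun x => CompA.ext (i.α.apply_symm_apply _) (j.α.apply_symm_apply _)
        fun a h h' => (i.β.apply_symm_apply _).trans
          (x.s_congr (j.α.apply_symm_apply a) _ _) }
  β :=
    { toFun := mapB i j
      invFun := mapB i.symm j.symm
      left_inv := fun x => CompB.ext (j.β.symm_apply_apply _)
        fun a h h' => (i.β.symm_apply_apply _).trans
          (x.s_congr (j.α.symm_apply_apply a) _ _)
      right_inv := fun x => CompB.ext (j.β.apply_symm_apply _)
        fun a h h' => (i.β.apply_symm_apply _).trans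
          (x.s_congr (j.α.apply_symm_apply a) _ _) }
  α_smul g x := CompA.ext (i.α_smul g _) (j.α_smul g _) fun a h h' =>
    (i.β_smul g _).trans (congrArg (fun b => g • i.β b)
      (x.s_congr (j.symm.α_smul g⁻¹ a).symm _ _))
  β_smul g x := CompB.ext (j.β_smul g _) fun a h h' =>
    (i.β_smul g _).trans (congrArg (fun b => g • i.β b)
      (x.s_congr (j.symm.α_smul g⁻¹ a).symm _ _))
  p_α x := i.p_α _
  q_α x := CompB.ext (j.q_α _) fun _ _ _ => rfl
  r_β x := j.r_β _

/-- The left unit law. -/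
def idComp (ω : GBispan X Y) : Iso ((id X).comp ω) ω where
  α :=
    { toFun := fun x => x.a₁
      invFun := fun a => ⟨ω.p a, a, fun a' _ => ω.p a', fun _ _ => rfl, rfl⟩
      left_inv := fun x => CompA.ext ((x.r_s x.a₁ rfl).symm.trans x.q_a₀.symm) rfl
        fun a h h' => (x.r_s a h').symm
      right_inv := fun _ => rfl }
  β :=
    { toFun := fun x => x.b
      invFun := fun b => ⟨b, fun a' _ => ω.p a', fun _ _ => rfl⟩
      left_inv := fun x => CompB.ext rfl fun a h h' => (x.r_s a h').symm
      right_inv := fun _ => rfl }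
  α_smul _ _ := rfl
  β_smul _ _ := rfl
  p_α x := (x.r_s x.a₁ rfl).symm.trans x.q_a₀.symm
  q_α _ := rfl
  r_β _ := rfl

/-- The right unit law. -/
def compId (ω : GBispan X Y) : Iso (ω.comp (id Y)) ω where
  α :=
    { toFun := fun x => x.a₀
      invFun := fun a => ⟨a, ω.r (ω.q a), fun _ _ => ω.q a, fun _ h => h.symm, rfl⟩
      left_inv := fun x => CompA.ext rfl ((congrArg ω.r x.q_a₀).trans (x.r_s x.a₁ rfl))
        fun a h h' => x.q_a₀.trans (x.s_congr (Eq.symm h') _ _)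
      right_inv := fun _ => rfl }
  β :=
    { toFun := fun x => x.s x.b rfl
      invFun := fun b => ⟨ω.r b, fun _ _ => b, fun _ h => h.symm⟩
      left_inv := fun x => CompB.ext (x.r_s x.b rfl)
        fun a h h' => x.s_congr (Eq.symm h') _ _
      right_inv := fun _ => rfl }
  α_smul _ _ := rfl
  β_smul g x := congrArg (g • ·) (x.s_congr (inv_smul_smul g x.b) _ _)
  p_α _ := rfl
  q_α x := x.q_a₀
  r_β x := x.r_s x.b rfl

section assoc

variable (ω₀ : GBispan X Y) (ω₁ : GBispan Y Z) (ω₂ : GBispan Z W)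

/-- The associativity map on the middle sets. -/
def assocB (x : CompB (ω₀.comp ω₁) ω₂) : CompB ω₀ (ω₁.comp ω₂) where
  b := ⟨x.b, fun a h => (x.s a h).b, x.r_s⟩
  s y h := (x.s y.a₁ (congrArg CompB.b h)).s y.a₀
    (y.q_a₀.trans (CompB.s_eq h rfl _ _))
  r_s y h := (x.s y.a₁ (congrArg CompB.b h)).r_s y.a₀ _

/-- The inverse of the associativity map on the middle sets. -/
def assocB' (x : CompB ω₀ (ω₁.comp ω₂)) : CompB (ω₀.comp ω₁) ω₂ where
  b := x.b.b
  s a₂ h₂ :=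
    { b := x.b.s a₂ h₂
      s := fun a₁ h₁ => x.s ⟨a₁, a₂, fun a h => x.b.s a (h.trans h₂), fun a h => x.b.r_s a _, h₁⟩
        (CompB.ext h₂ fun _ _ _ => rfl)
      r_s := fun a₁ h₁ => x.r_s _ _ }
  r_s a₂ h₂ := x.b.r_s a₂ h₂

/-- The associativity map on the left hand sets. -/
def assocA (x : CompA (ω₀.comp ω₁) ω₂) : CompA ω₀ (ω₁.comp ω₂) where
  a₀ := x.a₀.a₀
  a₁ := ⟨x.a₀.a₁, x.a₁, fun a h => (x.s a h).b, x.r_s, congrArg CompB.b x.q_a₀⟩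
  s y h := (x.s y.a₁ (congrArg CompB.b h)).s y.a₀
    (y.q_a₀.trans (CompB.s_eq h rfl _ _))
  r_s y h := (x.s y.a₁ (congrArg CompB.b h)).r_s y.a₀ _
  q_a₀ := x.a₀.q_a₀.trans (CompB.s_eq x.q_a₀ rfl _ _)

/-- The inverse of the associativity map on the left hand sets. -/
def assocA' (x : CompA ω₀ (ω₁.comp ω₂)) : CompA (ω₀.comp ω₁) ω₂ where
  a₀ :=
    { a₀ := x.a₀
      a₁ := x.a₁.a₀
      s := fun a h => x.s ⟨a, x.a₁.a₁, x.a₁.s, x.a₁.r_s, h.trans x.a₁.q_a₀⟩ rfl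
      r_s := fun a h => x.r_s _ _
      q_a₀ := x.q_a₀ }
  a₁ := x.a₁.a₁
  s a₂ h₂ :=
    { b := x.a₁.s a₂ h₂
      s := fun a₁ h₁ =>
        x.s ⟨a₁, a₂, fun a h => x.a₁.s a (h.trans h₂), fun a h => x.a₁.r_s a _, h₁⟩
          (CompB.ext h₂ fun _ _ _ => rfl)
      r_s := fun a₁ h₁ => x.r_s _ _ }
  r_s a₂ h₂ := x.a₁.r_s a₂ h₂
  q_a₀ := CompB.ext x.a₁.q_a₀ fun _ _ _ => rfl

/-- The associativity isomorphism. -/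
def assocIso : Iso ((ω₀.comp ω₁).comp ω₂) (ω₀.comp (ω₁.comp ω₂)) where
  α :=
    { toFun := assocA ω₀ ω₁ ω₂
      invFun := assocA' ω₀ ω₁ ω₂
      left_inv := fun x => CompA.ext
        (CompA.ext rfl rfl fun a h h' => CompB.s_eq x.q_a₀.symm rfl _ _) rfl
        fun a h h' => rfl
      right_inv := fun x => CompA.ext rfl rfl fun y h h' => by
        refine x.s_congr (a := ⟨y.a₀, y.a₁, _, _, _⟩) ?_ _ h'
        exact CompA.ext rfl rfl fun a k k' => CompB.s_eq (Eq.symm h') rfl _ k' }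
  β :=
    { toFun := assocB ω₀ ω₁ ω₂
      invFun := assocB' ω₀ ω₁ ω₂
      left_inv := fun x => CompB.ext rfl fun a h h' => rfl
      right_inv := fun x => CompB.ext rfl fun y h h' => by
        refine x.s_congr (a := ⟨y.a₀, y.a₁, _, _, _⟩) ?_ _ h'
        exact CompA.ext rfl rfl fun a k k' => CompB.s_eq (Eq.symm h') rfl _ k' }
  α_smul g x := rfl
  β_smul g x := rfl
  p_α x := rfl
  q_α x := rfl
  r_β x := rfl

end assoc

/-- An equivariant map is green if it preserves isotropy groups. -/
def _root_.FinGSet.IsGreen {U V : FinGSet G} (f : U →[G] V) : Prop :=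
  ∀ u : U, MulAction.stabilizer G (f u) = MulAction.stabilizer G u

/-- A bispan is green if its middle map is green. -/
def IsGreen (ω : GBispan X Y) : Prop := FinGSet.IsGreen ω.q

theorem isGreen_iff (ω : GBispan X Y) :
    ω.IsGreen ↔ ∀ (g : G) (a : ω.A), g • ω.q a = ω.q a → g • a = a := by
  refine ⟨fun h g a e => ?_, fun h a => le_antisymm (fun g e => h g a e) fun g e => ?_⟩
  · have : g ∈ MulAction.stabilizer G (ω.q a) := e
    rwa [h a] at this
  · change g • ω.q a = ω.q a
    rw [← map_smul]
    exact congrArg ω.q e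

theorem IsGreen.of_iso {ω ω' : GBispan X Y} (i : Iso ω ω') (h : ω.IsGreen) : ω'.IsGreen := by
  rw [isGreen_iff] at h ⊢
  intro g a e
  apply i.symm.α.injective
  rw [i.symm.α_smul]
  apply h
  rw [i.symm.q_α, ← i.symm.β_smul, e]

theorem isGreen_id (X : FinGSet G) : (id X).IsGreen := fun _ => rfl

theorem IsGreen.comp {ω₀ : GBispan X Y} {ω₁ : GBispan Y Z} (h₀ : ω₀.IsGreen) (h₁ : ω₁.IsGreen) :
    (ω₀.comp ω₁).IsGreen := by
  rw [isGreen_iff] at h₀ h₁ ⊢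
  intro g x e
  have e₁ : g • x.a₁ = x.a₁ := h₁ g x.a₁ (congrArg CompB.b e)
  have e₁' : g⁻¹ • x.a₁ = x.a₁ := by rw [inv_smul_eq_iff, e₁]
  have e₂ : ∀ a (h : ω₁.q a = ω₁.q x.a₁) h', g • x.s (g⁻¹ • a) h' = x.s a h :=
    fun a h h' => CompB.s_eq e (rfl : a = a) (h.trans (congrArg CompB.b e).symm) h
  refine CompA.ext (h₀ g x.a₀ ?_) e₁ fun a h h' => e₂ a h' _
  rw [x.q_a₀]
  refine Eq.trans ?_ (e₂ x.a₁ rfl (by rw [e₁']))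
  exact congrArg (g • ·) (x.s_congr e₁'.symm _ _)

end GBispan

/-- The category whose objects are the finite `G`-sets and whose morphisms are the isomorphism
classes of bispans. -/
structure BispanCat (G : Type u) [Group G] where
  of :: (toGSet : FinGSet G)

namespace BispanCat

variable {G : Type u} [Group G]

instance : Category.{u + 1} (BispanCat G) where
  Hom X Y := Quotient (GBispan.setoid X.toGSet Y.toGSet)
  id X := Quotient.mk _ (GBispan.id X.toGSet)
  comp := Quotient.map₂ GBispan.comp fun _ _ ⟨i⟩ _ _ ⟨j⟩ => ⟨GBispan.compIso i j⟩
  id_comp f := by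
    induction f using Quotient.inductionOn with | h ω => exact Quotient.sound ⟨GBispan.idComp ω⟩
  comp_id f := by
    induction f using Quotient.inductionOn with | h ω => exact Quotient.sound ⟨GBispan.compId ω⟩
  assoc f g h := by
    induction f, g using Quotient.inductionOn₂ with | h ω₀ ω₁ =>
    induction h using Quotient.inductionOn with | h ω₂ =>
    exact Quotient.sound ⟨GBispan.assocIso ω₀ ω₁ ω₂⟩

/-- The morphisms represented by green bispans. -/
def green (G : Type u) [Group G] : MorphismProperty (BispanCat G) := fun X Y f =>
  ∃ ω : GBispan X.toGSet Y.toGSet, Quotient.mk _ ω = f ∧ ω.IsGreen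

/-- A morphism is green if and only if all the bispans that represent it are green. -/
theorem green_mk_iff {X Y : BispanCat G} (ω : GBispan X.toGSet Y.toGSet) :
    green G (show X ⟶ Y from Quotient.mk _ ω) ↔ ω.IsGreen := by
  refine ⟨fun ⟨ω', e, h⟩ => ?_, fun h => ⟨ω, rfl, h⟩⟩
  obtain ⟨i⟩ := Quotient.exact e
  exact h.of_iso i

instance : (green G).IsMultiplicative where
  id_mem X := ⟨GBispan.id X.toGSet, rfl, GBispan.isGreen_id _⟩
  comp_mem := by
    rintro X Y Z _ _ ⟨ω₀, rfl, h₀⟩ ⟨ω₁, rfl, h₁⟩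
    exact ⟨ω₀.comp ω₁, rfl, h₀.comp h₁⟩

end BispanCat

/-- The subcategory of green bispans. -/
abbrev GreenBispanCat (G : Type u) [Group G] : Type (u + 1) := WideSubcategory (BispanCat.green G)

section small

variable {G : Type u} [Group G]

/-- Every finite `G`-set is isomorphic to `Fin n` with some action of `G`. -/
theorem FinGSet.exists_fin (X : FinGSet G) :
    ∃ (c : Σ n : ℕ, (G →* Equiv.Perm (Fin n))) (e : X ≃ Fin c.1),
      ∀ (g : G) (x : X), e (g • x) = c.2 g (e x) := by
  obtain ⟨n, ⟨e⟩⟩ := Finite.exists_equiv_fin X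
  refine ⟨⟨n, (e.permCongrHom : Equiv.Perm X →* Equiv.Perm (Fin n)).comp
    (MulAction.toPermHom G X)⟩, e, fun g x => ?_⟩
  simp

theorem FinGSet.exists_equiv {X Y : FinGSet G} {c : Σ n : ℕ, (G →* Equiv.Perm (Fin n))}
    (e : X ≃ Fin c.1) (he : ∀ (g : G) (x : X), e (g • x) = c.2 g (e x))
    (e' : Y ≃ Fin c.1) (he' : ∀ (g : G) (x : Y), e' (g • x) = c.2 g (e' x)) (g : G) (x : X) :
    (e.trans e'.symm) (g • x) = g • (e.trans e'.symm) x := by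
  simp [he, Equiv.symm_apply_eq, he']

theorem GSpan.exists_fin {X Y : FinGSet G} (ω : GSpan X Y) :
    ∃ (k : Σ c : (Σ n : ℕ, (G →* Equiv.Perm (Fin n))), (Fin c.1 → X) × (Fin c.1 → Y))
      (e : ω.A ≃ Fin k.1.1), (∀ (g : G) (a : ω.A), e (g • a) = k.1.2 g (e a)) ∧
        (∀ a, k.2.1 (e a) = ω.p a) ∧ (∀ a, k.2.2 (e a) = ω.q a) := by
  obtain ⟨c, e, he⟩ := ω.A.exists_fin
  exact ⟨⟨c, fun i => ω.p (e.symm i), fun i => ω.q (e.symm i)⟩, e, he, fun a => by simp,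
    fun a => by simp⟩

variable [Finite G]

instance FinGSet.finite_actions (n : ℕ) : Finite (G →* Equiv.Perm (Fin n)) :=
  Finite.of_injective (fun f => (f : G → Equiv.Perm (Fin n))) DFunLike.coe_injective

/-- There are countably many isomorphism classes of finite `G`-sets and of spans, so the category
of spans is essentially small. -/
instance SpanCat.essentiallySmall : EssentiallySmall.{w} (SpanCat G) := by
  rw [essentiallySmall_iff]
  constructor
  · have : Countable (Skeleton (SpanCat G)) := by
      choose c hc using FinGSet.exists_fin (G := G)
      refine Function.Injective.countable
        (f := fun X => c ((fromSkeleton (SpanCat G)).obj X).toGSet) fun X Y h => ?_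
      obtain ⟨e, he⟩ := hc ((fromSkeleton (SpanCat G)).obj X).toGSet
      have hY := hc ((fromSkeleton (SpanCat G)).obj Y).toGSet
      rw [← show c _ = c _ from h] at hY
      obtain ⟨e', he'⟩ := hY
      refine skeleton_skeletal _ ⟨(fromSkeleton (SpanCat G)).preimageIso ?_⟩
      exact SpanCat.isoT ⟨e.trans e'.symm, FinGSet.exists_equiv e he e' he'⟩
        ⟨e'.trans e.symm, FinGSet.exists_equiv e' he' e he⟩
        (e.trans e'.symm).symm_apply_apply (e.trans e'.symm).apply_symm_apply
    exact Countable.toSmall _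
  · constructor
    intro X Y
    have : Countable (X ⟶ Y) := by
      choose k hk using GSpan.exists_fin (X := X.toGSet) (Y := Y.toGSet)
      refine Function.Injective.countable (f := fun f => k (Quotient.out f)) fun f f' h => ?_
      obtain ⟨e, he, h₁, h₂⟩ := hk (Quotient.out f)
      have hf' := hk (Quotient.out f')
      rw [← show k _ = k _ from h] at hf'
      obtain ⟨e', he', h₁', h₂'⟩ := hf'
      rw [← Quotient.out_eq f, ← Quotient.out_eq f']
      refine Quotient.sound ⟨e.trans e'.symm, FinGSet.exists_equiv e he e' he',
        fun a => ?_, fun a => ?_⟩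
      · rw [← h₁, ← h₁']; simp
      · rw [← h₂, ← h₂']; simp
    exact Countable.toSmall _

end small

section day

open Limits MonoidalCategory.ExternalProduct

variable {G : Type u} [Group G] [Finite G]

instance SpanCat.essentiallySmall_prod : EssentiallySmall.{w} (SpanCat G × SpanCat G) :=
  .mk' ((equivSmallModel.{w} (SpanCat G)).prod (equivSmallModel.{w} (SpanCat G)))

instance SpanCat.locallySmall : LocallySmall.{w} (SpanCat G) :=
  ((essentiallySmall_iff (SpanCat G)).1 inferInstance).2

instance SpanCat.hasPointwiseLeftKanExtension (M N : SpanCat G ⥤ Type w) :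
    (tensor (SpanCat G)).HasPointwiseLeftKanExtension (M ⊠ N) := fun d =>
  haveI := hasColimitsOfShape_of_essentiallySmall.{w}
    (CostructuredArrow (tensor (SpanCat G)) d) (Type w)
  inferInstance

instance SpanCat.hasPointwiseLeftKanExtension_unit :
    (Functor.fromPUnit.{0} <| 𝟙_ (SpanCat G)).HasPointwiseLeftKanExtension
        (Functor.fromPUnit.{0} <| 𝟙_ (Type w)) := fun d =>
  haveI := hasColimitsOfShape_of_essentiallySmall.{w}
    (CostructuredArrow (Functor.fromPUnit.{0} <| 𝟙_ (SpanCat G)) d) (Type w)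
  inferInstance

end day

section braiding

open MonoidalCategory.ExternalProduct MonoidalCategory.DayFunctor
  LawfulDayConvolutionMonoidalCategoryStruct

universe v₁ v₂ u₁ u₂

variable {C : Type u₁} [Category.{v₁} C] [MonoidalCategory C] [SymmetricCategory C]
  {V : Type u₂} [Category.{v₂} V] [MonoidalCategory V] [SymmetricCategory V]
  [∀ (F G : C ⥤ V), (tensor C).HasPointwiseLeftKanExtension (F ⊠ G)]
  [(Functor.fromPUnit.{0} <| 𝟙_ C).HasPointwiseLeftKanExtension
    (Functor.fromPUnit.{0} <| 𝟙_ V)]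
  [∀ (v : V) (d : C), Limits.PreservesColimitsOfShape
    (CostructuredArrow (tensor C) d) (tensorLeft v)]
  [∀ (v : V) (d : C), Limits.PreservesColimitsOfShape
    (CostructuredArrow (tensor C) d) (tensorRight v)]
  [∀ (v : V) (d : C), Limits.PreservesColimitsOfShape
    (CostructuredArrow (Functor.fromPUnit.{0} <| 𝟙_ C) d) (tensorLeft v)]
  [∀ (v : V) (d : C), Limits.PreservesColimitsOfShape
    (CostructuredArrow (Functor.fromPUnit.{0} <| 𝟙_ C) d) (tensorRight v)]
  [∀ (v : V) (d : C × C), Limits.PreservesColimitsOfShape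
    (CostructuredArrow ((𝟭 C).prod <| Functor.fromPUnit.{0} <| 𝟙_ C) d) (tensorRight v)]
  [∀ (v : V) (d : C × C), Limits.PreservesColimitsOfShape
    (CostructuredArrow ((tensor C).prod (𝟭 C)) d) (tensorRight v)]

attribute [local instance] convolution convolution₂ convolution₂'

/-- The braiding of the Day convolution product. -/
noncomputable def dayBraiding (F G : C ⊛⥤ V) : F ⊗ G ≅ G ⊗ F :=
  letI e := DayConvolution.braiding ((ι C V (C ⊛⥤ V)).obj F) ((ι C V (C ⊛⥤ V)).obj G)
  { hom := ⟨e.hom⟩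
    inv := ⟨e.inv⟩
    hom_inv_id := DayFunctor.hom_ext e.hom_inv_id
    inv_hom_id := DayFunctor.hom_ext e.inv_hom_id }

theorem map_dayBraiding_hom (F G : C ⊛⥤ V) :
    (ι C V (C ⊛⥤ V)).map (dayBraiding F G).hom =
      (DayConvolution.braiding ((ι C V (C ⊛⥤ V)).obj F) ((ι C V (C ⊛⥤ V)).obj G)).hom := rfl

theorem map_day_associator_inv (X Y Z : C ⊛⥤ V) :
    (ι C V (C ⊛⥤ V)).map (α_ X Y Z).inv =
      (DayConvolution.associator ((ι C V (C ⊛⥤ V)).obj X) ((ι C V (C ⊛⥤ V)).obj Y)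
        ((ι C V (C ⊛⥤ V)).obj Z)).inv :=
  congrArg Iso.inv (Iso.ext (α := (ι C V (C ⊛⥤ V)).mapIso (α_ X Y Z))
    (ι_map_associator_hom_eq_associator_hom C V (C ⊛⥤ V) X Y Z))

/-- The Day convolution product is symmetric. -/
noncomputable instance daySymmetric : SymmetricCategory (C ⊛⥤ V) where
  braiding := dayBraiding
  braiding_naturality_right X Y Z f := by
    apply Functor.Faithful.map_injective (F := ι C V (C ⊛⥤ V))
    rw [← id_tensorHom, ← tensorHom_id]
    simp only [Functor.map_comp, ι_map_tensorHom_hom_eq_tensorHom,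
      map_dayBraiding_hom]
    exact DayConvolution.braiding_naturality_right _ ((ι C V (C ⊛⥤ V)).map f)
  braiding_naturality_left f Z := by
    apply Functor.Faithful.map_injective (F := ι C V (C ⊛⥤ V))
    rw [← id_tensorHom, ← tensorHom_id]
    simp only [Functor.map_comp, ι_map_tensorHom_hom_eq_tensorHom,
      map_dayBraiding_hom]
    exact DayConvolution.braiding_naturality_left ((ι C V (C ⊛⥤ V)).map f) _
  hexagon_forward X Y Z := by
    apply Functor.Faithful.map_injective (F := ι C V (C ⊛⥤ V))
    rw [← id_tensorHom, ← tensorHom_id]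
    simp only [Functor.map_comp, ι_map_tensorHom_hom_eq_tensorHom,
      map_dayBraiding_hom, ι_map_associator_hom_eq_associator_hom]
    exact DayConvolution.hexagon_forward ((ι C V (C ⊛⥤ V)).obj X) ((ι C V (C ⊛⥤ V)).obj Y)
      ((ι C V (C ⊛⥤ V)).obj Z)
  hexagon_reverse X Y Z := by
    apply Functor.Faithful.map_injective (F := ι C V (C ⊛⥤ V))
    rw [← id_tensorHom, ← tensorHom_id]
    simp only [Functor.map_comp, ι_map_tensorHom_hom_eq_tensorHom,
      map_dayBraiding_hom, map_day_associator_inv]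
    exact DayConvolution.hexagon_reverse ((ι C V (C ⊛⥤ V)).obj X) ((ι C V (C ⊛⥤ V)).obj Y)
      ((ι C V (C ⊛⥤ V)).obj Z)
  symmetry X Y := by
    apply Functor.Faithful.map_injective (F := ι C V (C ⊛⥤ V))
    simp only [Functor.map_comp, map_dayBraiding_hom]
    exact DayConvolution.symmetry ((ι C V (C ⊛⥤ V)).obj X) ((ι C V (C ⊛⥤ V)).obj Y)

end braiding

section categories

open scoped MonoidalCategory.DayFunctor

/-- A Mackey functor (with values in sets): a functor from the category of spans of finite `G`-sets
to sets that preserves finite products. -/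
def IsMackey (G : Type u) [Group G] : ObjectProperty (SpanCat G ⥤ Type w) :=
  fun M => Limits.PreservesFiniteProducts M

/-- The commutative monoids for the box product (the Day convolution product of functors
`SpanCat G ⥤ Type w`) whose underlying functor is a Mackey functor. -/
def isGreenSemiring (G : Type u) [Group G] [Finite G] :
    ObjectProperty (CommMon (SpanCat G ⊛⥤ Type w)) :=
  fun S => IsMackey G S.X.functor

/-- The category of Green semirings: Mackey functors with a commutative monoid structure for the
box product, and homomorphisms of commutative monoids. -/
abbrev GreenSemiring (G : Type u) [Group G] [Finite G] :=
  (isGreenSemiring.{u, w} G).FullSubcategory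

/-- The functors from the category of green bispans to sets that preserve finite products. -/
def isGreenFunctor (G : Type u) [Group G] : ObjectProperty (GreenBispanCat G ⥤ Type w) :=
  fun S => Limits.PreservesFiniteProducts S

/-- The category of Green functors and natural transformations. -/
abbrev GreenFunctor (G : Type u) [Group G] := (isGreenFunctor.{u, w} G).FullSubcategory

end categories

/-!
Both categories are compared with a third one, the category `FrobeniusFunctor G` of Mackey functors
`M` with a commutative multiplication on every set `M(X)` such that restrictions are homomorphisms
and Frobenius reciprocity `f_*(x · f^* y) = f_* x · y` holds.

*Green functors.* Spans are the bispans whose middle map is an identity, so a Green functor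
restricts to a Mackey functor; the norms along the fold maps `X ⊔ X ⟶ X` and `∅ ⟶ X` provide the
multiplications, and an exponential diagram (`GreenBispanCat.T_comp_norm_fold`) gives Frobenius
reciprocity. Conversely, the multiplications determine the norms along all green maps. A green map
`q : A ⟶ B` preserves isotropy, so a map `f : T ⟶ B` from a transitive `G`-set can be lifted through
every point of the fibre over `f t`. After base change to `T` the map `q` therefore is a fold map
from a disjoint union of copies of `T`, and the norm of `s ∈ M(A)` has to restrict along `f` to the
product of the elements `σ^* s` over the lifts `σ : T ⟶ A` of `f`
(`GreenBispanCat.nm_eq_norm`). An element of `M(B)` is the same as a compatible family of elements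
on the transitive `G`-sets over `B` (`SpanCat.IsAdditive.existsUnique_glue`), so this formula also
defines a norm for a given multiplication, `FrobeniusFunctor.norm`. That restriction, norm
and transfer define a functor on green bispans comes down to the exchange of a norm with a transfer,
`FrobeniusFunctor.norm_res_tr_norm`. Over a transitive `G`-set `T` it says that a product of
transfers is the transfer of a product from a fibre product (`FrobeniusFunctor.prod_res_tr`), which
is iterated Frobenius reciprocity; the middle set in the composite of two bispans is this fibre
product (`FrobeniusFunctor.isFibreFamily_evalSection`).

*Green semirings.* The box product is a Kan extension, so a map `M ⊠ M ⟶ M` is a natural family of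
exterior products `M(X) × M(Y) ⟶ M(X × Y)`. Exterior and interior products determine one another by
`x ⊠ y = pr₁^* x · pr₂^* y` and `x · y = Δ^* (x ⊠ y)`, and naturality of the exterior product for
spans corresponds to compatibility of the interior product with restrictions together with Frobenius
reciprocity.
-/

/-! ### Finite `G`-sets: disjoint unions and fibre products -/

namespace FinGSet

variable {G : Type u} [Group G] {X Y Z W P : FinGSet G}

/-- The disjoint union of two finite `G`-sets. -/
def sum (X Y : FinGSet G) : FinGSet G := ⟨X ⊕ Y⟩

/-- The empty `G`-set. -/
def empty (G : Type u) [Group G] : FinGSet G :=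
  letI : MulAction G PEmpty.{u + 1} :=
    { smul := fun _ x => x, one_smul := fun _ => rfl, mul_smul := fun _ _ _ => rfl }
  ⟨PEmpty⟩

instance : IsEmpty (empty G) := inferInstanceAs (IsEmpty PEmpty)

/-- The first inclusion into a disjoint union. -/
def inl : X →[G] X.sum Y := ⟨Sum.inl, fun _ _ => rfl⟩

/-- The second inclusion into a disjoint union. -/
def inr : Y →[G] X.sum Y := ⟨Sum.inr, fun _ _ => rfl⟩

/-- The map out of a disjoint union with given restrictions. -/
def desc (f : X →[G] Z) (g : Y →[G] Z) : X.sum Y →[G] Z where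
  toFun := Sum.elim f g
  map_smul' k a := by
    rcases a with a | a
    · exact map_smul f k a
    · exact map_smul g k a

/-- The map from the empty `G`-set. -/
def fromEmpty (X : FinGSet G) : empty G →[G] X where
  toFun x := isEmptyElim x
  map_smul' _ x := isEmptyElim x

theorem inl_injective : Function.Injective (inl : X →[G] X.sum Y) := Sum.inl_injective

theorem inr_injective : Function.Injective (inr : Y →[G] X.sum Y) := Sum.inr_injective

theorem inl_ne_inr (x : X) (y : Y) : (inl x : X.sum Y) ≠ inr y := Sum.inl_ne_inr

theorem sum_cases (a : X.sum Y) : (∃ x, inl x = a) ∨ ∃ y, inr y = a := by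
  rcases a with a | a
  · exact Or.inl ⟨a, rfl⟩
  · exact Or.inr ⟨a, rfl⟩

theorem desc_bijective {f : X →[G] Z} {g : Y →[G] Z} (hf : Function.Injective f)
    (hg : Function.Injective g) (hfg : ∀ x y, f x ≠ g y)
    (h : ∀ z, (∃ x, f x = z) ∨ ∃ y, g y = z) : Function.Bijective (desc f g) := by
  constructor
  · exact hf.sumElim hg hfg
  · intro z
    rcases h z with ⟨x, rfl⟩ | ⟨y, rfl⟩
    · exact ⟨inl x, rfl⟩
    · exact ⟨inr y, rfl⟩

/-- The inverse of an equivariant bijection. -/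
noncomputable def inverse (f : X →[G] Y) (hf : Function.Bijective f) : Y →[G] X where
  toFun := (Equiv.ofBijective f hf).symm
  map_smul' g y := by
    rw [Equiv.symm_apply_eq, Equiv.ofBijective_apply, id, map_smul]
    exact congrArg (g • ·) (Equiv.ofBijective_apply_symm_apply f hf y).symm

theorem apply_inverse (f : X →[G] Y) (hf : Function.Bijective f) (y : Y) :
    f (inverse f hf y) = y := Equiv.ofBijective_apply_symm_apply f hf y

/-- The commutative square of equivariant maps formed by `a : P ⟶ X`, `b : P ⟶ Y`, `f : X ⟶ Z` and
`g : Y ⟶ Z` is cartesian. -/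
structure IsFibreProduct (a : P →[G] X) (b : P →[G] Y) (f : X →[G] Z) (g : Y →[G] Z) : Prop where
  comm : ∀ p, f (a p) = g (b p)
  ext : ∀ p p', a p = a p' → b p = b p' → p = p'
  exists_eq : ∀ x y, f x = g y → ∃ p, a p = x ∧ b p = y

namespace IsFibreProduct

variable {a : P →[G] X} {b : P →[G] Y} {f : X →[G] Z} {g : Y →[G] Z}

theorem symm (h : IsFibreProduct a b f g) : IsFibreProduct b a g f where
  comm p := (h.comm p).symm
  ext p p' h₁ h₂ := h.ext p p' h₂ h₁
  exists_eq y x e := (h.exists_eq x y e.symm).imp fun _ => And.symm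

theorem comp_bijective (h : IsFibreProduct a b f g) (e : W →[G] P) (he : Function.Bijective e) :
    IsFibreProduct (a.comp e) (b.comp e) f g where
  comm p := h.comm (e p)
  ext p p' h₁ h₂ := he.1 (h.ext _ _ h₁ h₂)
  exists_eq x y k := by
    obtain ⟨p, h₁, h₂⟩ := h.exists_eq x y k
    obtain ⟨w, rfl⟩ := he.2 p
    exact ⟨w, h₁, h₂⟩

theorem paste {V Q : FinGSet G} {c : Q →[G] V} {d : Q →[G] P} {k : V →[G] X}
    (h' : IsFibreProduct c d k a) (h : IsFibreProduct a b f g) :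
    IsFibreProduct c (b.comp d) (f.comp k) g where
  comm p := (congrArg f (h'.comm p)).trans (h.comm (d p))
  ext p p' h₁ h₂ := h'.ext p p' h₁
    (h.ext _ _ (((h'.comm p).symm.trans (congrArg k h₁)).trans (h'.comm p')) h₂)
  exists_eq v y e := by
    obtain ⟨p, h₁, h₂⟩ := h.exists_eq (k v) y e
    obtain ⟨q, h₃, h₄⟩ := h'.exists_eq v p h₁.symm
    exact ⟨q, h₃, (congrArg b h₄).trans h₂⟩

end IsFibreProduct

/-- A finite `G`-set over a disjoint union is the disjoint union of its parts over the summands. -/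
theorem desc_bijective_of_isFibreProduct {f : W →[G] X.sum Y} {P₁ P₂ : FinGSet G}
    {i₁ : P₁ →[G] W} {j₁ : P₁ →[G] X} {i₂ : P₂ →[G] W} {j₂ : P₂ →[G] Y}
    (h₁ : IsFibreProduct i₁ j₁ f inl) (h₂ : IsFibreProduct i₂ j₂ f inr) :
    Function.Bijective (desc i₁ i₂) := by
  refine desc_bijective (fun a b h => h₁.ext a b h ?_) (fun a b h => h₂.ext a b h ?_)
    (fun x y h => ?_) fun w => ?_
  · exact inl_injective ((h₁.comm a).symm.trans ((congrArg f h).trans (h₁.comm b)))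
  · exact inr_injective ((h₂.comm a).symm.trans ((congrArg f h).trans (h₂.comm b)))
  · exact inl_ne_inr _ _ ((h₁.comm x).symm.trans ((congrArg f h).trans (h₂.comm y)))
  · rcases sum_cases (f w) with ⟨x, hx⟩ | ⟨y, hy⟩
    · exact Or.inl ((h₁.exists_eq w x hx.symm).imp fun _ => And.left)
    · exact Or.inr ((h₂.exists_eq w y hy.symm).imp fun _ => And.left)

/-- The disjoint union of two maps. -/
def sumMap (f : X →[G] Z) (g : Y →[G] W) : X.sum Y →[G] Z.sum W :=
  desc (inl.comp f) (inr.comp g)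

theorem isFibreProduct_inl (f : X →[G] Z) (g : Y →[G] W) :
    IsFibreProduct inl f (sumMap f g) inl := by
  refine ⟨fun _ => rfl, fun _ _ h _ => inl_injective h, fun x y h => ?_⟩
  obtain ⟨x, rfl⟩ | ⟨x, rfl⟩ := sum_cases x
  · exact ⟨x, rfl, inl_injective h⟩
  · exact (inl_ne_inr _ _ h.symm).elim

theorem isFibreProduct_inr (f : X →[G] Z) (g : Y →[G] W) :
    IsFibreProduct inr g (sumMap f g) inr := by
  refine ⟨fun _ => rfl, fun _ _ h _ => inr_injective h, fun x y h => ?_⟩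
  obtain ⟨x, rfl⟩ | ⟨x, rfl⟩ := sum_cases x
  · exact (inl_ne_inr _ _ h).elim
  · exact ⟨x, rfl, inr_injective h⟩

/-- The first projection of a fibre product. -/
def pullbackFst (f : X →[G] Z) (g : Y →[G] Z) : pullback f g →[G] X :=
  ⟨fun p => p.1.1, fun _ _ => rfl⟩

/-- The second projection of a fibre product. -/
def pullbackSnd (f : X →[G] Z) (g : Y →[G] Z) : pullback f g →[G] Y :=
  ⟨fun p => p.1.2, fun _ _ => rfl⟩

theorem isFibreProduct_pullback (f : X →[G] Z) (g : Y →[G] Z) :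
    IsFibreProduct (pullbackFst f g) (pullbackSnd f g) f g where
  comm p := p.2
  ext _ _ h₁ h₂ := Subtype.ext (Prod.ext h₁ h₂)
  exists_eq x y e := ⟨⟨(x, y), e⟩, rfl, rfl⟩

/-- The first projection of a product. -/
def fst (X Y : FinGSet G) : X.prod Y →[G] X := ⟨Prod.fst, fun _ _ => rfl⟩

/-- The second projection of a product. -/
def snd (X Y : FinGSet G) : X.prod Y →[G] Y := ⟨Prod.snd, fun _ _ => rfl⟩

/-- The map to a product with given components. -/
def lift (f : X →[G] Y) (g : X →[G] Z) : X →[G] Y.prod Z :=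
  ⟨fun x => (f x, g x), fun k x => Prod.ext (map_smul f k x) (map_smul g k x)⟩

/-- The map to the point. -/
def toPoint (X : FinGSet G) : X →[G] point G := ⟨fun _ => PUnit.unit, fun _ _ => rfl⟩

theorem isFibreProduct_id_left (f : X →[G] Y) :
    IsFibreProduct (MulActionHom.id G) f f (MulActionHom.id G) :=
  ⟨fun _ => rfl, fun _ _ h _ => h, fun x _ h => ⟨x, rfl, h⟩⟩

theorem isFibreProduct_of_injective {f : X →[G] Y} (hf : Function.Injective f) :
    IsFibreProduct (MulActionHom.id G) (MulActionHom.id G) f f :=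
  ⟨fun _ => rfl, fun _ _ h _ => h, fun x _ h => ⟨x, rfl, hf h⟩⟩

end FinGSet

/-! ### Spans -/

namespace SpanCat

open FinGSet

variable {G : Type u} [Group G] {X Y Z W P : FinGSet G}

theorem mk_eq_of_bijective {ω ω' : GSpan X Y} (e : ω.A →[G] ω'.A) (he : Function.Bijective e)
    (h₁ : ∀ a, ω'.p (e a) = ω.p a) (h₂ : ∀ a, ω'.q (e a) = ω.q a) : mk ω = mk ω' :=
  mk_eq ⟨Equiv.ofBijective e he, fun g a => map_smul e g a, h₁, h₂⟩

theorem mk_eq_R_comp_T (ω : GSpan X Y) : mk ω = mk (GSpan.R ω.p) ≫ mk (GSpan.T ω.q) :=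
  (mk_eq (GSpan.R_comp (GSpan.T ω.q) ω.p)).symm

theorem mk_R_comp (f : X →[G] Y) (ω : GSpan X Z) :
    mk (GSpan.R f) ≫ mk ω = mk ⟨ω.A, f.comp ω.p, ω.q⟩ := mk_eq (GSpan.R_comp ω f)

/-- A span is composed with a reversed map by base change along any fibre product. -/
theorem mk_comp_R (ω : GSpan X Y) (f : Z →[G] Y) {a : P →[G] ω.A} {b : P →[G] Z}
    (h : IsFibreProduct a b ω.q f) : mk ω ≫ mk (GSpan.R f) = mk ⟨P, ω.p.comp a, b⟩ := by
  symm
  refine mk_eq_of_bijective (ω' := ω.comp (GSpan.R f))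
    ⟨fun p => ⟨(a p, b p), h.comm p⟩, fun g p => Subtype.ext (Prod.ext (map_smul a g p)
      (map_smul b g p))⟩ ⟨fun p p' e => ?_, fun x => ?_⟩ (fun p => rfl) fun p => rfl
  · exact h.ext p p' (congrArg (fun x => x.1.1) e) (congrArg (fun x => x.1.2) e)
  · obtain ⟨p, h₁, h₂⟩ := h.exists_eq x.1.1 x.1.2 x.2
    exact ⟨p, Subtype.ext (Prod.ext h₁ h₂)⟩

/-- Base change of transfers. -/
theorem mk_T_comp_R {f : X →[G] Z} {g : Y →[G] Z} {a : P →[G] X} {b : P →[G] Y}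
    (h : IsFibreProduct a b f g) :
    mk (GSpan.T f) ≫ mk (GSpan.R g) = mk (GSpan.R a) ≫ mk (GSpan.T b) := by
  rw [← mk_eq_R_comp_T ⟨P, a, b⟩]
  exact mk_comp_R (GSpan.T f) g h

/-- The disjoint union is a product in the category of spans. -/
theorem existsUnique_lift (f : of W ⟶ of X) (g : of W ⟶ of Y) :
    ∃! k : of W ⟶ of (X.sum Y), k ≫ mk (GSpan.R inl) = f ∧ k ≫ mk (GSpan.R inr) = g := by
  obtain ⟨ω₁, rfl⟩ := exists_mk f
  obtain ⟨ω₂, rfl⟩ := exists_mk g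
  refine ⟨mk ⟨ω₁.A.sum ω₂.A, desc ω₁.p ω₂.p, sumMap ω₁.q ω₂.q⟩,
    ⟨mk_comp_R ⟨_, desc ω₁.p ω₂.p, _⟩ inl (isFibreProduct_inl ω₁.q ω₂.q),
      mk_comp_R ⟨_, desc ω₁.p ω₂.p, _⟩ inr (isFibreProduct_inr ω₁.q ω₂.q)⟩, ?_⟩
  · rintro k ⟨h₁, h₂⟩
    obtain ⟨ω, rfl⟩ := exists_mk k
    rw [mk_comp_R ω inl (isFibreProduct_pullback _ _)] at h₁
    rw [mk_comp_R ω inr (isFibreProduct_pullback _ _)] at h₂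
    obtain ⟨e₁, s₁, p₁, q₁⟩ := Quotient.exact h₁.symm
    obtain ⟨e₂, s₂, p₂, q₂⟩ := Quotient.exact h₂.symm
    symm
    have i₁ := (isFibreProduct_pullback ω.q inl).comp_bijective ⟨e₁, s₁⟩ e₁.bijective
    have i₂ := (isFibreProduct_pullback ω.q inr).comp_bijective ⟨e₂, s₂⟩ e₂.bijective
    refine mk_eq_of_bijective (desc _ _) (desc_bijective_of_isFibreProduct i₁ i₂) ?_ ?_
    · rintro (a | a)
      exacts [p₁ a, p₂ a]
    · rintro (a | a)
      exacts [(i₁.comm a).trans (congrArg inl (q₁ a)), (i₂.comm a).trans (congrArg inr (q₂ a))]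

/-- The empty `G`-set is terminal in the category of spans. -/
theorem existsUnique_to_empty (X : FinGSet G) : ∃! k : of X ⟶ of (FinGSet.empty G), True := by
  refine ⟨mk ⟨FinGSet.empty G, fromEmpty _, MulActionHom.id G⟩, trivial, fun k _ => ?_⟩
  obtain ⟨ω, rfl⟩ := exists_mk k
  exact mk_eq_of_bijective ω.q ⟨fun a => isEmptyElim (ω.q a), fun b => isEmptyElim b⟩
    (fun a => isEmptyElim (ω.q a)) fun a => rfl

end SpanCat

/-! ### Preservation of finite products -/

open Limits in
/-- If `C` has the terminal object `t` and the binary products `pr X Y`, then a functor to sets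
preserves finite products if and only if it preserves these. -/
theorem preservesFiniteProducts_type_iff {C : Type*} [Category* C] (F : C ⥤ Type w) (t : C)
    (ht : ∀ X : C, ∃! k : X ⟶ t, True) (pr : C → C → C) (fst : ∀ X Y, pr X Y ⟶ X)
    (snd : ∀ X Y, pr X Y ⟶ Y)
    (hp : ∀ (X Y W : C) (f : W ⟶ X) (g : W ⟶ Y),
      ∃! k : W ⟶ pr X Y, k ≫ fst X Y = f ∧ k ≫ snd X Y = g) :
    PreservesFiniteProducts F ↔ (∃! x : F.obj t, True) ∧
      ∀ X Y, Function.Bijective fun z : F.obj (pr X Y) =>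
        ((F.map (fst X Y) z, F.map (snd X Y) z) : F.obj X × F.obj Y) := by
  have ht' : IsTerminal t := IsTerminal.ofUniqueHom (fun X => (ht X).choose)
    fun X m => (ht X).choose_spec.2 m trivial
  have hp' (X Y : C) : IsLimit (BinaryFan.mk (fst X Y) (snd X Y)) :=
    BinaryFan.IsLimit.mk _ (fun f g => (hp X Y _ f g).choose)
      (fun f g => (hp X Y _ f g).choose_spec.1.1) (fun f g => (hp X Y _ f g).choose_spec.1.2)
      fun f g m h₁ h₂ => (hp X Y _ f g).choose_spec.2 m ⟨h₁, h₂⟩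
  have hbij (X Y : C) : Nonempty (IsLimit (BinaryFan.mk (F.map (fst X Y)) (F.map (snd X Y)))) ↔
      Function.Bijective fun z : F.obj (pr X Y) =>
        ((F.map (fst X Y) z, F.map (snd X Y) z) : F.obj X × F.obj Y) := by
    constructor
    · rintro ⟨h⟩
      exact ((isIso_iff_bijective _).1
        (h.conePointUniqueUpToIso (Types.binaryProductLimit _ _)).isIso_hom)
    · intro h
      let e := Equiv.ofBijective _ h
      refine ⟨BinaryFan.IsLimit.mk _ (fun f g => ↾fun x => e.symm (f x, g x)) (fun f g => ?_)
        (fun f g => ?_) fun f g m h₁ h₂ => ?_⟩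
      · ext x
        exact congrArg Prod.fst (e.apply_symm_apply (f x, g x))
      · ext x
        exact congrArg Prod.snd (e.apply_symm_apply (f x, g x))
      · ext x
        refine (e.symm_apply_apply (m x)).symm.trans (congrArg e.symm (Prod.ext ?_ ?_))
        · exact ConcreteCategory.congr_hom h₁ x
        · exact ConcreteCategory.congr_hom h₂ x
  constructor
  · intro h
    refine ⟨?_, fun X Y => (hbij X Y).1 ⟨mapIsLimitOfPreservesOfIsLimit F _ _ (hp' X Y)⟩⟩
    have := Types.isTerminalEquivUnique _ (IsTerminal.isTerminalObj F t ht')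
    exact ⟨this.default, trivial, fun y _ => this.uniq y⟩
  · rintro ⟨⟨x, -, hx⟩, h⟩
    have : HasTerminal C := ht'.hasTerminal
    have (X Y : C) : HasBinaryProduct X Y := ⟨⟨_, hp' X Y⟩⟩
    have : HasBinaryProducts C := hasBinaryProducts_of_hasLimit_pair C
    have : HasFiniteProducts C := hasFiniteProducts_of_has_binary_and_terminal
    have : PreservesLimitsOfShape (Discrete WalkingPair) F := ⟨fun {K} => by
      have := preservesLimit_of_preserves_limit_cone (hp' (K.obj ⟨.left⟩) (K.obj ⟨.right⟩))
        ((isLimitMapConeBinaryFanEquiv F _ _).symm ((hbij _ _).2 (h _ _)).some)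
      exact preservesLimit_of_iso_diagram F (diagramIsoPair K).symm⟩
    have : PreservesLimit (Functor.empty.{0} C) F :=
      preservesLimit_of_preserves_limit_cone ht' ((isLimitMapConeEmptyConeEquiv F t).symm
        ((Types.isTerminalEquivUnique _).symm ⟨⟨x⟩, fun y => hx y trivial⟩))
    have := preservesLimitsOfShape_pempty_of_preservesTerminal F
    exact PreservesFiniteProducts.of_preserves_binary_and_terminal F

/-! ### Green bispans -/

namespace FinGSet

variable {G : Type u} [Group G] {X Y Z W P : FinGSet G}

theorem isGreen_iff_smul {f : X →[G] Y} :
    IsGreen f ↔ ∀ (g : G) (x : X), g • f x = f x → g • x = x :=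
  GBispan.isGreen_iff ⟨X, Y, MulActionHom.id G, f, MulActionHom.id G⟩

theorem isGreen_id (X : FinGSet G) : IsGreen (MulActionHom.id G : X →[G] X) := fun _ => rfl

theorem isGreen_of_injective {f : X →[G] Y} (hf : Function.Injective f) : IsGreen f :=
  isGreen_iff_smul.2 fun g x h => hf ((map_smul f g x).trans h)

theorem IsGreen.comp {f : X →[G] Y} {g : Y →[G] Z} (hg : IsGreen g) (hf : IsGreen f) :
    IsGreen (g.comp f) := fun x => (hg (f x)).trans (hf x)

theorem IsGreen.desc {f : X →[G] Z} {g : Y →[G] Z} (hf : IsGreen f) (hg : IsGreen g) :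
    IsGreen (desc f g) := by
  rw [isGreen_iff_smul] at *
  rintro k (x | y) h
  · exact congrArg inl (hf k x h)
  · exact congrArg inr (hg k y h)

/-- The fold map. -/
def fold (X : FinGSet G) : X.sum X →[G] X := desc (MulActionHom.id G) (MulActionHom.id G)

theorem isGreen_fold (X : FinGSet G) : IsGreen (fold X) := (isGreen_id X).desc (isGreen_id X)

theorem IsGreen.sumMap {f : X →[G] Z} {g : Y →[G] W} (hf : IsGreen f) (hg : IsGreen g) :
    IsGreen (sumMap f g) :=
  ((isGreen_of_injective inl_injective).comp hf).desc ((isGreen_of_injective inr_injective).comp hg)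

theorem IsGreen.of_isFibreProduct {a : P →[G] X} {b : P →[G] Y} {f : X →[G] Z} {g : Y →[G] Z}
    (h : IsFibreProduct a b f g) (hf : IsGreen f) : IsGreen b := by
  rw [isGreen_iff_smul] at *
  refine fun k p hp => h.ext _ _ ?_ ((map_smul b k p).trans hp)
  rw [map_smul]
  refine hf k _ ?_
  rw [h.comm, ← map_smul, hp]

end FinGSet

namespace GreenBispanCat

open FinGSet

variable {G : Type u} [Group G] {X Y Z W P Q : FinGSet G}

/-- A finite `G`-set as an object of the category of green bispans. -/
def of (X : FinGSet G) : GreenBispanCat G := ⟨⟨X⟩⟩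

/-- The morphism represented by a green bispan. -/
def mk (ω : GBispan X Y) (h : ω.IsGreen) : of X ⟶ of Y := ⟨Quotient.mk _ ω, ω, rfl, h⟩

theorem exists_mk (f : of X ⟶ of Y) : ∃ (ω : GBispan X Y) (h : ω.IsGreen), mk ω h = f := by
  obtain ⟨_, ω, rfl, h⟩ := f
  exact ⟨ω, h, rfl⟩

theorem mk_eq_of_iso {ω ω' : GBispan X Y} (h : ω.IsGreen) (h' : ω'.IsGreen)
    (i : GBispan.Iso ω ω') : mk ω h = mk ω' h' :=
  WideSubcategory.hom_ext _ (Quotient.sound ⟨i⟩)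

theorem exists_iso {ω ω' : GBispan X Y} {h : ω.IsGreen} {h' : ω'.IsGreen}
    (e : mk ω h = mk ω' h') : Nonempty (GBispan.Iso ω ω') :=
  Quotient.exact (congrArg InducedWideCategory.Hom.hom e)

theorem mk_eq_of_bijective {ω ω' : GBispan X Y} (h : ω.IsGreen) (h' : ω'.IsGreen)
    (α : ω.A →[G] ω'.A) (hα : Function.Bijective α) (β : ω.B →[G] ω'.B)
    (hβ : Function.Bijective β) (hp : ∀ a, ω'.p (α a) = ω.p a)
    (hq : ∀ a, ω'.q (α a) = β (ω.q a)) (hr : ∀ b, ω'.r (β b) = ω.r b) : mk ω h = mk ω' h' :=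
  mk_eq_of_iso h h' ⟨Equiv.ofBijective α hα, Equiv.ofBijective β hβ, fun g a => map_smul α g a,
    fun g a => map_smul β g a, hp, hq, hr⟩

/-- The composite of a bispan with a span: the middle row is pulled back along the span. -/
theorem mk_comp_span (ω₀ : GBispan X Y) (h₀ : ω₀.IsGreen) (ω₁ : GSpan Y Z)
    {a : P →[G] ω₀.B} {b : P →[G] ω₁.A} (h : IsFibreProduct a b ω₀.r ω₁.p)
    {c : Q →[G] ω₀.A} {d : Q →[G] P} (h' : IsFibreProduct c d ω₀.q a) :
    mk ω₀ h₀ ≫ mk ⟨ω₁.A, ω₁.A, ω₁.p, MulActionHom.id G, ω₁.q⟩ (isGreen_id _) =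
      mk ⟨Q, P, ω₀.p.comp c, d, ω₁.q.comp b⟩ (IsGreen.of_isFibreProduct h' h₀) := by
  symm
  refine mk_eq_of_bijective _ (by exact GBispan.IsGreen.comp h₀ (isGreen_id _))
    { toFun := fun x =>
        { a₀ := c x
          a₁ := b (d x)
          s := fun _ _ => a (d x)
          r_s := fun y hy => (h.comm (d x)).trans (congrArg ω₁.p (Eq.symm hy))
          q_a₀ := h'.comm x }
      map_smul' := fun g x => ?_ } ⟨fun x y e => ?_, fun x => ?_⟩
    { toFun := fun x =>
        { b := b x
          s := fun _ _ => a x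
          r_s := fun y hy => (h.comm x).trans (congrArg ω₁.p (Eq.symm hy)) }
      map_smul' := fun g x => ?_ } ⟨fun x y e => ?_, fun x => ?_⟩
    (fun _ => rfl) (fun _ => rfl) fun _ => rfl
  · exact GBispan.CompA.ext (map_smul c g x) ((congrArg b (map_smul d g x)).trans (map_smul b g _))
      fun _ _ _ => (congrArg a (map_smul d g x)).trans (map_smul a g _)
  · have e₀ : c x = c y := congrArg GBispan.CompA.a₀ e
    have e₁ : b (d x) = b (d y) := congrArg GBispan.CompA.a₁ e
    exact h'.ext _ _ e₀ (h.ext _ _ ((h'.comm x).symm.trans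
      ((congrArg ω₀.q e₀).trans (h'.comm y))) e₁)
  · obtain ⟨p, h₁, h₂⟩ := h.exists_eq (x.s x.a₁ rfl) x.a₁ (x.r_s _ _)
    obtain ⟨q, h₃, h₄⟩ := h'.exists_eq x.a₀ p (x.q_a₀.trans h₁.symm)
    refine ⟨q, GBispan.CompA.ext h₃ ((congrArg b h₄).trans h₂) fun y hy hy' => ?_⟩
    exact ((congrArg a h₄).trans h₁).trans (x.s_congr (Eq.symm hy') _ _)
  · exact GBispan.CompB.ext (map_smul b g x) fun _ _ _ => map_smul a g x
  · exact h.ext _ _ (GBispan.CompB.s_eq (a := b x) (a' := b y) e (congrArg GBispan.CompB.b e)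
      rfl rfl) (congrArg GBispan.CompB.b e)
  · obtain ⟨p, h₁, h₂⟩ := h.exists_eq (x.s x.b rfl) x.b (x.r_s _ _)
    exact ⟨p, GBispan.CompB.ext h₂ fun y hy hy' => h₁.trans (x.s_congr (Eq.symm hy') _ _)⟩

/-- If the last map of the first bispan is an identity, then the sections in the composite are
determined, and the composite is formed with a fibre product. -/
theorem mk_comp_of_id {A B : FinGSet G} (p : A →[G] X) (q : A →[G] Y) (hq : IsGreen q)
    (ω₁ : GBispan Y Z) (h₁ : ω₁.IsGreen) {c : Q →[G] A} {d : Q →[G] ω₁.A}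
    (h : IsFibreProduct c d q ω₁.p) :
    mk ⟨A, Y, p, q, MulActionHom.id G⟩ hq ≫ mk ω₁ h₁ =
      mk ⟨Q, ω₁.B, p.comp c, ω₁.q.comp d, ω₁.r⟩
        (IsGreen.comp h₁ (IsGreen.of_isFibreProduct h hq)) := by
  symm
  refine mk_eq_of_bijective _ (by exact GBispan.IsGreen.comp hq h₁)
    { toFun := fun x =>
        { a₀ := c x
          a₁ := d x
          s := fun y _ => ω₁.p y
          r_s := fun y hy => rfl
          q_a₀ := h.comm x }
      map_smul' := fun g x => ?_ } ⟨fun x y e => ?_, fun x => ?_⟩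
    { toFun := fun x =>
        { b := x
          s := fun y _ => ω₁.p y
          r_s := fun y hy => rfl }
      map_smul' := fun g x => ?_ } ⟨fun x y e => ?_, fun x => ?_⟩
    (fun _ => rfl) (fun _ => rfl) fun _ => rfl
  · refine GBispan.CompA.ext (map_smul c g x) (map_smul d g x) fun y _ _ => ?_
    exact (smul_inv_smul g _).symm.trans (congrArg (g • ·) (map_smul ω₁.p _ _).symm)
  · exact h.ext _ _ (congrArg GBispan.CompA.a₀ e) (congrArg GBispan.CompA.a₁ e)
  · obtain ⟨z, e₁, e₂⟩ := h.exists_eq x.a₀ x.a₁ (x.q_a₀.trans (x.r_s _ _))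
    exact ⟨z, GBispan.CompA.ext e₁ e₂ fun y hy hy' => (x.r_s y hy').symm⟩
  · refine GBispan.CompB.ext rfl fun y _ _ => ?_
    exact (smul_inv_smul g _).symm.trans (congrArg (g • ·) (map_smul ω₁.p _ _).symm)
  · exact congrArg GBispan.CompB.b e
  · exact ⟨x.b, GBispan.CompB.ext rfl fun y hy hy' => (x.r_s y hy').symm⟩

/-- The inclusion of spans in green bispans: a span `X ⟵ A ⟶ Y` is the bispan
`X ⟵ A = A ⟶ Y`. -/
def incl (G : Type u) [Group G] : SpanCat G ⥤ GreenBispanCat G where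
  obj X := of X.toGSet
  map {X Y} := Quotient.lift
    (fun ω : GSpan X.toGSet Y.toGSet =>
      mk ⟨ω.A, ω.A, ω.p, MulActionHom.id G, ω.q⟩ (isGreen_id _))
    fun ω ω' ⟨e, h₁, h₂, h₃⟩ => mk_eq_of_iso _ _ ⟨e, e, h₁, h₁, h₂, fun _ => rfl, h₃⟩
  map_id X := rfl
  map_comp {X Y Z} f g := by
    induction f, g using Quotient.inductionOn₂ with | h ω₀ ω₁ =>
    refine (mk_comp_span ⟨ω₀.A, ω₀.A, ω₀.p, MulActionHom.id G, ω₀.q⟩ _ ω₁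
      (isFibreProduct_pullback _ _) (isFibreProduct_id_left _).symm).symm

theorem incl_map_mk (ω : GSpan X Y) : (incl G).map (SpanCat.mk ω) =
    mk ⟨ω.A, ω.A, ω.p, MulActionHom.id G, ω.q⟩ (isGreen_id _) := rfl

/-- The bispan `A = A ⟶ B = B` attached to a green map `q : A ⟶ B`. -/
def norm (q : X →[G] Y) (hq : IsGreen q) : of X ⟶ of Y :=
  mk ⟨X, Y, MulActionHom.id G, q, MulActionHom.id G⟩ hq

theorem norm_comp (f : X →[G] Y) (hf : IsGreen f) (g : Y →[G] Z) (hg : IsGreen g) :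
    norm f hf ≫ norm g hg = norm (g.comp f) (hg.comp hf) :=
  mk_comp_of_id (B := Y) _ f hf ⟨Y, Z, MulActionHom.id G, g, MulActionHom.id G⟩ hg
    (isFibreProduct_id_left f).symm.symm

/-- Every green bispan is a restriction, followed by a norm and a transfer. -/
theorem mk_eq_R_comp_norm_comp_T (ω : GBispan X Y) (h : ω.IsGreen) :
    mk ω h = (incl G).map (SpanCat.mk (GSpan.R ω.p)) ≫ norm ω.q h ≫
      (incl G).map (SpanCat.mk (GSpan.T ω.r)) := by
  rw [incl_map_mk, incl_map_mk]
  have := mk_comp_span ⟨ω.A, ω.B, MulActionHom.id G, ω.q, MulActionHom.id G⟩ h (GSpan.T ω.r)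
    (isFibreProduct_id_left (MulActionHom.id G)) (isFibreProduct_id_left ω.q)
  refine Eq.trans ?_ (congrArg _ this.symm)
  exact (mk_comp_of_id (B := ω.A) ω.p (MulActionHom.id G) (isGreen_id _)
    ⟨ω.A, ω.B, MulActionHom.id G, ω.q, ω.r⟩ h (isFibreProduct_id_left (MulActionHom.id G))).symm

/-- Norms commute with base change. -/
theorem norm_comp_R {q : X →[G] Z} (hq : IsGreen q) {f : Y →[G] Z} {a : P →[G] X} {b : P →[G] Y}
    (h : IsFibreProduct a b q f) :
    norm q hq ≫ (incl G).map (SpanCat.mk (GSpan.R f)) =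
      (incl G).map (SpanCat.mk (GSpan.R a)) ≫ norm b (IsGreen.of_isFibreProduct h hq) := by
  rw [incl_map_mk, incl_map_mk]
  refine (mk_comp_of_id (B := Z) _ q hq _ _ h).trans (Eq.symm ?_)
  exact mk_comp_of_id (B := X) a _ (isGreen_id _) ⟨P, Y, _, b, _⟩ _
    (isFibreProduct_id_left (MulActionHom.id G))

/-- Equal elements have equal sections; the proof arguments of the two sides may differ. -/
theorem _root_.GBispan.CompA.s_eq {ω₀ : GBispan X Y} {ω₁ : GBispan Y Z} {x y : ω₀.CompA ω₁}
    (e : x = y) (a : ω₁.A) (h : ω₁.q a = ω₁.q x.a₁) (h' : ω₁.q a = ω₁.q y.a₁) :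
    x.s a h = y.s a h' := by
  subst e; rfl

/-- The elements of the middle set in the composite of `f ⊔ id` and the fold map. A section over the
fibre `{inl b, inr b}` has to send `inr b` to itself, so it is given by a point `x` with
`f x = b`. -/
theorem exists_of_compB_fold (f : X →[G] Y)
    (z : GBispan.CompB ⟨X.sum Y, X.sum Y, MulActionHom.id G, MulActionHom.id G,
      sumMap f (MulActionHom.id G)⟩ ⟨Y.sum Y, Y, MulActionHom.id G, fold Y, MulActionHom.id G⟩) :
    ∃ x, f x = z.b ∧
      ∀ y hy, z.s y hy = Sum.elim (fun _ => (inl x : X.sum Y)) (fun y' => inr y') y := by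
  rcases hx : z.s (inl z.b) rfl with x | y
  · have hr := z.r_s (inl z.b) rfl
    rw [hx] at hr
    refine ⟨x, inl_injective hr, fun y hy => ?_⟩
    rcases y with y | y
    · exact (z.s_congr (congrArg Sum.inl hy) _ _).trans hx
    · have hr := z.r_s (inr y) hy
      change z.s (inr y) hy = Sum.inr y
      rcases hk : z.s (inr y) hy with k | k
      · rw [hk] at hr
        exact (inl_ne_inr _ _ hr).elim
      · rw [hk] at hr
        exact congrArg Sum.inr (inr_injective hr)
  · have hr := z.r_s (inl z.b) rfl
    rw [hx] at hr
    exact (inl_ne_inr _ _ hr.symm).elim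

/-- The exponential diagram that expresses Frobenius reciprocity: the composite of the transfer
along `f ⊔ id` with the norm along the fold map of `Y` is the bispan
`X ⊔ Y ⟵ X ⊔ X ⟶ X ⟶ Y`. -/
theorem T_comp_norm_fold (f : X →[G] Y) :
    (incl G).map (SpanCat.mk (GSpan.T (sumMap f (MulActionHom.id G)))) ≫
        norm (fold Y) (isGreen_fold Y) =
      (incl G).map (SpanCat.mk (GSpan.R (sumMap (MulActionHom.id G) f))) ≫
        norm (fold X) (isGreen_fold X) ≫ (incl G).map (SpanCat.mk (GSpan.T f)) := by
  refine Eq.trans (Eq.symm ?_) (mk_eq_R_comp_norm_comp_T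
    ⟨X.sum X, X, sumMap (MulActionHom.id G) f, fold X, f⟩ (isGreen_fold X))
  refine mk_eq_of_bijective _ (by exact GBispan.IsGreen.comp (isGreen_id _) (isGreen_fold Y))
    { toFun := fun x =>
        { a₀ := sumMap (MulActionHom.id G) f x
          a₁ := sumMap f f x
          s := fun y _ => Sum.elim (fun _ => inl (fold X x)) (fun z => inr z) y
          r_s := ?_
          q_a₀ := ?_ }
      map_smul' := fun g x => ?_ } ⟨fun x y e => ?_, fun x => ?_⟩
    { toFun := fun x =>
        { b := f x
          s := fun y _ => Sum.elim (fun _ => inl x) (fun z => inr z) y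
          r_s := ?_ }
      map_smul' := fun g x => ?_ } ⟨fun x y e => ?_, fun x => ?_⟩
    (fun _ => rfl) (fun x => ?_) fun _ => rfl
  · rintro (y | y) hy
    · refine congrArg Sum.inl (Eq.trans ?_ (Eq.symm hy))
      rcases x with x | x <;> rfl
    · rfl
  · rcases x with x | x <;> rfl
  · refine GBispan.CompA.ext (map_smul _ g x) (map_smul (sumMap f f) g x) fun y _ _ => ?_
    rcases y with y | y
    · exact congrArg Sum.inl (map_smul (fold X) g x)
    · exact congrArg Sum.inr (smul_inv_smul g y).symm
  · have e₀ := congrArg GBispan.CompA.a₀ e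
    have e₁ := congrArg GBispan.CompA.a₁ e
    rcases x with x | x <;> rcases y with y | y
    · exact congrArg Sum.inl (inl_injective e₀)
    · exact (inl_ne_inr _ _ e₁).elim
    · exact (inl_ne_inr _ _ e₁.symm).elim
    · have := GBispan.CompA.s_eq e (inl (f x)) rfl (inr_injective e₁)
      exact congrArg Sum.inr (inl_injective this)
  · obtain ⟨z, hz, hs⟩ := exists_of_compB_fold f ⟨fold Y x.a₁, x.s, x.r_s⟩
    have h₀ := x.q_a₀.trans (hs x.a₁ rfl)
    replace hz : f z = fold Y x.a₁ := hz
    rcases hy : x.a₁ with y | y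
    · rw [hy] at hz h₀
      refine ⟨inl z, GBispan.CompA.ext h₀.symm ?_ fun y hy hy' => (hs y hy').symm⟩
      exact (congrArg Sum.inl hz).trans hy.symm
    · rw [hy] at hz h₀
      have e₁ : inr (f z) = x.a₁ := (congrArg Sum.inr hz).trans hy.symm
      exact ⟨inr z, GBispan.CompA.ext ((congrArg Sum.inr hz).trans h₀.symm) e₁
        fun y hy hy' => (hs y hy').symm⟩
  · rintro (y | y) hy
    · exact congrArg Sum.inl (Eq.symm hy)
    · rfl
  · refine GBispan.CompB.ext (map_smul f g x) fun y _ _ => ?_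
    rcases y with y | y
    · rfl
    · exact congrArg Sum.inr (smul_inv_smul g y).symm
  · have h := GBispan.CompB.s_eq e (rfl : inl (f x) = inl (f x)) rfl (congrArg GBispan.CompB.b e)
    exact inl_injective h
  · obtain ⟨z, hz, hs⟩ := exists_of_compB_fold f x
    exact ⟨z, GBispan.CompB.ext hz fun y hy hy' => (hs y hy').symm⟩
  · refine GBispan.CompB.ext ?_ fun _ _ _ => rfl
    rcases x with x | x <;> rfl

/-- The disjoint union is a product in the category of green bispans. -/
theorem existsUnique_lift (f : of W ⟶ of X) (g : of W ⟶ of Y) :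
    ∃! k : of W ⟶ of (X.sum Y), k ≫ (incl G).map (SpanCat.mk (GSpan.R inl)) = f ∧
      k ≫ (incl G).map (SpanCat.mk (GSpan.R inr)) = g := by
  obtain ⟨ω₁, h₁, rfl⟩ := exists_mk f
  obtain ⟨ω₂, h₂, rfl⟩ := exists_mk g
  refine ⟨mk ⟨ω₁.A.sum ω₂.A, ω₁.B.sum ω₂.B, desc ω₁.p ω₂.p, sumMap ω₁.q ω₂.q, sumMap ω₁.r ω₂.r⟩
      (IsGreen.sumMap h₁ h₂),
    ⟨mk_comp_span ⟨_, _, desc ω₁.p ω₂.p, _, _⟩ _ (GSpan.R inl) (isFibreProduct_inl ω₁.r ω₂.r)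
      (isFibreProduct_inl ω₁.q ω₂.q),
    mk_comp_span ⟨_, _, desc ω₁.p ω₂.p, _, _⟩ _ (GSpan.R inr) (isFibreProduct_inr ω₁.r ω₂.r)
      (isFibreProduct_inr ω₁.q ω₂.q)⟩, ?_⟩
  rintro k ⟨e₁, e₂⟩
  obtain ⟨ω, h, rfl⟩ := exists_mk k
  have f₁ := isFibreProduct_pullback ω.r (inl : X →[G] X.sum Y)
  have f₂ := isFibreProduct_pullback ω.r (inr : Y →[G] X.sum Y)
  have f₁' := isFibreProduct_pullback ω.q (pullbackFst ω.r inl)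
  have f₂' := isFibreProduct_pullback ω.q (pullbackFst ω.r inr)
  obtain ⟨i⟩ := exists_iso (((mk_comp_span ω h (GSpan.R inl) f₁ f₁').symm.trans e₁).symm)
  obtain ⟨j⟩ := exists_iso (((mk_comp_span ω h (GSpan.R inr) f₂ f₂').symm.trans e₂).symm)
  have g₁ := f₁.comp_bijective ⟨i.β, i.β_smul⟩ i.β.bijective
  have g₂ := f₂.comp_bijective ⟨j.β, j.β_smul⟩ j.β.bijective
  have g₁' := (f₁'.paste f₁).comp_bijective ⟨i.α, i.α_smul⟩ i.α.bijective
  have g₂' := (f₂'.paste f₂).comp_bijective ⟨j.α, j.α_smul⟩ j.α.bijective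
  symm
  refine mk_eq_of_bijective _ _ (desc _ _) (desc_bijective_of_isFibreProduct g₁' g₂')
    (desc _ _) (desc_bijective_of_isFibreProduct g₁ g₂) ?_ ?_ ?_
  · rintro (a | a)
    exacts [i.p_α a, j.p_α a]
  · rintro (a | a)
    · exact (f₁'.comm _).trans (congrArg (pullbackFst ω.r inl) (i.q_α a))
    · exact (f₂'.comm _).trans (congrArg (pullbackFst ω.r inr) (j.q_α a))
  · rintro (b | b)
    · exact (g₁.comm b).trans (congrArg inl (i.r_β b))
    · exact (g₂.comm b).trans (congrArg inr (j.r_β b))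

/-- The empty `G`-set is terminal in the category of green bispans. -/
theorem existsUnique_to_empty (X : FinGSet G) : ∃! k : of X ⟶ of (FinGSet.empty G), True := by
  refine ⟨(incl G).map (SpanCat.mk ⟨FinGSet.empty G, fromEmpty _, MulActionHom.id G⟩), trivial,
    fun k _ => ?_⟩
  obtain ⟨ω, h, rfl⟩ := exists_mk k
  have : IsEmpty ω.B := ⟨fun b => isEmptyElim (ω.r b)⟩
  have : IsEmpty ω.A := ⟨fun a => isEmptyElim (ω.q a)⟩
  exact mk_eq_of_bijective _ (by exact isGreen_id _) (ω.r.comp ω.q)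
    ⟨fun a => isEmptyElim a, fun b => isEmptyElim b⟩ ω.r
    ⟨fun a => isEmptyElim a, fun b => isEmptyElim b⟩ (fun a => isEmptyElim a)
    (fun a => isEmptyElim a) (fun a => isEmptyElim a)

end GreenBispanCat

/-! ### Restriction and transfer -/

namespace SpanCat

open FinGSet

variable {G : Type u} [Group G] {X Y Z W P : FinGSet G} (M : SpanCat G ⥤ Type w)

/-- The restriction along `f` of a functor on spans. -/
def res (f : X →[G] Y) (y : M.obj (of Y)) : M.obj (of X) := M.map (mk (GSpan.R f)) y

/-- The transfer along `f` of a functor on spans. -/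
def tr (f : X →[G] Y) (x : M.obj (of X)) : M.obj (of Y) := M.map (mk (GSpan.T f)) x

theorem map_comp_apply {X Y Z : SpanCat G} (f : X ⟶ Y) (g : Y ⟶ Z) (x : M.obj X) :
    M.map (f ≫ g) x = M.map g (M.map f x) := by
  rw [M.map_comp]; rfl

theorem map_id_apply {X : SpanCat G} (x : M.obj X) : M.map (𝟙 X) x = x := by
  rw [M.map_id]; rfl

theorem map_mk_apply (ω : GSpan X Y) (x : M.obj (of X)) :
    M.map (mk ω) x = tr M ω.q (res M ω.p x) := by
  rw [mk_eq_R_comp_T, map_comp_apply]; rfl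

/-- The map associated with an equivariant bijection is restriction along the inverse. -/
theorem map_T_eq_res (f : X →[G] Y) (f' : Y →[G] X)
    (h : ∀ x, f' (f x) = x) (h' : ∀ y, f (f' y) = y) (x : M.obj (.of X)) :
    M.map (mk (GSpan.T f)) x = res M f' x :=
  congrArg (fun k => M.map k x) (mk_eq (GSpan.T_isIso_R f f' h h'))

theorem res_id (x : M.obj (of X)) : res M (MulActionHom.id G) x = x := map_id_apply M x

theorem tr_id (x : M.obj (of X)) : tr M (MulActionHom.id G) x = x := map_id_apply M x

theorem res_res (f : X →[G] Y) (g : Y →[G] Z) (z : M.obj (of Z)) :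
    res M f (res M g z) = res M (g.comp f) z := by
  rw [res, res, ← map_comp_apply, mk_R_comp]; rfl

theorem tr_tr (f : X →[G] Y) (g : Y →[G] Z) (x : M.obj (of X)) :
    tr M g (tr M f x) = tr M (g.comp f) x := by
  rw [tr, tr, ← map_comp_apply, mk_T_comp_T]; rfl

theorem res_tr {f : X →[G] Z} {g : Y →[G] Z} {a : P →[G] X} {b : P →[G] Y}
    (h : IsFibreProduct a b f g) (x : M.obj (of X)) :
    res M g (tr M f x) = tr M b (res M a x) := by
  rw [res, tr, ← map_comp_apply, mk_T_comp_R h, map_comp_apply]; rfl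

/-- For injective `f`, the fibre product of `X` with itself over `Y` is `X`. -/
theorem res_tr_of_injective {f : X →[G] Y} (hf : Function.Injective f) (x : M.obj (of X)) :
    res M f (tr M f x) = x := by
  rw [res_tr M (isFibreProduct_of_injective hf), res_id, tr_id]

theorem res_injective_of_bijective {f : X →[G] Y} (hf : Function.Bijective f) :
    Function.Injective (res M f) := by
  refine Function.LeftInverse.injective (g := res M (inverse f hf)) fun y => ?_
  rw [res_res, show f.comp (inverse f hf) = MulActionHom.id G from
    MulActionHom.ext (apply_inverse f hf), res_id]

theorem tr_res_of_bijective {f : X →[G] Y} (hf : Function.Bijective f) (y : M.obj (of Y)) :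
    tr M f (res M f y) = y :=
  res_injective_of_bijective M hf (res_tr_of_injective M hf.1 _)

/-- A functor on spans is additive if it takes disjoint unions to products. -/
def IsAdditive : Prop :=
  (∃! x : M.obj (of (FinGSet.empty G)), True) ∧
    ∀ X Y : FinGSet G, Function.Bijective fun z : M.obj (of (X.sum Y)) =>
      (res M inl z, res M inr z)

theorem isMackey_iff_isAdditive : IsMackey G M ↔ IsAdditive M := by
  refine (preservesFiniteProducts_type_iff M (of (FinGSet.empty G))
    (fun X => existsUnique_to_empty X.toGSet) (fun X Y => of (X.toGSet.sum Y.toGSet))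
    (fun X Y => mk (GSpan.R inl)) (fun X Y => mk (GSpan.R inr))
    fun X Y W f g => existsUnique_lift f g).trans ?_
  exact and_congr Iff.rfl ⟨fun h X Y => h (of X) (of Y), fun h X Y => h X.toGSet Y.toGSet⟩

theorem res_app {M N : SpanCat G ⥤ Type w} (α : M ⟶ N) (f : X →[G] Y) (y : M.obj (of Y)) :
    α.app (of X) (res M f y) = res N f (α.app (of Y) y) :=
  ConcreteCategory.congr_hom (α.naturality (mk (GSpan.R f))) y

theorem tr_app {M N : SpanCat G ⥤ Type w} (α : M ⟶ N) (f : X →[G] Y) (x : M.obj (of X)) :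
    α.app (of Y) (tr M f x) = tr N f (α.app (of X) x) :=
  ConcreteCategory.congr_hom (α.naturality (mk (GSpan.T f))) x

end SpanCat

/-! ### Transitive `G`-sets and gluing -/

namespace FinGSet

variable {G : Type u} [Group G] {X Y Z W P A B T U : FinGSet G}

/-- Every element of `T` is a translate of `t`. -/
def IsGenerator (t : T) : Prop := ∀ t' : T, ∃ g : G, g • t = t'

/-- A `G`-set with exactly one orbit. -/
def IsTransitive (T : FinGSet G) : Prop := ∃ t : T, IsGenerator t

/-- The sub-`G`-set of the elements that satisfy an invariant predicate. -/
def sub (X : FinGSet G) (s : X → Prop) (h : ∀ (g : G) x, s x → s (g • x)) : FinGSet G :=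
  letI : MulAction G {x // s x} :=
    { smul := fun g x => ⟨g • x.1, h g x.1 x.2⟩
      one_smul := fun x => Subtype.ext (one_smul G x.1)
      mul_smul := fun a b x => Subtype.ext (mul_smul a b x.1) }
  ⟨{x // s x}⟩

/-- The inclusion of a sub-`G`-set. -/
def subIncl (X : FinGSet G) (s : X → Prop) (h : ∀ (g : G) x, s x → s (g • x)) :
    X.sub s h →[G] X := ⟨fun x => x.1, fun _ _ => rfl⟩

/-- Every finite `G`-set is built from transitive ones by disjoint unions. -/
theorem induction {p : FinGSet G → Prop} (empty : p (empty G))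
    (transitive : ∀ T : FinGSet G, T.IsTransitive → p T) (sum : ∀ X Y, p X → p Y → p (X.sum Y))
    (iso : ∀ (X Y : FinGSet G) (e : X →[G] Y), Function.Bijective e → p X → p Y)
    (X : FinGSet G) : p X := by
  induction hn : Nat.card X using Nat.strong_induction_on generalizing X with
  | _ n ih =>
    subst hn
    rcases isEmpty_or_nonempty X with hX | ⟨⟨x⟩⟩
    · exact iso _ _ (fromEmpty X) ⟨fun a => isEmptyElim a, fun b => isEmptyElim b⟩ empty
    -- `X` is the disjoint union of the orbit of `x` and the complement, which has fewer elements
    · have hs (g : G) (y : X) : (∃ k : G, k • x = y) → ∃ k : G, k • x = g • y := by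
        rintro ⟨k, rfl⟩
        exact ⟨g * k, mul_smul g k x⟩
      have hs' (g : G) (y : X) (h : ¬ ∃ k : G, k • x = y) : ¬ ∃ k : G, k • x = g • y := by
        rintro ⟨k, hk⟩
        exact h ⟨g⁻¹ * k, by rw [mul_smul, hk, inv_smul_smul]⟩
      refine iso _ _ (desc (subIncl X _ hs) (subIncl X _ hs')) ?_ (sum _ _ (transitive _ ?_)
        (ih _ ?_ _ rfl))
      · refine desc_bijective Subtype.val_injective Subtype.val_injective
          (fun a b h => b.2 (Eq.subst (motive := fun y => ∃ k : G, k • x = y) h a.2)) fun y => ?_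
        by_cases hy : ∃ k : G, k • x = y
        · exact Or.inl ⟨⟨y, hy⟩, rfl⟩
        · exact Or.inr ⟨⟨y, hy⟩, rfl⟩
      · refine ⟨⟨x, 1, one_smul G x⟩, fun t => ?_⟩
        obtain ⟨y, g, hg⟩ := t
        exact ⟨g, Subtype.ext hg⟩
      · exact Finite.card_subtype_lt (x := x) (by simpa using ⟨1, one_smul G x⟩)

/-- A transitive `G`-set over a disjoint union lies over one of the summands. -/
theorem IsTransitive.factors (hT : T.IsTransitive) (f : T →[G] X.sum Y) :
    (∃ f' : T →[G] X, f = inl.comp f') ∨ ∃ f' : T →[G] Y, f = inr.comp f' := by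
  obtain ⟨t, ht⟩ := hT
  rcases sum_cases (f t) with ⟨x, hx⟩ | ⟨y, hy⟩
  · left
    have (t' : T) : ∃ x', inl x' = f t' := by
      obtain ⟨g, rfl⟩ := ht t'
      exact ⟨g • x, by rw [map_smul, map_smul, hx]⟩
    choose k hk using this
    refine ⟨⟨k, fun g t' => inl_injective (Y := Y) ?_⟩, MulActionHom.ext fun t' => (hk t').symm⟩
    rw [hk, map_smul, map_smul, hk]; rfl
  · right
    have (t' : T) : ∃ y', inr y' = f t' := by
      obtain ⟨g, rfl⟩ := ht t'
      exact ⟨g • y, by rw [map_smul, map_smul, hy]⟩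
    choose k hk using this
    refine ⟨⟨k, fun g t' => inr_injective (X := X) ?_⟩, MulActionHom.ext fun t' => (hk t').symm⟩
    rw [hk, map_smul, map_smul, hk]; rfl

/-- The maps `T ⟶ A` that lift `f : T ⟶ B` along `q : A ⟶ B`. -/
def Lift (q : A →[G] B) (f : T →[G] B) : Type u := {σ : T →[G] A // q.comp σ = f}

/-- A lift given by a map and a proof that it lifts. -/
def Lift.mk {q : A →[G] B} {f : T →[G] B} (σ : T →[G] A) (h : ∀ t, q (σ t) = f t) : Lift q f :=
  ⟨σ, MulActionHom.ext h⟩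

instance (q : A →[G] B) (f : T →[G] B) : Finite (Lift q f) :=
  Finite.of_injective (fun σ => (σ.1 : T → A)) fun _ _ h => Subtype.ext (DFunLike.coe_injective h)

noncomputable instance (q : A →[G] B) (f : T →[G] B) : Fintype (Lift q f) := Fintype.ofFinite _

theorem Lift.apply {q : A →[G] B} {f : T →[G] B} (σ : Lift q f) (t : T) : q (σ.1 t) = f t :=
  DFunLike.congr_fun σ.2 t

theorem hom_ext_of_isGenerator {t : T} (ht : IsGenerator t) {σ τ : T →[G] A} (h : σ t = τ t) :
    σ = τ := by
  refine MulActionHom.ext fun t' => ?_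
  obtain ⟨g, rfl⟩ := ht t'
  rw [map_smul, map_smul, h]

/-- A map from a transitive `G`-set may send a generator to any element whose isotropy group
contains that of the generator. -/
theorem exists_hom_of_isGenerator {t : T} (ht : IsGenerator t) (a : A)
    (ha : ∀ g : G, g • t = t → g • a = a) : ∃ σ : T →[G] A, σ t = a := by
  choose k hk using ht
  have key (g g' : G) (h : g • t = g' • t) : g • a = g' • a := by
    rw [← inv_smul_eq_iff, ← mul_smul]
    refine ha _ ?_
    rw [mul_smul, h, inv_smul_smul]
  refine ⟨⟨fun t' => k t' • a, fun g t' => ?_⟩, ?_⟩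
  · rw [id, ← mul_smul]
    exact key _ _ (by rw [hk, mul_smul, hk])
  · exact (key _ 1 (by rw [hk, one_smul])).trans (one_smul G a)

/-- Along a green map, a map from a transitive `G`-set has a lift with prescribed value at a point,
because green maps preserve isotropy groups. -/
theorem IsGreen.exists_lift {q : A →[G] B} (hq : IsGreen q) (f : T →[G] B) {t : T}
    (ht : IsGenerator t) (a : A) (ha : q a = f t) : ∃ σ : Lift q f, σ.1 t = a := by
  obtain ⟨σ, hσ⟩ := exists_hom_of_isGenerator ht a fun g hg => isGreen_iff_smul.1 hq g a (by
    rw [ha, ← map_smul, hg])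
  refine ⟨⟨σ, hom_ext_of_isGenerator ht ?_⟩, hσ⟩
  exact (congrArg q hσ).trans ha

theorem Lift.ext_of_isGenerator {q : A →[G] B} {f : T →[G] B} {t : T} (ht : IsGenerator t)
    {σ τ : Lift q f} (h : σ.1 t = τ.1 t) : σ = τ :=
  Subtype.ext (hom_ext_of_isGenerator ht h)

/-- Composition of lifts with a map of the source. -/
def Lift.precomp {q : A →[G] B} {f : T →[G] B} (h : U →[G] T) (σ : Lift q f) :
    Lift q (f.comp h) :=
  .mk (σ.1.comp h) fun u => σ.apply (h u)

theorem IsGenerator.map {u : U} (hT : T.IsTransitive) (h : U →[G] T) :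
    IsGenerator (h u) := by
  obtain ⟨t, ht⟩ := hT
  intro t'
  obtain ⟨g, hg⟩ := ht (h u)
  obtain ⟨g', hg'⟩ := ht t'
  exact ⟨g' * g⁻¹, by rw [mul_smul, ← hg, inv_smul_smul, hg']⟩

/-- Lifts along a green map correspond to points of a fibre, so their number does not change under
maps of transitive `G`-sets. -/
theorem Lift.precomp_bijective {q : A →[G] B} (hq : IsGreen q) (f : T →[G] B)
    (hT : T.IsTransitive) (hU : U.IsTransitive) (h : U →[G] T) :
    Function.Bijective (Lift.precomp h : Lift q f → Lift q (f.comp h)) := by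
  obtain ⟨u, hu⟩ := hU
  have ht : IsGenerator (h u) := IsGenerator.map hT h
  refine ⟨fun σ τ e => Lift.ext_of_isGenerator ht ?_, fun τ => ?_⟩
  · exact DFunLike.congr_fun (congrArg Subtype.val e) u
  · obtain ⟨σ, hσ⟩ := hq.exists_lift f ht (τ.1 u) (τ.apply u)
    exact ⟨σ, Lift.ext_of_isGenerator hu hσ⟩

/-- The map into a fibre product with given components. -/
theorem IsFibreProduct.exists_lift {a : P →[G] X} {b : P →[G] Y} {f : X →[G] Z} {g : Y →[G] Z}
    (h : IsFibreProduct a b f g) (x : T →[G] X) (y : T →[G] Y) (e : ∀ t, f (x t) = g (y t)) :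
    ∃ k : T →[G] P, a.comp k = x ∧ b.comp k = y := by
  choose k hx hy using fun t => h.exists_eq (x t) (y t) (e t)
  refine ⟨⟨k, fun g t => h.ext _ _ ?_ ?_⟩, MulActionHom.ext hx, MulActionHom.ext hy⟩
  · rw [hx, map_smul, map_smul, hx]; rfl
  · rw [hy, map_smul, map_smul, hy]; rfl

end FinGSet

namespace SpanCat

open FinGSet

variable {G : Type u} [Group G] {M : SpanCat G ⥤ Type w}

/-- An additive functor is determined by its values on transitive `G`-sets: compatible elements on
the transitive `G`-sets over `B` glue to a unique element on `B`. -/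
theorem IsAdditive.existsUnique_glue (hM : IsAdditive M) (B : FinGSet G)
    (t : ∀ T : FinGSet G, T.IsTransitive → (T →[G] B) → M.obj (of T))
    (ht : ∀ (T U : FinGSet G) (hT : T.IsTransitive) (hU : U.IsTransitive) (h : U →[G] T)
      (f : T →[G] B), res M h (t T hT f) = t U hU (f.comp h)) :
    ∃! s : M.obj (of B), ∀ (T : FinGSet G) (hT : T.IsTransitive) (f : T →[G] B),
      res M f s = t T hT f := by
  revert t
  induction B using FinGSet.induction with
  | empty =>
    intro t ht
    obtain ⟨⟨x, -, hx⟩, -⟩ := hM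
    exact ⟨x, fun T hT f => isEmptyElim (f hT.choose), fun y _ => hx y trivial⟩
  | transitive B hB =>
    intro t ht
    refine ⟨t B hB (MulActionHom.id G), fun T hT f => ht B T hB hT f _, fun y hy => ?_⟩
    exact (res_id M y).symm.trans (hy B hB _)
  | sum X Y ihX ihY =>
    intro t ht
    obtain ⟨x, hx, hx'⟩ := ihX (fun T hT f => t T hT (inl.comp f))
      fun T U hT hU h f => ht T U hT hU h _
    obtain ⟨y, hy, hy'⟩ := ihY (fun T hT f => t T hT (inr.comp f))
      fun T U hT hU h f => ht T U hT hU h _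
    obtain ⟨z, hz⟩ := (hM.2 X Y).2 (x, y)
    obtain ⟨rfl, rfl⟩ := Prod.ext_iff.1 hz
    refine ⟨z, fun T hT f => ?_, fun z' hz' => (hM.2 X Y).1 (Prod.ext ?_ ?_)⟩
    · rcases hT.factors f with ⟨f, rfl⟩ | ⟨f, rfl⟩
      · exact (res_res M f inl z).symm.trans (hx T hT f)
      · exact (res_res M f inr z).symm.trans (hy T hT f)
    · exact hx' _ fun T hT f => (res_res M _ _ _).trans (hz' T hT _)
    · exact hy' _ fun T hT f => (res_res M _ _ _).trans (hz' T hT _)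
  | iso X Y e he ih =>
    intro t ht
    obtain ⟨x, hx, hx'⟩ := ih (fun T hT f => t T hT (e.comp f))
      fun T U hT hU h f => ht T U hT hU h _
    refine ⟨tr M e x, fun T hT f => ?_, fun y hy => ?_⟩
    · obtain ⟨f, rfl⟩ : ∃ f', f = e.comp f' := ⟨(inverse e he).comp f,
        MulActionHom.ext fun t => (apply_inverse e he (f t)).symm⟩
      rw [← res_res, res_tr_of_injective M he.1, hx]
    · refine res_injective_of_bijective M he ?_
      rw [res_tr_of_injective M he.1]
      exact hx' _ fun T hT f => (res_res M _ _ _).trans (hy T hT _)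

/-- Elements of an additive functor can be compared on transitive `G`-sets. -/
theorem IsAdditive.ext (hM : IsAdditive M) {B : FinGSet G} {s s' : M.obj (of B)}
    (h : ∀ (T : FinGSet G) (hT : T.IsTransitive) (f : T →[G] B), res M f s = res M f s') :
    s = s' := by
  obtain ⟨x, -, hx⟩ := hM.existsUnique_glue B (fun T hT f => res M f s)
    fun T U hT hU k f => res_res M k f s
  exact (hx s fun _ _ _ => rfl).trans (hx s' fun T hT f => (h T hT f).symm).symm

end SpanCat

/-! ### Mackey functors with multiplications -/

/-- A Mackey functor `M` with a commutative multiplication on every `M(X)` which is preserved by the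
restrictions and satisfies Frobenius reciprocity. -/
structure FrobeniusFunctor (G : Type u) [Group G] where
  /-- The underlying functor on spans. -/
  M : SpanCat G ⥤ Type w
  isAdditive : SpanCat.IsAdditive M
  /-- The multiplication. -/
  mon : ∀ X : FinGSet G, CommMonoid (M.obj (.of X))
  res_mul : ∀ {X Y : FinGSet G} (f : X →[G] Y) (x y : M.obj (.of Y)),
    SpanCat.res M f ((mon Y).mul x y) = (mon X).mul (SpanCat.res M f x) (SpanCat.res M f y)
  res_one : ∀ {X Y : FinGSet G} (f : X →[G] Y), SpanCat.res M f (mon Y).one = (mon X).one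
  frobenius : ∀ {X Y : FinGSet G} (f : X →[G] Y) (x : M.obj (.of X)) (y : M.obj (.of Y)),
    SpanCat.tr M f ((mon X).mul x (SpanCat.res M f y)) = (mon Y).mul (SpanCat.tr M f x) y

namespace FrobeniusFunctor

open FinGSet

variable {G : Type u} [Group G] {X Y Z W P Q A B T U : FinGSet G}
  (S : FrobeniusFunctor.{u, w} G)

/-- The commutative monoid of elements over `X`. -/
def val (X : FinGSet G) : Type w := S.M.obj (.of X)

instance (X : FinGSet G) : CommMonoid (S.val X) := S.mon X

/-- The restriction homomorphism. -/
def res (f : X →[G] Y) : S.val Y →* S.val X where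
  toFun := SpanCat.res S.M f
  map_one' := S.res_one f
  map_mul' := S.res_mul f

/-- The transfer. -/
def tr (f : X →[G] Y) : S.val X → S.val Y := SpanCat.tr S.M f

theorem res_id (x : S.val X) : S.res (MulActionHom.id G) x = x := SpanCat.res_id S.M x

theorem tr_id (x : S.val X) : S.tr (MulActionHom.id G) x = x := SpanCat.tr_id S.M x

theorem res_res (f : X →[G] Y) (g : Y →[G] Z) (z : S.val Z) :
    S.res f (S.res g z) = S.res (g.comp f) z := SpanCat.res_res S.M f g z

theorem tr_tr (f : X →[G] Y) (g : Y →[G] Z) (x : S.val X) :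
    S.tr g (S.tr f x) = S.tr (g.comp f) x := SpanCat.tr_tr S.M f g x

theorem res_tr {f : X →[G] Z} {g : Y →[G] Z} {a : P →[G] X} {b : P →[G] Y}
    (h : IsFibreProduct a b f g) (x : S.val X) : S.res g (S.tr f x) = S.tr b (S.res a x) :=
  SpanCat.res_tr S.M h x

theorem tr_mul_res (f : X →[G] Y) (x : S.val X) (y : S.val Y) :
    S.tr f (x * S.res f y) = S.tr f x * y := S.frobenius f x y

theorem ext {s s' : S.val B}
    (h : ∀ (T : FinGSet G) (hT : T.IsTransitive) (f : T →[G] B), S.res f s = S.res f s') :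
    s = s' := S.isAdditive.ext h

/-- The product of two transfers is the transfer from the fibre product. -/
theorem tr_mul_tr {f : X →[G] Z} {g : Y →[G] Z} {a : P →[G] X} {b : P →[G] Y}
    (h : IsFibreProduct a b f g) (x : S.val X) (y : S.val Y) :
    S.tr f x * S.tr g y = S.tr (g.comp b) (S.res a x * S.res b y) := by
  rw [← tr_tr, tr_mul_res, ← S.res_tr h, mul_comm, ← tr_mul_res, mul_comm]

/-! ### Norms along green maps -/

/-- The products over the lifts along a green map are compatible with restriction, so they glue. -/
theorem existsUnique_norm {q : A →[G] B} (hq : IsGreen q) (s : S.val A) :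
    ∃! n : S.val B, ∀ (T : FinGSet G) (hT : T.IsTransitive) (f : T →[G] B),
      S.res f n = ∏ σ : Lift q f, S.res σ.1 s := by
  refine S.isAdditive.existsUnique_glue B (fun T hT f => (∏ σ : Lift q f, S.res σ.1 s : S.val T))
    fun T U hT hU h f => ?_
  change S.res h (∏ σ : Lift q f, S.res σ.1 s) = (∏ σ : Lift q (f.comp h), S.res σ.1 s : S.val U)
  rw [map_prod]
  refine Fintype.prod_bijective _ (Lift.precomp_bijective hq f hT hU h) _ _ fun σ => ?_
  exact S.res_res _ _ _

/-- The norm along a green map `q : A ⟶ B`. Over a transitive `G`-set `T ⟶ B` it is the product over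
the lifts `T ⟶ A` along `q`, which correspond to the points of a fibre of `q`. -/
noncomputable def norm {q : A →[G] B} (hq : IsGreen q) (s : S.val A) : S.val B :=
  (S.existsUnique_norm hq s).choose

theorem res_norm_eq_prod {q : A →[G] B} (hq : IsGreen q) (s : S.val A) (hT : T.IsTransitive)
    (f : T →[G] B) : S.res f (S.norm hq s) = ∏ σ : Lift q f, S.res σ.1 s :=
  (S.existsUnique_norm hq s).choose_spec.1 T hT f

theorem norm_id (s : S.val A) : S.norm (isGreen_id A) s = s := by
  refine S.ext fun T hT f => ?_
  rw [res_norm_eq_prod _ _ _ hT]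
  exact Fintype.prod_eq_single (f := fun σ : Lift (MulActionHom.id G) f => S.res σ.1 s)
    (.mk f fun _ => rfl) fun σ hσ => (hσ (Subtype.ext σ.2)).elim

/-- Norms commute with base change. -/
theorem res_norm {q : X →[G] Z} (hq : IsGreen q) {f : Y →[G] Z} {a : P →[G] X} {b : P →[G] Y}
    (h : IsFibreProduct a b q f) (s : S.val X) :
    S.res f (S.norm hq s) = S.norm (IsGreen.of_isFibreProduct h hq) (S.res a s) := by
  refine S.ext fun T hT k => ?_
  rw [res_res, res_norm_eq_prod _ _ _ hT, res_norm_eq_prod _ _ _ hT]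
  symm
  refine Fintype.prod_bijective
    (fun τ : Lift b k => (.mk (a.comp τ.1) fun t =>
      (h.comm _).trans (congrArg f (τ.apply t)) : Lift q (f.comp k)))
    ⟨fun τ τ' e => ?_, fun σ => ?_⟩ _ _ fun τ => S.res_res _ _ _
  · refine Subtype.ext (MulActionHom.ext fun t => h.ext _ _ ?_ ?_)
    · exact DFunLike.congr_fun (congrArg Subtype.val e) t
    · exact (τ.apply t).trans (τ'.apply t).symm
  · obtain ⟨τ, h₁, h₂⟩ := h.exists_lift σ.1 k σ.apply
    exact ⟨⟨τ, h₂⟩, Subtype.ext h₁⟩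

/-- The norm along the fold map is the multiplication. -/
theorem norm_fold (s : S.val (X.sum X)) :
    S.norm (isGreen_fold X) s = S.res inl s * S.res inr s := by
  refine S.ext fun T hT f => ?_
  obtain ⟨t, -⟩ := id hT
  classical
  have : (Finset.univ : Finset (Lift (fold X) f)) =
      {.mk (inl.comp f) fun _ => rfl, .mk (inr.comp f) fun _ => rfl} := by
    refine (Finset.eq_univ_of_forall fun σ => ?_).symm
    rw [Finset.mem_insert, Finset.mem_singleton]
    rcases hT.factors σ.1 with ⟨f', hf'⟩ | ⟨f', hf'⟩
    · have : f' = f := by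
        rw [← σ.2, hf']; rfl
      exact Or.inl (Subtype.ext (hf'.trans (congrArg (inl.comp ·) this)))
    · have : f' = f := by
        rw [← σ.2, hf']; rfl
      exact Or.inr (Subtype.ext (hf'.trans (congrArg (inr.comp ·) this)))
  rw [res_norm_eq_prod _ _ _ hT, this, Finset.prod_pair, map_mul, res_res, res_res]
  · rfl
  · intro e
    exact inl_ne_inr _ _ (DFunLike.congr_fun (congrArg Subtype.val e) t)

/-- The norm along the map from the empty set is the unit. -/
theorem norm_fromEmpty (s : S.val (FinGSet.empty G))
    (h : IsGreen (fromEmpty X)) : S.norm h s = 1 := by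
  refine S.ext fun T hT f => ?_
  have : IsEmpty (Lift (fromEmpty X) f) := ⟨fun σ => isEmptyElim (σ.1 hT.choose)⟩
  rw [res_norm_eq_prod _ _ _ hT, map_one, Finset.univ_eq_empty, Finset.prod_empty]

/-! ### Products of transfers -/

/-- The maps `ρ : P ⟶ T` and `e i : P ⟶ B` exhibit `P` as the fibre product over `T` of the
`G`-sets obtained from `r : B ⟶ Y` by base change along the maps `f i : T ⟶ Y`. -/
structure IsFibreFamily {I : Type*} (ρ : P →[G] T) (e : I → (P →[G] B)) (r : B →[G] Y)
    (f : I → (T →[G] Y)) : Prop where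
  comm : ∀ i p, r (e i p) = f i (ρ p)
  ext : ∀ p p', ρ p = ρ p' → (∀ i, e i p = e i p') → p = p'
  exists_eq : ∀ t (b : I → B), (∀ i, r (b i) = f i t) → ∃ p, ρ p = t ∧ ∀ i, e i p = b i

/-- A fibre product as in `IsFibreFamily`. -/
def familyPullback {I : Type u} [Finite I] (r : B →[G] Y) (f : I → (T →[G] Y)) : FinGSet G :=
  letI : MulAction G {x : T × (I → B) // ∀ i, r (x.2 i) = f i x.1} :=
    { smul := fun k x => ⟨k • x.1, fun i => by
        change r (k • x.1.2 i) = f i (k • x.1.1)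
        rw [map_smul, map_smul, x.2]⟩
      one_smul := fun x => Subtype.ext (one_smul G x.1)
      mul_smul := fun a b x => Subtype.ext (mul_smul a b x.1) }
  ⟨{x : T × (I → B) // ∀ i, r (x.2 i) = f i x.1}⟩

/-- A product of transfers is a transfer of products from a fibre product. -/
theorem prod_res_tr {I : Type u} [Fintype I] (r : B →[G] Y) (f : I → (T →[G] Y)) {ρ : P →[G] T}
    {e : I → (P →[G] B)} (h : IsFibreFamily ρ e r f) (z : S.val B) :
    ∏ i, S.res (f i) (S.tr r z) = S.tr ρ (∏ i, S.res (e i) z) := by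
  suffices H : ∀ (I : Type u) [Finite I] [Fintype I] (f : I → (T →[G] Y)) (P : FinGSet G)
      (ρ : P →[G] T) (e : I → (P →[G] B)) (h : IsFibreFamily ρ e r f),
      ∏ i, S.res (f i) (S.tr r z) = S.tr ρ (∏ i, S.res (e i) z) from H I f P ρ e h
  intro I _
  clear h f e ρ
  induction I using Finite.induction_empty_option with
  | of_equiv φ ih =>
    intro _ f P ρ e h
    have := Fintype.ofEquiv _ φ.symm
    rw [← φ.prod_comp, ← φ.prod_comp]
    refine ih (fun i => f (φ i)) P ρ (fun i => e (φ i)) ⟨fun i p => h.comm _ p, fun p p' h₁ h₂ =>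
      h.ext p p' h₁ fun i => ?_, fun t b hb => ?_⟩
    · rw [← φ.apply_symm_apply i]
      exact h₂ _
    · obtain ⟨p, h₁, h₂⟩ := h.exists_eq t (fun i => b (φ.symm i)) fun i => by
        rw [hb, φ.apply_symm_apply]
      exact ⟨p, h₁, fun i => by rw [h₂, φ.symm_apply_apply]⟩
  | h_empty =>
    intro _ f P ρ e h
    have hρ : Function.Bijective ρ := ⟨fun p p' hp => h.ext p p' hp fun i => i.elim,
      fun t => (h.exists_eq t (fun i => i.elim) fun i => i.elim).imp fun _ => And.left⟩
    rw [Finset.univ_eq_empty, Finset.prod_empty, Finset.prod_empty, ← map_one (S.res ρ)]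
    exact (SpanCat.tr_res_of_bijective S.M hρ _).symm
  | @h_option I _ ih =>
    intro _ f P ρ e h
    have : Fintype I := Fintype.ofFinite I
    -- split off the index `none`: `P` is the fibre product of `B` and the fibre product `P'` of
    -- the other factors
    let P' := familyPullback r fun i => f (some i)
    let ρ' : P' →[G] T := ⟨fun p => p.1.1, fun _ _ => rfl⟩
    let e' (i : I) : P' →[G] B := ⟨fun p => p.1.2 i, fun _ _ => rfl⟩
    have h' : IsFibreFamily ρ' e' r fun i => f (some i) :=
      ⟨fun i p => p.2 i, fun p p' h₁ h₂ => Subtype.ext (Prod.ext h₁ (funext h₂)),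
        fun t b hb => ⟨⟨(t, b), hb⟩, rfl, fun _ => rfl⟩⟩
    let π : P →[G] P' := ⟨fun p => ⟨(ρ p, fun i => e (some i) p), fun i => h.comm _ p⟩,
      fun g p => Subtype.ext (Prod.ext (map_smul ρ g p) (funext fun i => map_smul (e _) g p))⟩
    have hπ : IsFibreProduct (e none) π r ((f none).comp ρ') := by
      refine ⟨fun p => h.comm none p, fun p p' h₁ h₂ => h.ext _ _ ?_ ?_, fun b p hb => ?_⟩
      · exact congrArg ρ' h₂
      · rintro (_ | i)
        · exact h₁
        · exact congrArg (e' i) h₂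
      · obtain ⟨p', h₁, h₂⟩ := h.exists_eq p.1.1 (fun i => i.elim b p.1.2) (by
          rintro (_ | i)
          · exact hb
          · exact p.2 i)
        exact ⟨p', h₂ none, Subtype.ext (Prod.ext h₁ (funext fun i => h₂ (some i)))⟩
    have key : S.res (f none) (S.tr r z) * S.tr ρ' (∏ i, S.res (e' i) z) =
        S.tr ρ (S.res (e none) z * ∏ i, S.res (e (some i)) z) := by
      rw [mul_comm, ← tr_mul_res, res_res, S.res_tr hπ, mul_comm, ← tr_mul_res, tr_tr, map_prod]
      congr 2
      exact Finset.prod_congr rfl fun i _ => S.res_res π (e' i) z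
    have hsplit (T : FinGSet G) (F : Option I → S.val T) : ∏ i, F i = F none * ∏ i, F (some i) := by
      rw [← Fintype.prod_option]
      exact Finset.prod_congr (Finset.ext fun i => by simp) fun _ _ => rfl
    rw [hsplit, hsplit, ih _ P' ρ' e' h', key]

end FrobeniusFunctor

/-! ### The action of green bispans -/

namespace FinGSet

variable {G : Type u} [Group G] {T : FinGSet G}

theorem IsTransitive.isGenerator (hT : T.IsTransitive) (t : T) : IsGenerator t :=
  IsGenerator.map (u := t) hT (MulActionHom.id G)

end FinGSet

namespace FrobeniusFunctor

open FinGSet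

variable {G : Type u} [Group G] {X Y Z W P Q A B T U : FinGSet G}
  (S : FrobeniusFunctor.{u, w} G)

/-- The map induced by a green bispan: restrict, take the norm, and transfer. -/
noncomputable def act (ω : GBispan X Y) (h : ω.IsGreen) (x : S.val X) : S.val Y :=
  S.tr ω.r (S.norm h (S.res ω.p x))

theorem act_iso {ω ω' : GBispan X Y} (h : ω.IsGreen) (h' : ω'.IsGreen) (i : GBispan.Iso ω ω')
    (x : S.val X) : S.act ω h x = S.act ω' h' x := by
  let α : ω.A →[G] ω'.A := ⟨i.α, i.α_smul⟩
  let β : ω.B →[G] ω'.B := ⟨i.β, i.β_smul⟩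
  have hαβ : IsFibreProduct α ω.q ω'.q β :=
    ⟨i.q_α, fun p p' h _ => i.α.injective h, fun a b e => ⟨i.α.symm a, i.α.apply_symm_apply a, by
      rw [← Equiv.apply_eq_iff_eq i.β, ← i.q_α, Equiv.apply_symm_apply]
      exact e⟩⟩
  have hp : ω.p = ω'.p.comp α := MulActionHom.ext fun a => (i.p_α a).symm
  have hr : ω.r = ω'.r.comp β := MulActionHom.ext fun a => (i.r_β a).symm
  rw [act, act, hr, ← tr_tr, hp, ← res_res, ← S.res_norm h' hαβ]
  congr 1
  exact SpanCat.tr_res_of_bijective S.M i.β.bijective _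

section comp

variable (ω₀ : GBispan X Y) (ω₁ : GBispan Y Z)

/-- The projection of the middle set of a composite to the middle set of the second bispan. -/
def compProjB : (ω₀.comp ω₁).B →[G] ω₁.B := ⟨GBispan.CompB.b, fun _ _ => rfl⟩

/-- The projection of the left hand set of a composite to that of the first bispan. -/
def compProjA : (ω₀.comp ω₁).A →[G] ω₀.A := ⟨GBispan.CompA.a₀, fun _ _ => rfl⟩

variable {ω₀ ω₁} {f : T →[G] ω₁.B}

/-- A lift `σ` of `f` along `q₁` evaluates the sections that constitute the middle set of a
composite. -/
def evalSection (σ : Lift ω₁.q f) : pullback f (compProjB ω₀ ω₁) →[G] ω₀.B where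
  toFun p := p.1.2.s (σ.1 p.1.1) ((σ.apply _).trans p.2)
  map_smul' g p := congrArg (g • ·) (p.1.2.s_congr
    (by rw [← map_smul]; exact congrArg σ.1 (inv_smul_smul g p.1.1)) _ _)

/-- Over a transitive `G`-set, the middle set of a composite is a fibre product indexed by the
lifts along `q₁`. -/
theorem isFibreFamily_evalSection (h₁ : ω₁.IsGreen) (hT : T.IsTransitive) :
    IsFibreFamily (pullbackFst f (compProjB ω₀ ω₁)) (fun σ : Lift ω₁.q f => evalSection σ) ω₀.r
      fun σ => ω₁.p.comp σ.1 where
  comm σ p := p.1.2.r_s _ _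
  ext := by
    rintro ⟨⟨t, x⟩, hx⟩ ⟨⟨t', x'⟩, hx'⟩ h hs
    obtain rfl : t = t' := h
    refine Subtype.ext (Prod.ext rfl (GBispan.CompB.ext (hx.symm.trans hx') fun a ha ha' => ?_))
    obtain ⟨σ, rfl⟩ := IsGreen.exists_lift h₁ f (hT.isGenerator t) a (ha.trans hx.symm)
    exact hs σ
  exists_eq t b hb := by
    choose σ hσ using fun a ha => IsGreen.exists_lift h₁ f (hT.isGenerator t) a ha
    refine ⟨⟨(t, ⟨f t, fun a ha => b (σ a ha), fun a ha => ?_⟩), rfl⟩, rfl, fun τ => ?_⟩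
    · rw [hb]
      exact congrArg ω₁.p (hσ a ha)
    · exact congrArg b (Lift.ext_of_isGenerator (hT.isGenerator t) (hσ _ (τ.apply t)))

/-- The lift to the left hand set of a composite that is formed by lifts to the left hand sets of
the two bispans. -/
def compLift (k : U →[G] pullback f (compProjB ω₀ ω₁)) (σ : Lift ω₁.q f)
    (τ : Lift ω₀.q ((evalSection σ).comp k)) :
    Lift (ω₀.comp ω₁).q ((pullbackSnd f (compProjB ω₀ ω₁)).comp k) :=
  .mk
    { toFun := fun u =>
        { a₀ := τ.1 u
          a₁ := σ.1 (k u).1.1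
          s := fun a ha => (k u).1.2.s a ((ha.trans (σ.apply _)).trans (k u).2)
          r_s := fun a ha => (k u).1.2.r_s a _
          q_a₀ := τ.apply u }
      map_smul' := fun g u => by
        refine GBispan.CompA.ext (map_smul τ.1 g u) ?_ fun a h h' => ?_
        · exact (congrArg (fun z => σ.1 z.1.1) (map_smul k g u)).trans (map_smul σ.1 g (k u).1.1)
        · exact GBispan.CompB.s_eq (congrArg (fun z => z.1.2) (map_smul k g u)) rfl _
            ((h'.trans (map_smul ω₁.q g (σ.1 (k u).1.1))).trans
              (congrArg (g • ·) ((σ.apply _).trans (k u).2))) }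
    fun u => GBispan.CompB.ext ((σ.apply _).trans (k u).2) fun a h h' => rfl

/-- All lifts to the left hand set of a composite arise from lifts to those of the two bispans. -/
theorem compLift_bijective (h₀ : ω₀.IsGreen) (h₁ : ω₁.IsGreen) (hT : T.IsTransitive)
    (hU : U.IsTransitive) (k : U →[G] pullback f (compProjB ω₀ ω₁)) :
    Function.Bijective fun x : Σ σ : Lift ω₁.q f, Lift ω₀.q ((evalSection σ).comp k) =>
      compLift k x.1 x.2 := by
  obtain ⟨u, hu⟩ := hU
  have ht := hT.isGenerator (k u).1.1
  constructor
  · rintro ⟨σ, τ⟩ ⟨σ', τ'⟩ e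
    have e (u) := DFunLike.congr_fun (congrArg Subtype.val e) u
    obtain rfl : σ = σ' := Lift.ext_of_isGenerator ht (congrArg GBispan.CompA.a₁ (e u))
    obtain rfl : τ = τ' := Lift.ext_of_isGenerator hu (congrArg GBispan.CompA.a₀ (e u))
    rfl
  · intro l
    have hb (u) : ω₁.q (l.1 u).a₁ = f (k u).1.1 :=
      (congrArg GBispan.CompB.b (l.apply u)).trans (k u).2.symm
    obtain ⟨σ, hσ⟩ := IsGreen.exists_lift h₁ f ht (l.1 u).a₁ (hb u)
    have hσ' (u') : σ.1 (k u').1.1 = (l.1 u').a₁ := by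
      obtain ⟨g, rfl⟩ := hu u'
      rw [map_smul k, map_smul l.1]
      exact (map_smul σ.1 g _).trans (congrArg (g • ·) hσ)
    refine ⟨⟨σ, .mk ((compProjA ω₀ ω₁).comp l.1) fun u => ?_⟩, Subtype.ext (MulActionHom.ext
      fun u => GBispan.CompA.ext rfl (hσ' u) fun a h h' => ?_)⟩
    · exact (l.1 u).q_a₀.trans (GBispan.CompB.s_eq (l.apply u) (hσ' u).symm _ _)
    · exact (GBispan.CompB.s_eq (l.apply u) rfl h' _).symm

/-- The norm along `q₁` of a transfer along `r₀`, for norms along `q₀`, is computed by the composite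
bispan. -/
theorem norm_res_tr_norm (h₀ : IsGreen ω₀.q) (h₁ : IsGreen ω₁.q) (h : IsGreen (ω₀.comp ω₁).q)
    (y : S.val ω₀.A) : S.norm h₁ (S.res ω₁.p (S.tr ω₀.r (S.norm h₀ y))) =
      S.tr (compProjB ω₀ ω₁) (S.norm h (S.res (compProjA ω₀ ω₁) y)) := by
  refine S.ext fun T hT f => ?_
  rw [res_norm_eq_prod _ _ _ hT, S.res_tr (isFibreProduct_pullback f (compProjB ω₀ ω₁)).symm]
  simp only [res_res]
  rw [S.prod_res_tr ω₀.r _ (isFibreFamily_evalSection h₁ hT)]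
  congr 1
  refine S.ext fun U hU k => ?_
  rw [res_res, res_norm_eq_prod _ _ _ hU, map_prod]
  simp only [res_res]
  refine (Finset.prod_congr rfl fun σ _ => res_norm_eq_prod S h₀ y hU _).trans ?_
  rw [← Fintype.prod_sigma']
  exact Fintype.prod_bijective _ (compLift_bijective h₀ h₁ hT hU k) _ _ fun _ => rfl

/-- The action of green bispans respects composition. -/
theorem act_comp (h₀ : ω₀.IsGreen) (h₁ : ω₁.IsGreen) (x : S.val X) :
    S.act (ω₀.comp ω₁) (h₀.comp h₁) x = S.act ω₁ h₁ (S.act ω₀ h₀ x) := by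
  refine Eq.trans ?_ (congrArg (S.tr ω₁.r)
    (S.norm_res_tr_norm h₀ h₁ (h₀.comp h₁) (S.res ω₀.p x)).symm)
  rw [tr_tr, res_res]
  rfl

end comp

/-- On spans the action is the given functor. -/
theorem act_span (ω : GSpan X Y) (x : S.val X) :
    S.act ⟨ω.A, ω.A, ω.p, MulActionHom.id G, ω.q⟩ (isGreen_id _) x =
      S.M.map (SpanCat.mk ω) x := by
  refine (congrArg (S.tr ω.q) (S.norm_id _)).trans ?_
  exact (SpanCat.map_mk_apply S.M ω x).symm

/-- The functor on green bispans defined by a Mackey functor with a multiplication. -/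
noncomputable def toGreen : GreenBispanCat G ⥤ Type w where
  -- a morphism is represented by a chosen green bispan; the choice does not matter by `act_iso`
  obj X := S.M.obj (.of X.obj.toGSet)
  map {X Y} f := ↾(S.act f.2.choose f.2.choose_spec.2)
  map_id X := by
    ext x
    let h := (𝟙 X : X ⟶ X).2
    obtain ⟨i⟩ := Quotient.exact h.choose_spec.1
    refine (S.act_iso h.choose_spec.2 (GBispan.isGreen_id _) i x).trans ?_
    exact (S.act_span (GSpan.id X.obj.toGSet) x).trans (SpanCat.map_id_apply S.M x)
  map_comp {X Y Z} f g := by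
    ext x
    obtain ⟨i⟩ : Nonempty (GBispan.Iso (f ≫ g).2.choose (f.2.choose.comp g.2.choose)) := by
      refine Quotient.exact ((f ≫ g).2.choose_spec.1.trans ?_)
      exact congrArg₂ (· ≫ ·) f.2.choose_spec.1.symm g.2.choose_spec.1.symm
    exact (S.act_iso (f ≫ g).2.choose_spec.2 (f.2.choose_spec.2.comp g.2.choose_spec.2) i x).trans
      (S.act_comp f.2.choose_spec.2 g.2.choose_spec.2 x)

theorem toGreen_map_mk (ω : GBispan X Y) (h : ω.IsGreen) (x : S.val X) :
    S.toGreen.map (GreenBispanCat.mk ω h) x = S.act ω h x := by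
  obtain ⟨i⟩ := Quotient.exact (GreenBispanCat.mk ω h).2.choose_spec.1
  exact S.act_iso (GreenBispanCat.mk ω h).2.choose_spec.2 h i x

end FrobeniusFunctor

/-! ### The multiplication on a Green functor -/

namespace GreenBispanCat

open FinGSet

variable {G : Type u} [Group G] {X Y Z W P A B T : FinGSet G}

theorem preservesFiniteProducts_iff_isAdditive (F : GreenBispanCat G ⥤ Type w) :
    Limits.PreservesFiniteProducts F ↔ SpanCat.IsAdditive (incl G ⋙ F) := by
  refine (preservesFiniteProducts_type_iff F (of (FinGSet.empty G))
    (fun X => existsUnique_to_empty X.obj.toGSet)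
    (fun X Y => of (X.obj.toGSet.sum Y.obj.toGSet))
    (fun X Y => (incl G).map (SpanCat.mk (GSpan.R inl)))
    (fun X Y => (incl G).map (SpanCat.mk (GSpan.R inr)))
    fun X Y W f g => existsUnique_lift f g).trans ?_
  exact and_congr Iff.rfl ⟨fun h X Y => h (of X) (of Y),
    fun h X Y => h X.obj.toGSet Y.obj.toGSet⟩

variable (F : GreenBispanCat G ⥤ Type w)

/-- The elements of a functor on green bispans over `X`. -/
def elts (X : FinGSet G) : Type w := (incl G ⋙ F).obj (.of X)

/-- The restriction along `f`. -/
def res (f : X →[G] Y) : elts F Y → elts F X := SpanCat.res (incl G ⋙ F) f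

/-- The transfer along `f`. -/
def tr (f : X →[G] Y) : elts F X → elts F Y := SpanCat.tr (incl G ⋙ F) f

/-- The norm along a green map. -/
def nm (q : X →[G] Y) (hq : IsGreen q) (x : elts F X) : elts F Y := F.map (norm q hq) x

theorem res_res (f : X →[G] Y) (g : Y →[G] Z) (z : elts F Z) :
    res F f (res F g z) = res F (g.comp f) z := SpanCat.res_res _ f g z

theorem res_tr {f : X →[G] Z} {g : Y →[G] Z} {a : P →[G] X} {b : P →[G] Y}
    (h : IsFibreProduct a b f g) (x : elts F X) : res F g (tr F f x) = tr F b (res F a x) :=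
  SpanCat.res_tr _ h x

theorem map_comp_apply {X Y Z : GreenBispanCat G} (f : X ⟶ Y) (g : Y ⟶ Z) (x : F.obj X) :
    F.map (f ≫ g) x = F.map g (F.map f x) := by
  rw [F.map_comp]; rfl

theorem nm_id (x : elts F X) : nm F (MulActionHom.id G) (isGreen_id X) x = x := by
  exact ConcreteCategory.congr_hom (F.map_id (of X)) x

theorem nm_nm (f : X →[G] Y) (hf : IsGreen f) (g : Y →[G] Z) (hg : IsGreen g) (x : elts F X) :
    nm F g hg (nm F f hf x) = nm F (g.comp f) (hg.comp hf) x :=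
  (map_comp_apply F _ _ x).symm.trans (congrArg (fun k => F.map k x) (norm_comp f hf g hg))

theorem res_nm {q : X →[G] Z} (hq : IsGreen q) {f : Y →[G] Z} {a : P →[G] X} {b : P →[G] Y}
    (h : IsFibreProduct a b q f) (x : elts F X) :
    res F f (nm F q hq x) = nm F b (IsGreen.of_isFibreProduct h hq) (res F a x) :=
  (map_comp_apply F _ _ x).symm.trans ((congrArg (fun k => F.map k x) (norm_comp_R hq h)).trans
    (map_comp_apply F _ _ x))

theorem map_mk_apply (ω : GBispan X Y) (h : ω.IsGreen) (x : elts F X) :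
    F.map (mk ω h) x = tr F ω.r (nm F ω.q h (res F ω.p x)) := by
  refine (congrArg (fun k => F.map k x) (mk_eq_R_comp_norm_comp_T ω h)).trans ?_
  exact (map_comp_apply F _ _ x).trans (map_comp_apply F _ _ _)

/-- Norms can be transported along isomorphisms of the source. -/
theorem nm_res_of_bijective {e : X →[G] Y} (he : Function.Bijective e) {q : Y →[G] Z}
    (hq : IsGreen q) {q' : X →[G] Z} (hq' : IsGreen q') (h : ∀ x, q (e x) = q' x)
    (y : elts F Y) : nm F q' hq' (res F e y) = nm F q hq y := by
  obtain rfl : q.comp e = q' := MulActionHom.ext h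
  have hge : IsGreen e := isGreen_of_injective he.1
  rw [← nm_nm F e hge q hq]
  congr 1
  refine SpanCat.res_injective_of_bijective (incl G ⋙ F) he ?_
  refine (res_nm F hge (isFibreProduct_of_injective he.1) _).trans ?_
  rw [nm_id]
  exact SpanCat.res_id _ _

variable {F} (hF : SpanCat.IsAdditive (incl G ⋙ F))

/-- The element over a disjoint union with given restrictions. -/
noncomputable def pair (x : elts F X) (y : elts F Y) : elts F (X.sum Y) :=
  ((hF.2 X Y).2 (x, y)).choose

theorem res_inl_pair (x : elts F X) (y : elts F Y) : res F inl (pair hF x y) = x :=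
  congrArg Prod.fst ((hF.2 X Y).2 (x, y)).choose_spec

theorem res_inr_pair (x : elts F X) (y : elts F Y) : res F inr (pair hF x y) = y :=
  congrArg Prod.snd ((hF.2 X Y).2 (x, y)).choose_spec

theorem sum_ext (hF : SpanCat.IsAdditive (incl G ⋙ F)) {z z' : elts F (X.sum Y)}
    (h₁ : res F inl z = res F inl z') (h₂ : res F inr z = res F inr z') : z = z' :=
  (hF.2 X Y).1 (Prod.ext h₁ h₂)

theorem pair_eq {x : elts F X} {y : elts F Y} {z : elts F (X.sum Y)} (h₁ : x = res F inl z)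
    (h₂ : y = res F inr z) : pair hF x y = z :=
  sum_ext hF ((res_inl_pair hF x y).trans h₁) ((res_inr_pair hF x y).trans h₂)

theorem pair_res_res (z : elts F (X.sum Y)) : pair hF (res F inl z) (res F inr z) = z :=
  pair_eq hF rfl rfl

/-- The multiplication: the norm along the fold map. -/
noncomputable def mul (x y : elts F X) : elts F X := nm F (fold X) (isGreen_fold X) (pair hF x y)

/-- The element over the empty set. -/
noncomputable def nil : elts F (FinGSet.empty G) := hF.1.choose

theorem eq_nil (x : elts F (FinGSet.empty G)) : x = nil hF := hF.1.choose_spec.2 x trivial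

/-- The unit: the norm along the map from the empty set. -/
noncomputable def one (X : FinGSet G) : elts F X :=
  nm F (fromEmpty X) (isGreen_of_injective fun a => isEmptyElim a) (nil hF)

theorem nm_fold (z : elts F (X.sum X)) :
    nm F (fold X) (isGreen_fold X) z = mul hF (res F inl z) (res F inr z) := by
  rw [mul, pair_res_res]

theorem nm_sumMap {f : X →[G] Z} (hf : IsGreen f) {g : Y →[G] W} (hg : IsGreen g)
    (x : elts F X) (y : elts F Y) :
    nm F (sumMap f g) (hf.sumMap hg) (pair hF x y) = pair hF (nm F f hf x) (nm F g hg y) := by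
  symm
  refine pair_eq hF ?_ ?_
  · rw [res_nm F _ (isFibreProduct_inl f g), res_inl_pair]
  · rw [res_nm F _ (isFibreProduct_inr f g), res_inr_pair]

theorem mul_comm' (x y : elts F X) : mul hF x y = mul hF y x := by
  have h : Function.Bijective (desc inr inl : X.sum X →[G] X.sum X) :=
    (Equiv.sumComm X X).bijective
  rw [mul, mul, ← nm_res_of_bijective F h (isGreen_fold X) (isGreen_fold X)]
  · congr 1
    symm
    refine pair_eq hF ?_ ?_
    · exact (res_inr_pair hF x y).symm.trans (res_res F inl (desc inr inl) (pair hF x y)).symm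
    · exact (res_inl_pair hF x y).symm.trans (res_res F inr (desc inr inl) (pair hF x y)).symm
  · rintro (a | a) <;> rfl

theorem one_mul' (x : elts F X) : mul hF (one hF X) x = x := by
  have hg : IsGreen (fromEmpty X) := isGreen_of_injective fun a => isEmptyElim a
  have h : Function.Bijective (desc (fromEmpty X) (MulActionHom.id G)) :=
    desc_bijective (fun a => isEmptyElim a) (fun _ _ h => h) (fun a => isEmptyElim a)
      fun x => Or.inr ⟨x, rfl⟩
  have e : one hF X = nm F (fromEmpty X) hg (nil hF) := rfl
  conv_lhs => rw [mul, e, ← nm_id F x, ← nm_sumMap hF hg (isGreen_id X), nm_nm]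
  rw [show pair hF (nil hF) x = res F (desc (fromEmpty X) (MulActionHom.id G)) x from ?_,
    nm_res_of_bijective F h (isGreen_id X), nm_id]
  · rintro (a | a)
    · exact isEmptyElim (show FinGSet.empty G from a)
    · rfl
  · refine pair_eq hF (eq_nil hF _).symm ?_
    exact (SpanCat.res_id (incl G ⋙ F) x).symm.trans
      (res_res F inr (desc (fromEmpty X) (MulActionHom.id G)) x).symm

theorem mul_assoc' (x y z : elts F X) : mul hF (mul hF x y) z = mul hF x (mul hF y z) := by
  let a : X.sum (X.sum X) →[G] (X.sum X).sum X := desc (inl.comp inl) (desc (inl.comp inr) inr)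
  have ha : Function.Bijective a := (Equiv.sumAssoc X X X).symm.bijective
  have e₁ : mul hF (mul hF x y) z = nm F _
      ((isGreen_fold X).comp ((isGreen_fold X).sumMap (isGreen_id X)))
      (pair hF (pair hF x y) z) := by
    rw [← nm_nm F _ ((isGreen_fold X).sumMap (isGreen_id X)) _ (isGreen_fold X),
      nm_sumMap hF (isGreen_fold X) (isGreen_id X), nm_id]
    rfl
  have e₂ : mul hF x (mul hF y z) = nm F _
      ((isGreen_fold X).comp ((isGreen_id X).sumMap (isGreen_fold X)))
      (pair hF x (pair hF y z)) := by
    rw [← nm_nm F _ ((isGreen_id X).sumMap (isGreen_fold X)) _ (isGreen_fold X),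
      nm_sumMap hF (isGreen_id X) (isGreen_fold X), nm_id]
    rfl
  rw [e₁, e₂]
  rw [← nm_res_of_bijective F ha _
    ((isGreen_fold X).comp ((isGreen_id X).sumMap (isGreen_fold X)))]
  · congr 1
    symm
    refine pair_eq hF ?_ (pair_eq hF ?_ ?_)
    · rw [res_res]
      change x = res F (inl.comp inl) _
      rw [← res_res, res_inl_pair, res_inl_pair]
    · rw [res_res, res_res]
      change y = res F (inl.comp inr) _
      rw [← res_res, res_inl_pair, res_inr_pair]
    · rw [res_res, res_res]
      change z = res F inr _
      rw [res_inr_pair]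
  · rintro (b | b | b) <;> rfl

theorem res_mul' (f : X →[G] Y) (x y : elts F Y) :
    res F f (mul hF x y) = mul hF (res F f x) (res F f y) := by
  have h : IsFibreProduct (sumMap f f) (fold X) (fold Y) f := by
    refine ⟨?_, ?_, ?_⟩
    · rintro (a | a) <;> rfl
    · rintro (a | a) (b | b) h h'
      · exact congrArg Sum.inl h'
      · exact (inl_ne_inr _ _ h).elim
      · exact (inl_ne_inr _ _ h.symm).elim
      · exact congrArg Sum.inr h'
    · rintro (a | a) b h
      · exact ⟨inl b, congrArg Sum.inl (Eq.symm h), rfl⟩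
      · exact ⟨inr b, congrArg Sum.inr (Eq.symm h), rfl⟩
  rw [mul, res_nm F _ h, nm_fold hF, res_res, res_res]
  change mul hF (res F (inl.comp f) _) (res F (inr.comp f) _) = _
  rw [← res_res, ← res_res, res_inl_pair, res_inr_pair]

theorem res_one' (f : X →[G] Y) : res F f (one hF Y) = one hF X := by
  have h : IsFibreProduct (MulActionHom.id G) (fromEmpty X) (fromEmpty Y) f :=
    ⟨fun a => isEmptyElim a, fun a => isEmptyElim a, fun a => isEmptyElim a⟩
  rw [one, res_nm F _ h]
  congr 1
  exact SpanCat.res_id _ _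

theorem frobenius' (f : X →[G] Y) (x : elts F X) (y : elts F Y) :
    tr F f (mul hF x (res F f y)) = mul hF (tr F f x) y := by
  have h := congrArg (fun k => F.map k (pair hF x y)) (T_comp_norm_fold f)
  replace h : nm F (fold Y) (isGreen_fold Y) (tr F (sumMap f (MulActionHom.id G)) (pair hF x y)) =
      tr F f (nm F (fold X) (isGreen_fold X)
        (res F (sumMap (MulActionHom.id G) f) (pair hF x y))) :=
    (map_comp_apply F _ _ _).symm.trans (h.trans ((map_comp_apply F _ _ _).trans
      (map_comp_apply F _ _ _)))
  rw [nm_fold hF, nm_fold hF, res_res, res_res, res_tr F (isFibreProduct_inl _ _),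
    res_tr F (isFibreProduct_inr _ _), res_inl_pair, res_inr_pair] at h
  change _ = tr F f (mul hF (res F (inl.comp (MulActionHom.id G)) _) (res F (inr.comp f) _)) at h
  rw [← res_res, ← res_res, res_inl_pair, res_inr_pair] at h
  refine Eq.trans ?_ (h.symm.trans ?_)
  · congr 2
    exact (SpanCat.res_id (incl G ⋙ F) x).symm
  · congr 1
    exact SpanCat.tr_id (incl G ⋙ F) y

/-- The Mackey functor with multiplication attached to a Green functor. -/
noncomputable def toFrobenius : FrobeniusFunctor.{u, w} G where
  M := incl G ⋙ F
  isAdditive := hF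
  mon X :=
    { mul := mul hF (X := X)
      one := one hF X
      mul_assoc := mul_assoc' hF
      one_mul := one_mul' hF
      mul_one := fun x => (mul_comm' hF x _).trans (one_mul' hF x)
      mul_comm := mul_comm' hF }
  res_mul := res_mul' hF
  res_one := res_one' hF
  frobenius := frobenius' hF

/-- If `W` is a disjoint union of copies of `T`, embedded by the sections `i l` of `n : W ⟶ T`, then
`n` is an iterated fold map, and the norm along `n` is the product of the restrictions to the
copies. -/
theorem nm_eq_prod {I : Type u} [Fintype I] {T W : FinGSet G} (n : W →[G] T) (hn : IsGreen n)
    (i : I → (T →[G] W)) (hi : ∀ l t, n (i l t) = t)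
    (hinj : ∀ l l' t, i l t = i l' t → l = l') (hsurj : ∀ w, ∃ l, i l (n w) = w)
    (s : elts F W) :
    nm F n hn s = (∏ l, (toFrobenius hF).res (i l) s : (toFrobenius hF).val T) := by
  suffices H : ∀ (I : Type u) [Finite I] [Fintype I] (W : FinGSet G) (n : W →[G] T)
      (hn : IsGreen n) (i : I → (T →[G] W)) (hi : ∀ l t, n (i l t) = t)
      (hinj : ∀ l l' t, i l t = i l' t → l = l') (hsurj : ∀ w, ∃ l, i l (n w) = w)
      (s : elts F W),
      nm F n hn s = (∏ l, (toFrobenius hF).res (i l) s : (toFrobenius hF).val T) from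
    H I W n hn i hi hinj hsurj s
  clear hinj hsurj hi i s hn n W
  intro I _
  induction I using Finite.induction_empty_option with
  | of_equiv φ ih =>
    intro _ W n hn i hi hinj hsurj s
    have := Fintype.ofEquiv _ φ.symm
    rw [← φ.prod_comp]
    refine ih W n hn (fun l => i (φ l)) (fun l => hi _)
      (fun l l' t h => φ.injective (hinj _ _ _ h)) (fun w => ?_) s
    obtain ⟨l, hl⟩ := hsurj w
    exact ⟨φ.symm l, by rw [φ.apply_symm_apply, hl]⟩
  | h_empty =>
    intro _ W n hn i hi hinj hsurj s
    have he : Function.Bijective (fromEmpty W) :=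
      ⟨fun a => isEmptyElim a, fun w => (hsurj w).choose.elim⟩
    rw [Finset.univ_eq_empty, Finset.prod_empty,
      ← nm_res_of_bijective F he hn (isGreen_of_injective fun a => isEmptyElim a)
        (fun a => isEmptyElim a)]
    exact congrArg _ (eq_nil hF _)
  | @h_option I _ ih =>
    intro _ W n hn i hi hinj hsurj s
    have : Fintype I := Fintype.ofFinite I
    have hs (g : G) (w : W) : (∃ l : I, i (some l) (n w) = w) →
        ∃ l : I, i (some l) (n (g • w)) = g • w := by
      rintro ⟨l, hl⟩
      exact ⟨l, by rw [map_smul, map_smul, hl]⟩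
    -- `W` is the disjoint union of the image `T` of `i none` and the images `W'` of the others
    let W' : FinGSet G := W.sub _ hs
    let j : W' →[G] W := W.subIncl _ hs
    have hn' : IsGreen (n.comp j) := hn.comp (isGreen_of_injective Subtype.val_injective)
    let i' (l : I) : T →[G] W' := ⟨fun t => ⟨i (some l) t, l, by rw [hi]⟩,
      fun g t => Subtype.ext (map_smul (i (some l)) g t)⟩
    have he : Function.Bijective (desc (i none) j) := by
      refine desc_bijective (fun t t' h => ?_) Subtype.val_injective ?_ fun w => ?_
      · rw [← hi none t, h, hi]
      · rintro t ⟨w, l, hl⟩ h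
        have hw : t = n w := (hi none t).symm.trans (congrArg n h)
        have := hinj none (some l) t (h.trans (hl.symm.trans (congrArg _ hw.symm)))
        exact nomatch this
      · obtain ⟨_ | l, hl⟩ := hsurj w
        · exact Or.inl ⟨_, hl⟩
        · exact Or.inr ⟨⟨w, l, hl⟩, rfl⟩
    have hsplit (F' : Option I → (toFrobenius hF).val T) :
        ∏ l, F' l = F' none * ∏ l, F' (some l) := by
      rw [← Fintype.prod_option]
      exact Finset.prod_congr (Finset.ext fun i => by simp) fun _ _ => rfl
    have hpair : res F (desc (i none) j) s = pair hF (res F (i none) s) (res F j s) :=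
      (pair_eq hF (res_res F inl (desc (i none) j) s).symm
        (res_res F inr (desc (i none) j) s).symm).symm
    rw [hsplit, ← nm_res_of_bijective F he hn
      ((isGreen_fold T).comp ((isGreen_id T).sumMap hn')), hpair,
      ← nm_nm F _ ((isGreen_id T).sumMap hn') _ (isGreen_fold T),
      nm_sumMap hF (isGreen_id T) hn', nm_id]
    · have hres : (∏ l, (toFrobenius hF).res (i' l) (res F j s) : (toFrobenius hF).val T) =
          ∏ l, (toFrobenius hF).res (i (some l)) s :=
        Finset.prod_congr rfl fun l _ => (toFrobenius hF).res_res (i' l) j s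
      refine congrArg (mul hF (res F (i none) s)) ((ih W' _ hn' i' (fun l => hi _)
        (fun l l' t h => ?_) (fun w => ?_) (res F j s)).trans hres)
      · exact Option.some_injective _ (hinj _ _ t (congrArg j h))
      · obtain ⟨w, l, hl⟩ := w
        exact ⟨l, Subtype.ext hl⟩
    · rintro (t | w)
      · exact hi none t
      · rfl

/-- The norms of a Green functor are those of the associated multiplication: over a transitive
`G`-set, a green map is a disjoint union of copies, one for every lift. -/
theorem nm_eq_norm {q : A →[G] B} (hq : IsGreen q) (s : elts F A) :
    nm F q hq s = (toFrobenius hF).norm hq s := by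
  refine (toFrobenius hF).ext fun T hT f => ?_
  refine Eq.trans ?_ ((toFrobenius hF).res_norm_eq_prod hq s hT f).symm
  have h := isFibreProduct_pullback q f
  have hres : (∏ σ : Lift q f, (toFrobenius hF).res (⟨fun t => ⟨(σ.1 t, t), σ.apply t⟩, fun g t =>
      Subtype.ext (Prod.ext (map_smul σ.1 g t) rfl)⟩ : T →[G] pullback q f)
        (res F (pullbackFst q f) s) : (toFrobenius hF).val T) =
      ∏ σ : Lift q f, (toFrobenius hF).res σ.1 s :=
    Finset.prod_congr rfl fun σ _ => (toFrobenius hF).res_res _ (pullbackFst q f) s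
  refine (res_nm F hq h s).trans ((nm_eq_prod hF (pullbackSnd q f) (IsGreen.of_isFibreProduct h hq)
    _ (fun σ t => rfl) (fun σ σ' t e => ?_) (fun w => ?_) _).trans hres)
  · exact Lift.ext_of_isGenerator (hT.isGenerator t) (congrArg (pullbackFst q f) e)
  · obtain ⟨⟨a, t⟩, e⟩ := w
    obtain ⟨σ, hσ⟩ := hq.exists_lift f (hT.isGenerator t) a e
    exact ⟨σ, Subtype.ext (Prod.ext hσ rfl)⟩

end GreenBispanCat

/-! ### Green functors and Mackey functors with multiplications -/

namespace FrobeniusFunctor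

open FinGSet

variable {G : Type u} [Group G] {X Y Z A B : FinGSet G}

/-- A morphism is a natural transformation that preserves multiplications and units. -/
@[ext]
structure Hom (S S' : FrobeniusFunctor.{u, w} G) where
  /-- The underlying natural transformation. -/
  trans : S.M ⟶ S'.M
  map_mul : ∀ {X : FinGSet G} (x y : S.val X), (trans.app (.of X) (x * y) : S'.val X) =
    (show S'.val X from trans.app (.of X) x) * (show S'.val X from trans.app (.of X) y)
  map_one : ∀ X : FinGSet G, (trans.app (.of X) (1 : S.val X) : S'.val X) = (1 : S'.val X)

instance : Category (FrobeniusFunctor.{u, w} G) where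
  Hom := Hom
  id S := ⟨𝟙 _, fun _ _ => rfl, fun _ => rfl⟩
  comp f g := ⟨f.trans ≫ g.trans, fun x y => (congrArg _ (f.map_mul x y)).trans (g.map_mul _ _),
    fun X => (congrArg _ (f.map_one X)).trans (g.map_one X)⟩

variable {S S' : FrobeniusFunctor.{u, w} G}

/-- The homomorphism of monoids over `X`. -/
def Hom.app (f : S ⟶ S') (X : FinGSet G) : S.val X →* S'.val X where
  toFun x := f.trans.app (.of X) x
  map_mul' := f.map_mul
  map_one' := f.map_one X

/-- An isomorphism given by a multiplicative natural isomorphism. -/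
noncomputable def isoMk (f : S ⟶ S') (hf : IsIso f.trans) : S ≅ S' where
  hom := f
  inv :=
    { trans := inv f.trans
      map_mul := fun {X} x y => by
        have h (z : S'.val X) : f.trans.app (.of X) ((inv f.trans).app (.of X) z) = z :=
          ConcreteCategory.congr_hom (NatTrans.congr_app (IsIso.inv_hom_id f.trans) _) z
        have h' (z : S.val X) : (inv f.trans).app (.of X) (f.trans.app (.of X) z) = z :=
          ConcreteCategory.congr_hom (NatTrans.congr_app (IsIso.hom_inv_id f.trans) _) z
        refine Eq.trans (congrArg _ ?_) (h' _)
        exact ((f.map_mul _ _).trans (congrArg₂ _ (h x) (h y))).symm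
      map_one := fun X => by
        have h' (z : S.val X) : (inv f.trans).app (.of X) (f.trans.app (.of X) z) = z :=
          ConcreteCategory.congr_hom (NatTrans.congr_app (IsIso.hom_inv_id f.trans) _) z
        exact (congrArg _ (f.map_one X).symm).trans (h' _) }
  hom_inv_id := Hom.ext (IsIso.hom_inv_id f.trans)
  inv_hom_id := Hom.ext (IsIso.inv_hom_id f.trans)

theorem Hom.app_res (f : S ⟶ S') (h : X →[G] Y) (y : S.val Y) :
    f.app X (S.res h y) = S'.res h (f.app Y y) := SpanCat.res_app f.trans h y

theorem Hom.app_tr (f : S ⟶ S') (h : X →[G] Y) (x : S.val X) :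
    f.app Y (S.tr h x) = S'.tr h (f.app X x) := SpanCat.tr_app f.trans h x

theorem Hom.app_norm (f : S ⟶ S') {q : A →[G] B} (hq : IsGreen q) (s : S.val A) :
    f.app B (S.norm hq s) = S'.norm hq (f.app A s) := by
  refine S'.ext fun T hT h => ?_
  rw [← app_res, res_norm_eq_prod _ _ _ hT, res_norm_eq_prod _ _ _ hT, map_prod]
  exact Finset.prod_congr rfl fun σ _ => f.app_res σ.1 s

/-- The functor `toGreen` extends the functor on spans. -/
noncomputable def inclToGreen (S : FrobeniusFunctor.{u, w} G) :
    GreenBispanCat.incl G ⋙ S.toGreen ≅ S.M :=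
  NatIso.ofComponents (fun X => Iso.refl _) fun {X Y} f => by
    obtain ⟨ω, rfl⟩ := SpanCat.exists_mk (X := X.toGSet) (Y := Y.toGSet) f
    ext x
    exact (S.toGreen_map_mk ⟨ω.A, ω.A, ω.p, MulActionHom.id G, ω.q⟩ (isGreen_id ω.A) x).trans
      (S.act_span ω x)

theorem isAdditive_toGreen (S : FrobeniusFunctor.{u, w} G) :
    SpanCat.IsAdditive (GreenBispanCat.incl G ⋙ S.toGreen) := by
  rw [← SpanCat.isMackey_iff_isAdditive]
  have := (SpanCat.isMackey_iff_isAdditive S.M).2 S.isAdditive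
  exact ⟨fun n => @Limits.preservesLimitsOfShape_of_natIso _ _ _ _ _ _ _ _ S.inclToGreen.symm
    (this.preserves n)⟩

theorem toGreen_nm (S : FrobeniusFunctor.{u, w} G) {q : A →[G] B} (hq : IsGreen q) (s : S.val A) :
    GreenBispanCat.nm S.toGreen q hq s = S.norm hq s := by
  refine (S.toGreen_map_mk ⟨A, B, MulActionHom.id G, q, MulActionHom.id G⟩ hq s).trans
    ((S.tr_id _).trans ?_)
  exact congrArg (S.norm hq) (S.res_id s)

theorem toGreen_res (S : FrobeniusFunctor.{u, w} G) (f : X →[G] Y) (y : S.val Y) :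
    GreenBispanCat.res S.toGreen f y = S.res f y :=
  SpanCat.res_app S.inclToGreen.hom f y

/-- The multiplication that underlies the Green functor attached to a multiplication is the given
one. -/
noncomputable def toFrobeniusToGreen (S : FrobeniusFunctor.{u, w} G) :
    GreenBispanCat.toFrobenius S.isAdditive_toGreen ≅ S :=
  isoMk (S := GreenBispanCat.toFrobenius S.isAdditive_toGreen) (S' := S)
    { trans := S.inclToGreen.hom
      map_mul := fun x y => by
        refine (S.toGreen_nm _ _).trans ((S.norm_fold _).trans ?_)
        exact congrArg₂ _
          ((S.toGreen_res _ _).symm.trans (GreenBispanCat.res_inl_pair S.isAdditive_toGreen x y))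
          ((S.toGreen_res _ _).symm.trans (GreenBispanCat.res_inr_pair S.isAdditive_toGreen x y))
      map_one := fun X => (S.toGreen_nm _ _).trans (S.norm_fromEmpty _ _) }
    (inferInstance : IsIso S.inclToGreen.hom)

end FrobeniusFunctor

namespace GreenBispanCat

open FinGSet

variable {G : Type u} [Group G] {X Y Z A B : FinGSet G} {F F' : GreenBispanCat G ⥤ Type w}

theorem nm_app (α : F ⟶ F') {q : A →[G] B} (hq : IsGreen q) (s : elts F A) :
    α.app (of B) (nm F q hq s) = nm F' q hq (α.app (of A) s) :=
  ConcreteCategory.congr_hom (α.naturality (norm q hq)) s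

theorem res_app (α : F ⟶ F') (f : X →[G] Y) (y : elts F Y) :
    α.app (of X) (res F f y) = res F' f (α.app (of Y) y) :=
  SpanCat.res_app (Functor.whiskerLeft (incl G) α) f y

/-- The functor from Green functors to Mackey functors with multiplications. -/
noncomputable def toFrobeniusFunctor (G : Type u) [Group G] :
    GreenFunctor.{u, w} G ⥤ FrobeniusFunctor.{u, w} G where
  obj F := toFrobenius ((preservesFiniteProducts_iff_isAdditive F.obj).1 F.property)
  map {F F'} α :=
    { trans := Functor.whiskerLeft (incl G) α.hom
      map_mul := fun x y => by
        refine (nm_app α.hom (isGreen_fold _) _).trans (congrArg _ ?_)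
        symm
        refine pair_eq _ ?_ ?_
        · exact (congrArg _ (res_inl_pair _ x y).symm).trans (res_app α.hom _ _)
        · exact (congrArg _ (res_inr_pair _ x y).symm).trans (res_app α.hom _ _)
      map_one := fun X => (nm_app α.hom _ _).trans (congrArg _ (eq_nil _ _)) }

instance : (toFrobeniusFunctor.{u, w} G).Faithful where
  map_injective {F F'} α β h := by
    refine ObjectProperty.hom_ext _ (NatTrans.ext (funext fun X => ?_))
    exact NatTrans.congr_app (congrArg FrobeniusFunctor.Hom.trans h) (.of X.obj.toGSet)

instance : (toFrobeniusFunctor.{u, w} G).Full where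
  map_surjective {F F'} ψ := by
    refine ⟨⟨{ app := fun X => ψ.trans.app (.of X.obj.toGSet), naturality := fun X Y f => ?_ }⟩,
      rfl⟩
    obtain ⟨ω, h, rfl⟩ := exists_mk (X := X.obj.toGSet) (Y := Y.obj.toGSet) f
    ext x
    refine (congrArg (ψ.app _) (map_mk_apply F.obj ω h x)).trans
      (Eq.trans ?_ (map_mk_apply F'.obj ω h _).symm)
    refine (ψ.app_tr ω.r _).trans (congrArg (tr F'.obj ω.r) ?_)
    refine (congrArg (ψ.app _) (nm_eq_norm _ h _)).trans
      (Eq.trans ?_ (nm_eq_norm _ h _).symm)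
    exact (ψ.app_norm h _).trans (congrArg _ (ψ.app_res ω.p x))

instance : (toFrobeniusFunctor.{u, w} G).EssSurj where
  mem_essImage S := ⟨⟨S.toGreen,
    (preservesFiniteProducts_iff_isAdditive _).2 S.isAdditive_toGreen⟩,
    ⟨S.toFrobeniusToGreen⟩⟩

instance : (toFrobeniusFunctor.{u, w} G).IsEquivalence where

end GreenBispanCat

/-! ### Elements of box products -/

namespace BoxProduct

open FinGSet
open scoped MonoidalCategory.DayFunctor MonoidalCategory.ExternalProduct
open LawfulDayConvolutionMonoidalCategoryStruct

variable {G : Type u} [Group G] [Finite G] {X Y Z : FinGSet G} {c d e : SpanCat G}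
  {F F' H H' K L : SpanCat G ⊛⥤ Type w}

theorem congr_apply {A B : Type w} {f g : A ⟶ B} (h : f = g) (x : A) : f x = g x :=
  ConcreteCategory.congr_hom h x

/-- The element of the box product given by a pair of elements. -/
noncomputable def pr (x : F.functor.obj c) (y : H.functor.obj d) :
    (F ⊗ H).functor.obj (c ⊗ d) :=
  (DayFunctor.η F H).app (c, d) (x, y)

/-- The generator of the unit of the box product. -/
noncomputable def star : (𝟙_ (SpanCat G ⊛⥤ Type w)).functor.obj (𝟙_ (SpanCat G)) :=
  DayFunctor.ν (SpanCat G) (Type w) PUnit.unit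

theorem map_pr {c' d' : SpanCat G} (f : c ⟶ c') (g : d ⟶ d') (x : F.functor.obj c)
    (y : H.functor.obj d) : (F ⊗ H).functor.map (f ⊗ₘ g) (pr x y) =
      pr (F.functor.map f x) (H.functor.map g y) :=
  (congr_apply ((DayFunctor.η F H).naturality (Prod.mkHom f g)) (x, y)).symm

/-- Every element of a box product comes from a pair, as the box product is a pointwise Kan
extension. The proof compares two maps from the colimit to the set of propositions: the property in
question and the constant one. -/
theorem exists_pr (t : (F ⊗ H).functor.obj e) : ∃ (c d : SpanCat G) (u : c ⊗ d ⟶ e)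
    (x : F.functor.obj c) (y : H.functor.obj d), (F ⊗ H).functor.map u (pr x y) = t := by
  let _ := convolution (SpanCat G) (Type w) (SpanCat G ⊛⥤ Type w) F H
  let p (t : (F ⊗ H).functor.obj e) : Prop := ∃ (c d : SpanCat G) (u : c ⊗ d ⟶ e)
    (x : F.functor.obj c) (y : H.functor.obj d), (F ⊗ H).functor.map u (pr x y) = t
  have h := DayConvolution.convolution_hom_ext_at
    (ι (SpanCat G) (Type w) (SpanCat G ⊛⥤ Type w) |>.obj F)
    (ι (SpanCat G) (Type w) (SpanCat G ⊛⥤ Type w) |>.obj H) e (v := ULift.{w} Prop)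
    (f := ↾fun t => ULift.up (p t))
    (g := ↾fun _ => ULift.up True) fun {c d} u => by
      ext z
      have hp : p ((F ⊗ H).functor.map u (pr z.1 z.2)) := ⟨c, d, u, z.1, z.2, rfl⟩
      exact iff_of_true hp trivial
  exact of_eq_true (congrArg ULift.down (congr_apply h t))

/-- Every element of the unit comes from the generator, for the same reason as in `exists_pr`. -/
theorem exists_star (t : (𝟙_ (SpanCat G ⊛⥤ Type w)).functor.obj e) :
    ∃ u : 𝟙_ (SpanCat G) ⟶ e, (𝟙_ (SpanCat G ⊛⥤ Type w)).functor.map u star = t := by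
  let _ := convolutionUnit (SpanCat G) (Type w) (SpanCat G ⊛⥤ Type w)
  let p (t : (𝟙_ (SpanCat G ⊛⥤ Type w)).functor.obj e) : Prop :=
    ∃ u : 𝟙_ (SpanCat G) ⟶ e, (𝟙_ (SpanCat G ⊛⥤ Type w)).functor.map u star = t
  have h := DayConvolutionUnit.hom_ext
    (ι (SpanCat G) (Type w) (SpanCat G ⊛⥤ Type w) |>.obj (𝟙_ (SpanCat G ⊛⥤ Type w))) (c := e)
    (v := ULift.{w} Prop)
    (g := ↾fun t => ULift.up (p t))
    (h := ↾fun _ => ULift.up True) fun u => by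
      ext z
      have hp : p ((𝟙_ (SpanCat G ⊛⥤ Type w)).functor.map u star) := ⟨u, rfl⟩
      exact iff_of_true hp trivial
  exact of_eq_true (congrArg ULift.down (congr_apply h t))

theorem app_congr {α β : F ⟶ H} (h : α = β) (x : F.functor.obj c) :
    α.natTrans.app c x = β.natTrans.app c x := by rw [h]

theorem app_map (α : F ⟶ H) (u : c ⟶ d) (x : F.functor.obj c) :
    α.natTrans.app d (F.functor.map u x) = H.functor.map u (α.natTrans.app c x) :=
  congr_apply (α.natTrans.naturality u) x

theorem hom_ext {α β : F ⊗ H ⟶ K}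
    (h : ∀ (c d : SpanCat G) (x : F.functor.obj c) (y : H.functor.obj d),
      α.natTrans.app (c ⊗ d) (pr x y) = β.natTrans.app (c ⊗ d) (pr x y)) : α = β :=
  DayFunctor.tensor_hom_ext fun c d => by
    ext z
    exact h c d z.1 z.2

theorem hom_ext₃ {α β : (F ⊗ H) ⊗ K ⟶ L}
    (h : ∀ (c d e : SpanCat G) (x : F.functor.obj c) (y : H.functor.obj d) (z : K.functor.obj e),
      α.natTrans.app _ (pr (pr x y) z) = β.natTrans.app _ (pr (pr x y) z)) : α = β := by
  refine hom_ext fun c e t z => ?_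
  obtain ⟨c, d, u, x, y, rfl⟩ := exists_pr t
  have hz : pr ((F ⊗ H).functor.map u (pr x y)) z =
      ((F ⊗ H) ⊗ K).functor.map (u ⊗ₘ 𝟙 e) (pr (pr x y) z) := by
    rw [map_pr]
    exact congrArg _ (SpanCat.map_id_apply K.functor z).symm
  rw [hz, app_map, app_map, h]

theorem hom_ext_unit {α β : 𝟙_ (SpanCat G ⊛⥤ Type w) ⟶ F}
    (h : α.natTrans.app _ star = β.natTrans.app _ star) : α = β :=
  DayFunctor.unit_hom_ext (by ext z; exact h)

theorem hom_ext_left {α β : 𝟙_ (SpanCat G ⊛⥤ Type w) ⊗ F ⟶ K}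
    (h : ∀ (c : SpanCat G) (x : F.functor.obj c),
      α.natTrans.app _ (pr star x) = β.natTrans.app _ (pr star x)) : α = β := by
  refine hom_ext fun c d t z => ?_
  obtain ⟨u, rfl⟩ := exists_star t
  have hz : pr ((𝟙_ (SpanCat G ⊛⥤ Type w)).functor.map u star) z =
      (𝟙_ (SpanCat G ⊛⥤ Type w) ⊗ F).functor.map (u ⊗ₘ 𝟙 d) (pr star z) := by
    rw [map_pr]
    exact congrArg _ (SpanCat.map_id_apply F.functor z).symm
  rw [hz, app_map, app_map, h]

theorem hom_ext_right {α β : F ⊗ 𝟙_ (SpanCat G ⊛⥤ Type w) ⟶ K}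
    (h : ∀ (c : SpanCat G) (x : F.functor.obj c),
      α.natTrans.app _ (pr x star) = β.natTrans.app _ (pr x star)) : α = β := by
  refine hom_ext fun c d z t => ?_
  obtain ⟨u, rfl⟩ := exists_star t
  have hz : pr z ((𝟙_ (SpanCat G ⊛⥤ Type w)).functor.map u star) =
      (F ⊗ 𝟙_ (SpanCat G ⊛⥤ Type w)).functor.map (𝟙 c ⊗ₘ u) (pr z star) := by
    rw [map_pr]
    exact congrArg (fun a => pr a _) (SpanCat.map_id_apply F.functor z).symm
  rw [hz, app_map, app_map, h]

theorem tensorHom_pr (f : F ⟶ F') (g : H ⟶ H') (x : F.functor.obj c) (y : H.functor.obj d) :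
    (f ⊗ₘ g).natTrans.app _ (pr x y) = pr (f.natTrans.app c x) (g.natTrans.app d y) :=
  congr_apply
    (convolutionExtensionUnit_comp_ι_map_tensorHom_app (SpanCat G) (Type w) f g c d) (x, y)

theorem whiskerLeft_pr (F) (g : H ⟶ H') (x : F.functor.obj c) (y : H.functor.obj d) :
    (F ◁ g).natTrans.app _ (pr x y) = pr x (g.natTrans.app d y) :=
  congr_apply
    (convolutionExtensionUnit_comp_ι_map_whiskerLeft_app (Type w) F g c d) (x, y)

theorem whiskerRight_pr (f : F ⟶ F') (H) (x : F.functor.obj c) (y : H.functor.obj d) :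
    (f ▷ H).natTrans.app _ (pr x y) = pr (f.natTrans.app c x) y :=
  congr_apply
    (convolutionExtensionUnit_comp_ι_map_whiskerRight_app (SpanCat G) (Type w) f H c d) (x, y)

theorem associator_pr (x : F.functor.obj c) (y : H.functor.obj d) (z : K.functor.obj e) :
    (α_ F H K).hom.natTrans.app _ (pr (pr x y) z) =
      (F ⊗ (H ⊗ K)).functor.map (α_ c d e).inv (pr x (pr y z)) :=
  congr_apply (associator_hom_unit_unit (Type w) F H K c d e) ((x, y), z)

theorem leftUnitor_pr (x : F.functor.obj c) :
    (λ_ F).hom.natTrans.app _ (pr star x) = F.functor.map (λ_ c).inv x :=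
  congr_apply (leftUnitor_hom_unit_app (Type w) F c) (PUnit.unit, x)

theorem rightUnitor_pr (x : F.functor.obj c) :
    (ρ_ F).hom.natTrans.app _ (pr x star) = F.functor.map (ρ_ c).inv x :=
  congr_apply (rightUnitor_hom_unit_app (Type w) F c) (x, PUnit.unit)

theorem braiding_pr (x : F.functor.obj c) (y : H.functor.obj d) :
    (β_ F H).hom.natTrans.app _ (pr x y) =
      (H ⊗ F).functor.map (β_ d c).hom (pr y x) := by
  let _ := convolution (SpanCat G) (Type w) (SpanCat G ⊛⥤ Type w) F H
  let _ := convolution (SpanCat G) (Type w) (SpanCat G ⊛⥤ Type w) H F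
  exact congr_apply
    (DayConvolution.unit_app_braiding_hom_app
      (ι (SpanCat G) (Type w) (SpanCat G ⊛⥤ Type w) |>.obj F)
      (ι (SpanCat G) (Type w) (SpanCat G ⊛⥤ Type w) |>.obj H) c d) (x, y)

theorem tensorDesc_pr (α : F.functor ⊠ H.functor ⟶ tensor (SpanCat G) ⋙ K.functor)
    (x : F.functor.obj c) (y : H.functor.obj d) :
    (DayFunctor.tensorDesc α).natTrans.app _ (pr x y) = α.app (c, d) (x, y) :=
  congr_apply (DayFunctor.η_comp_tensorDesc_app α c d) (x, y)

theorem unitDesc_star (φ : 𝟙_ (Type w) ⟶ F.functor.obj (𝟙_ (SpanCat G))) :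
    (DayFunctor.unitDesc φ).natTrans.app _ star = φ PUnit.unit :=
  congr_apply (DayFunctor.ν_comp_unitDesc φ) PUnit.unit

end BoxProduct

/-! ### Green semirings -/

namespace FrobeniusFunctor

open FinGSet
open scoped MonoidalCategory.DayFunctor MonoidalCategory.ExternalProduct

variable {G : Type u} [Group G] {X Y Z W A B X' Y' : FinGSet G}

variable (S : FrobeniusFunctor.{u, w} G)

/-- The exterior product of two elements. -/
def ext₂ (x : S.val X) (y : S.val Y) : S.val (X.prod Y) := S.res (fst X Y) x * S.res (snd X Y) y

/-- The exterior product is natural for spans. For transfers this is Frobenius reciprocity combined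
with base change along the projections. -/
theorem map_ext₂ (ω : GSpan X X') (ω' : GSpan Y Y') (x : S.val X) (y : S.val Y) :
    S.M.map (SpanCat.mk (ω.prod ω')) (S.ext₂ x y) =
      S.ext₂ (S.M.map (SpanCat.mk ω) x : S.val X') (S.M.map (SpanCat.mk ω') y : S.val Y') := by
  have e (x : S.val X) : S.M.map (SpanCat.mk ω) x = S.tr ω.q (S.res ω.p x) :=
    SpanCat.map_mk_apply S.M ω x
  have e' (y : S.val Y) : S.M.map (SpanCat.mk ω') y = S.tr ω'.q (S.res ω'.p y) :=
    SpanCat.map_mk_apply S.M ω' y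
  have h₁ : IsFibreProduct (fst ω.A Y') (SpanCat.prodMap ω.q (MulActionHom.id G)) ω.q
      (fst X' Y') :=
    ⟨fun _ => rfl, fun a b h h' => Prod.ext h (Prod.ext_iff.1 h').2,
      fun a b h => ⟨(a, b.2), rfl, Prod.ext h rfl⟩⟩
  have h₂ : IsFibreProduct (snd X' ω'.A) (SpanCat.prodMap (MulActionHom.id G) ω'.q) ω'.q
      (snd X' Y') :=
    ⟨fun _ => rfl, fun a b h h' => Prod.ext (Prod.ext_iff.1 h').1 h,
      fun a b h => ⟨(b.1, a), rfl, Prod.ext rfl h⟩⟩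
  have h₃ : IsFibreProduct (SpanCat.prodMap (MulActionHom.id G) ω'.q : ω.A.prod ω'.A →[G] _)
      (SpanCat.prodMap ω.q (MulActionHom.id G))
      (SpanCat.prodMap ω.q (MulActionHom.id G)) (SpanCat.prodMap (MulActionHom.id G) ω'.q) :=
    ⟨fun _ => rfl, fun a b h h' => Prod.ext (Prod.ext_iff.1 h).1 (Prod.ext_iff.1 h').2,
      fun a b h => ⟨(a.1, b.2), Prod.ext rfl (Prod.ext_iff.1 h).2.symm,
        Prod.ext (Prod.ext_iff.1 h).1 rfl⟩⟩
  refine (SpanCat.map_mk_apply S.M (ω.prod ω') _).trans ?_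
  change S.tr (ω.prod ω').q (S.res (ω.prod ω').p (S.ext₂ x y)) = _
  rw [e, e', ext₂, ext₂, S.res_tr h₁, S.res_tr h₂, S.tr_mul_tr h₃, map_mul]
  simp only [res_res]
  rfl

theorem ext₂_assoc (x : S.val X) (y : S.val Y) (z : S.val Z) :
    S.ext₂ (S.ext₂ x y) z = S.res (SpanCat.assocHom X Y Z) (S.ext₂ x (S.ext₂ y z)) := by
  simp only [ext₂, map_mul, res_res, mul_assoc]
  rfl

theorem ext₂_comm (x : S.val X) (y : S.val Y) :
    S.ext₂ x y = S.res (SpanCat.swap X Y) (S.ext₂ y x) := by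
  simp only [ext₂, map_mul, res_res, mul_comm]
  rfl

theorem one_ext₂ (x : S.val X) : S.ext₂ (1 : S.val (point G)) x = S.res (SpanCat.leftHom X) x := by
  rw [ext₂, map_one, one_mul]
  rfl

theorem ext₂_one (x : S.val X) : S.ext₂ x (1 : S.val (point G)) = S.res (SpanCat.rightHom X) x := by
  rw [ext₂, map_one, mul_one]
  rfl

/-- The interior product is the restriction of the exterior one to the diagonal. -/
theorem mul_eq_res_ext₂ (x y : S.val X) :
    x * y = S.res (lift (MulActionHom.id G) (MulActionHom.id G)) (S.ext₂ x y) := by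
  rw [ext₂, map_mul, res_res, res_res]
  exact (congrArg₂ _ (S.res_id x) (S.res_id y)).symm

end FrobeniusFunctor

namespace GreenSemiring

open FinGSet BoxProduct
open scoped MonoidalCategory.DayFunctor MonoidalCategory.ExternalProduct

variable {G : Type u} [Group G] [Finite G] {X Y Z W A B X' Y' : FinGSet G}

section toSemiring

variable (S : FrobeniusFunctor.{u, w} G)

/-- The exterior product as a natural transformation. -/
def extTrans : (S.M ⊠ S.M) ⟶ tensor (SpanCat G) ⋙ S.M where
  app c := ↾fun z => S.ext₂ (X := c.1.toGSet) (Y := c.2.toGSet) z.1 z.2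
  naturality c d f := by
    obtain ⟨ω, hω⟩ := SpanCat.exists_mk (X := c.1.toGSet) (Y := d.1.toGSet) f.1
    obtain ⟨ω', hω'⟩ := SpanCat.exists_mk (X := c.2.toGSet) (Y := d.2.toGSet) f.2
    obtain ⟨f₁, f₂⟩ := f
    obtain rfl := hω
    obtain rfl := hω'
    ext z
    exact (S.map_ext₂ ω ω' z.1 z.2).symm

/-- The multiplication of the commutative monoid attached to a multiplication. -/
noncomputable def mulHom : (⟨S.M⟩ : SpanCat G ⊛⥤ Type w) ⊗ ⟨S.M⟩ ⟶ ⟨S.M⟩ :=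
  DayFunctor.tensorDesc (extTrans S)

/-- The unit of the commutative monoid attached to a multiplication. -/
noncomputable def oneHom : 𝟙_ (SpanCat G ⊛⥤ Type w) ⟶ ⟨S.M⟩ :=
  DayFunctor.unitDesc (↾fun _ => (1 : S.val (point G)))

theorem mulHom_pr (x : S.val X) (y : S.val Y) :
    (mulHom S).natTrans.app (.of (X.prod Y))
      (pr (F := ⟨S.M⟩) (H := ⟨S.M⟩) (c := .of X) (d := .of Y) x y) = S.ext₂ x y :=
  tensorDesc_pr (F := ⟨S.M⟩) (H := ⟨S.M⟩) (K := ⟨S.M⟩) (c := .of X) (d := .of Y) (extTrans S) x y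

theorem oneHom_star : (oneHom S).natTrans.app (.of (point G)) star = (1 : S.val (point G)) :=
  unitDesc_star _

noncomputable instance : MonObj (⟨S.M⟩ : SpanCat G ⊛⥤ Type w) where
  one := oneHom S
  mul := mulHom S
  one_mul := hom_ext_left fun c x => by
    refine (congrArg ((mulHom S).natTrans.app _) ((whiskerRight_pr _ _ _ _).trans
      (congrArg (fun a => pr a x) (oneHom_star S)))).trans ?_
    refine ((mulHom_pr S _ _).trans (S.one_ext₂ x)).trans ?_
    exact ((leftUnitor_pr (F := ⟨S.M⟩) x).trans
      (SpanCat.map_T_eq_res S.M _ _ (fun _ => rfl) (fun _ => rfl) x)).symm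
  mul_one := hom_ext_right fun c x => by
    refine (congrArg ((mulHom S).natTrans.app _) ((whiskerLeft_pr _ _ _ _).trans
      (congrArg (fun a => pr x a) (oneHom_star S)))).trans ?_
    refine ((mulHom_pr S _ _).trans (S.ext₂_one x)).trans ?_
    exact ((rightUnitor_pr (F := ⟨S.M⟩) x).trans
      (SpanCat.map_T_eq_res S.M _ _ (fun _ => rfl) (fun _ => rfl) x)).symm
  mul_assoc := hom_ext₃ fun c d e x y z => by
    refine (congrArg ((mulHom S).natTrans.app _) ((whiskerRight_pr _ _ _ _).trans
      (congrArg (fun a => pr a z) (mulHom_pr S x y)))).trans ?_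
    refine ((mulHom_pr S _ _).trans (S.ext₂_assoc x y z)).trans ?_
    symm
    refine (congrArg (fun t => (mulHom S).natTrans.app _ (((⟨S.M⟩ : SpanCat G ⊛⥤ Type w) ◁
      mulHom S).natTrans.app _ t)) (associator_pr (F := ⟨S.M⟩) (H := ⟨S.M⟩) (K := ⟨S.M⟩)
        x y z)).trans ?_
    refine (congrArg ((mulHom S).natTrans.app _) (app_map _ _ _)).trans ((app_map _ _ _).trans ?_)
    refine (congrArg (S.M.map _) ((congrArg ((mulHom S).natTrans.app _)
      ((whiskerLeft_pr _ _ _ _).trans (congrArg (fun a => pr x a) (mulHom_pr S y z)))).trans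
        (mulHom_pr S _ _))).trans ?_
    exact SpanCat.map_T_eq_res S.M _ _ (fun _ => rfl) (fun _ => rfl) _

instance : IsCommMonObj (⟨S.M⟩ : SpanCat G ⊛⥤ Type w) where
  mul_comm := hom_ext fun c d x y => by
    refine (congrArg ((mulHom S).natTrans.app _)
      (braiding_pr (F := ⟨S.M⟩) (H := ⟨S.M⟩) x y)).trans ?_
    refine ((app_map _ _ _).trans (congrArg (S.M.map _) (mulHom_pr S y x))).trans ?_
    refine (SpanCat.map_T_eq_res S.M (SpanCat.swap d.toGSet c.toGSet)
      (SpanCat.swap c.toGSet d.toGSet) (fun _ => rfl) (fun _ => rfl) _).trans ?_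
    exact (S.ext₂_comm x y).symm.trans (mulHom_pr S x y).symm

/-- The functor from Mackey functors with multiplications to Green semirings. -/
noncomputable def ofFrobenius (G : Type u) [Group G] [Finite G] :
    FrobeniusFunctor.{u, w} G ⥤ GreenSemiring.{u, w} G where
  obj S := ⟨⟨⟨S.M⟩⟩, (SpanCat.isMackey_iff_isAdditive S.M).2 S.isAdditive⟩
  map {S S'} f :=
    ⟨CommMon.homMk
      { hom := ⟨f.trans⟩
        isMonHom_hom :=
          { one_hom := hom_ext_unit <| by
              refine (congrArg (f.trans.app _) (oneHom_star S)).trans ?_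
              exact (f.map_one _).trans (oneHom_star S').symm
            mul_hom := hom_ext fun c d x y => by
              refine (congrArg (f.trans.app _) (mulHom_pr S x y)).trans (Eq.trans ?_
                ((congrArg ((mulHom S').natTrans.app _) (tensorHom_pr (F := ⟨S.M⟩) (H := ⟨S.M⟩)
                  (F' := ⟨S'.M⟩) (H' := ⟨S'.M⟩) ⟨f.trans⟩ ⟨f.trans⟩ x y)).trans
                    (mulHom_pr S' _ _)).symm)
              exact (f.map_mul _ _).trans (congrArg₂ _ (f.app_res _ _) (f.app_res _ _)) } }⟩

instance : (ofFrobenius.{u, w} G).Faithful where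
  map_injective {S S'} f f' h := FrobeniusFunctor.Hom.ext <|
    congrArg (fun k => k.hom.hom.hom.natTrans) h

instance : (ofFrobenius.{u, w} G).Full where
  map_surjective {S S'} φ := by
    let α : S.M ⟶ S'.M := φ.hom.hom.hom.natTrans
    have hα : oneHom S ≫ φ.hom.hom.hom = oneHom S' := IsMonHom.one_hom φ.hom.hom.hom
    have hα' : mulHom S ≫ φ.hom.hom.hom = (φ.hom.hom.hom ⊗ₘ φ.hom.hom.hom) ≫ mulHom S' :=
      IsMonHom.mul_hom φ.hom.hom.hom
    have h₁ : α.app (.of (point G)) (1 : S.val (point G)) = (1 : S'.val (point G)) :=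
      (congrArg _ (oneHom_star S)).symm.trans ((app_congr hα star).trans (oneHom_star S'))
    have h₂ {X Y : FinGSet G} (x : S.val X) (y : S.val Y) : α.app (.of (X.prod Y)) (S.ext₂ x y) =
        S'.ext₂ (X := X) (Y := Y) (α.app (.of X) x) (α.app (.of Y) y) :=
      (congrArg _ (mulHom_pr S x y)).symm.trans ((app_congr hα' (pr (F := ⟨S.M⟩)
        (H := ⟨S.M⟩) (c := .of X) (d := .of Y) x y)).trans ((congrArg _ (tensorHom_pr
          (F := ⟨S.M⟩) (H := ⟨S.M⟩) (F' := ⟨S'.M⟩) (H' := ⟨S'.M⟩) φ.hom.hom.hom φ.hom.hom.hom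
            x y)).trans (mulHom_pr S' _ _)))
    refine ⟨⟨α, fun {X} x y => ?_, fun X => ?_⟩, rfl⟩
    · rw [S.mul_eq_res_ext₂, S'.mul_eq_res_ext₂]
      exact (SpanCat.res_app α _ _).trans (congrArg _ (h₂ x y))
    · rw [← map_one (S.res X.toPoint), ← map_one (S'.res X.toPoint)]
      exact (SpanCat.res_app α _ _).trans (congrArg _ h₁)

end toSemiring

section ofSemiring

variable (A : CommMon (SpanCat G ⊛⥤ Type w))

/-- The exterior product of two elements of a commutative monoid for the box product. -/
noncomputable def ext₂ (x : A.X.functor.obj (.of X)) (y : A.X.functor.obj (.of Y)) :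
    A.X.functor.obj (.of (X.prod Y)) :=
  (MonObj.mul (X := A.X)).natTrans.app (.of (X.prod Y)) (pr (c := .of X) (d := .of Y) x y)

/-- The element over the point given by the unit. -/
noncomputable def pointOne : A.X.functor.obj (.of (point G)) :=
  (MonObj.one (X := A.X)).natTrans.app (.of (point G)) star

variable {A} in
theorem map_ext₂ (ω : GSpan X X') (ω' : GSpan Y Y') (x : A.X.functor.obj (.of X))
    (y : A.X.functor.obj (.of Y)) : A.X.functor.map (SpanCat.mk (ω.prod ω')) (ext₂ A x y) =
      ext₂ A (A.X.functor.map (SpanCat.mk ω) x) (A.X.functor.map (SpanCat.mk ω') y) :=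
  (app_map (MonObj.mul (X := A.X)) (SpanCat.mk (ω.prod ω')) _).symm.trans
    (congrArg _ (map_pr (SpanCat.mk ω) (SpanCat.mk ω') x y))

variable {A} in
theorem res_ext₂ (f : X' →[G] X) (f' : Y' →[G] Y) (x : A.X.functor.obj (.of X))
    (y : A.X.functor.obj (.of Y)) : ext₂ A (SpanCat.res A.X.functor f x)
      (SpanCat.res A.X.functor f' y) =
        SpanCat.res A.X.functor (SpanCat.prodMap f f') (ext₂ A x y) :=
  (map_ext₂ (GSpan.R f) (GSpan.R f') x y).symm

variable {A} in
theorem one_ext₂ (x : A.X.functor.obj (.of X)) :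
    ext₂ A (pointOne A) x = SpanCat.res A.X.functor (SpanCat.leftHom X) x := by
  have h := app_congr (MonObj.one_mul A.X) (pr (c := 𝟙_ (SpanCat G)) (d := .of X) star x)
  refine (Eq.symm ?_).trans (h.trans ((leftUnitor_pr x).trans
    (SpanCat.map_T_eq_res A.X.functor _ _ (fun _ => rfl) (fun _ => rfl) x)))
  exact congrArg _ (whiskerRight_pr _ _ _ _)

variable {A} in
theorem ext₂_comm (x : A.X.functor.obj (.of X)) (y : A.X.functor.obj (.of Y)) :
    SpanCat.res A.X.functor (SpanCat.swap X Y) (ext₂ A y x) = ext₂ A x y := by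
  have h := app_congr (IsCommMonObj.mul_comm A.X) (pr (c := .of X) (d := .of Y) x y)
  refine Eq.trans ?_ h
  refine Eq.trans ?_ (congrArg _ (braiding_pr _ _)).symm
  refine Eq.trans ?_ (app_map _ _ _).symm
  exact (SpanCat.map_T_eq_res A.X.functor (SpanCat.swap Y X) (SpanCat.swap X Y) (fun _ => rfl)
    (fun _ => rfl) _).symm

variable {A} in
theorem ext₂_assoc (x : A.X.functor.obj (.of X)) (y : A.X.functor.obj (.of Y))
    (z : A.X.functor.obj (.of Z)) : ext₂ A (ext₂ A x y) z =
      SpanCat.res A.X.functor (SpanCat.assocHom X Y Z) (ext₂ A x (ext₂ A y z)) := by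
  have h := app_congr (MonObj.mul_assoc A.X)
    (pr (c := .of X ⊗ .of Y) (d := .of Z) (pr (c := .of X) (d := .of Y) x y) z)
  refine (Eq.symm ?_).trans (h.trans ?_)
  · exact congrArg _ (whiskerRight_pr _ _ _ _)
  · refine (congrArg (fun t => (MonObj.mul (X := A.X)).natTrans.app _
      ((A.X ◁ MonObj.mul (X := A.X)).natTrans.app _ t)) (associator_pr x y z)).trans ?_
    refine (congrArg _ (app_map _ _ _)).trans ((app_map _ _ _).trans ?_)
    refine (SpanCat.map_T_eq_res A.X.functor (SpanCat.assocInv X Y Z) (SpanCat.assocHom X Y Z)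
      (fun _ => rfl) (fun _ => rfl) _).trans ?_
    exact congrArg (fun t => SpanCat.res A.X.functor _ ((MonObj.mul (X := A.X)).natTrans.app _ t))
      (whiskerLeft_pr _ _ _ _)

/-- The multiplication on the elements over `X`: restrict the exterior product to the diagonal. -/
noncomputable def mul (x y : A.X.functor.obj (.of X)) : A.X.functor.obj (.of X) :=
  SpanCat.res A.X.functor (lift (MulActionHom.id G) (MulActionHom.id G)) (ext₂ A x y)

/-- The unit over `X`. -/
noncomputable def one (X : FinGSet G) : A.X.functor.obj (.of X) :=
  SpanCat.res A.X.functor X.toPoint (pointOne A)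

variable {A}

theorem res_mul (f : X →[G] Y) (x y : A.X.functor.obj (.of Y)) :
    SpanCat.res A.X.functor f (mul A x y) =
      mul A (SpanCat.res A.X.functor f x) (SpanCat.res A.X.functor f y) := by
  rw [mul, mul, res_ext₂, SpanCat.res_res, SpanCat.res_res]
  rfl

theorem mul_comm' (x y : A.X.functor.obj (.of X)) : mul A x y = mul A y x := by
  rw [mul, mul, ← ext₂_comm, SpanCat.res_res]
  rfl

theorem one_mul' (x : A.X.functor.obj (.of X)) : mul A (one A X) x = x := by
  have h := res_ext₂ X.toPoint (MulActionHom.id G) (pointOne A) x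
  rw [SpanCat.res_id] at h
  rw [mul, one, h, one_ext₂, SpanCat.res_res, SpanCat.res_res]
  exact SpanCat.res_id _ x

theorem mul_assoc' (x y z : A.X.functor.obj (.of X)) :
    mul A (mul A x y) z = mul A x (mul A y z) := by
  have h := res_ext₂ (lift (MulActionHom.id G) (MulActionHom.id G)) (MulActionHom.id G)
    (ext₂ A x y) z
  have h' := res_ext₂ (MulActionHom.id G) (lift (MulActionHom.id G) (MulActionHom.id G))
    x (ext₂ A y z)
  rw [SpanCat.res_id] at h h'
  rw [mul, mul, mul, mul, h, h', ext₂_assoc, SpanCat.res_res, SpanCat.res_res, SpanCat.res_res]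
  rfl

/-- Frobenius reciprocity follows from naturality of the exterior product for the transfer along
`f × id` and from base change along the diagonal of `Y`. -/
theorem frobenius (f : X →[G] Y) (x : A.X.functor.obj (.of X)) (y : A.X.functor.obj (.of Y)) :
    SpanCat.tr A.X.functor f (mul A x (SpanCat.res A.X.functor f y)) =
      mul A (SpanCat.tr A.X.functor f x) y := by
  have h := res_ext₂ (MulActionHom.id G) f x y
  rw [SpanCat.res_id] at h
  have h' := map_ext₂ (GSpan.T f) (GSpan.id Y) x y
  replace h' : SpanCat.tr A.X.functor (SpanCat.prodMap f (MulActionHom.id G)) (ext₂ A x y) =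
      ext₂ A (SpanCat.tr A.X.functor f x) y :=
    h'.trans (congrArg _ (SpanCat.map_id_apply _ y))
  have hf : IsFibreProduct (lift (MulActionHom.id G) f) f
      (SpanCat.prodMap f (MulActionHom.id G) : X.prod Y →[G] Y.prod Y)
      (lift (MulActionHom.id G) (MulActionHom.id G)) :=
    ⟨fun _ => rfl, fun a b h _ => (Prod.ext_iff.1 h).1, fun a b h => ⟨a.1, Prod.ext rfl
      ((Prod.ext_iff.1 h).1.trans (Prod.ext_iff.1 h).2.symm), (Prod.ext_iff.1 h).1⟩⟩
  rw [mul, mul, h, ← h', SpanCat.res_tr _ hf, SpanCat.res_res]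
  rfl

/-- The Mackey functor with multiplications given by a commutative monoid for the box product. -/
noncomputable def toFrobenius (hA : IsMackey G A.X.functor) : FrobeniusFunctor.{u, w} G where
  M := A.X.functor
  isAdditive := (SpanCat.isMackey_iff_isAdditive _).1 hA
  mon X :=
    { mul := mul A
      one := one A X
      mul_assoc := mul_assoc'
      one_mul := one_mul'
      mul_one := fun x => (mul_comm' _ _).trans (one_mul' x)
      mul_comm := mul_comm' }
  res_mul := res_mul
  res_one f := SpanCat.res_res _ f _ _
  frobenius := frobenius

/-- The exterior product can be recovered from the interior one, since the composite of the diagonal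
of `X × Y` with the product of the two projections is the identity. -/
theorem toFrobenius_ext₂ (hA : IsMackey G A.X.functor) (x : A.X.functor.obj (.of X))
    (y : A.X.functor.obj (.of Y)) : (toFrobenius hA).ext₂ (X := X) (Y := Y) x y = ext₂ A x y := by
  change SpanCat.res A.X.functor _ (ext₂ A (SpanCat.res A.X.functor (fst X Y) x)
    (SpanCat.res A.X.functor (snd X Y) y)) = _
  rw [res_ext₂, SpanCat.res_res]
  exact SpanCat.res_id _ _

/-- The Green semiring given by the interior multiplication of a Green semiring is the original
one. -/
noncomputable def ofFrobeniusToFrobenius (A : GreenSemiring.{u, w} G) :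
    (ofFrobenius G).obj (toFrobenius A.property) ≅ A :=
  ObjectProperty.isoMk _ <| CommMon.mkIso
    (M := ((ofFrobenius G).obj (toFrobenius A.property)).obj) (N := A.obj) (Iso.refl A.obj.X)
    (hom_ext_unit <| by
      refine (oneHom_star (toFrobenius A.property)).trans ?_
      exact SpanCat.res_id _ _)
    (hom_ext fun c d x y => by
      refine (mulHom_pr (toFrobenius A.property) x y).trans ?_
      refine (toFrobenius_ext₂ A.property _ _).trans ?_
      exact congrArg _ (tensorHom_pr (𝟙 A.obj.X) (𝟙 A.obj.X) x y).symm)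

end ofSemiring

instance : (ofFrobenius.{u, w} G).EssSurj where
  mem_essImage A := ⟨toFrobenius A.property, ⟨ofFrobeniusToFrobenius A⟩⟩

instance : (ofFrobenius.{u, w} G).IsEquivalence where

end GreenSemiring

theorem mainTheorem9 (G : Type u) [Group G] [Finite G] :
    Nonempty (GreenFunctor.{u, w} G ≌ GreenSemiring.{u, w} G) :=
  ⟨(GreenBispanCat.toFrobeniusFunctor G).asEquivalence.trans
    (GreenSemiring.ofFrobenius G).asEquivalence⟩
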